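/- **Conventions.** Let $\mathbb K$ be a field. A $\mathbb K$-linear quiver $Q$ with vertex set $O$ is a family of $\mathbb K$-vector spaces $Q(a,b)$, $a,b\in O$; quiver maps are families of linear maps. The quivers on $O$ form a monoidal category with $(Q\otimes P)(a,b)=\bigoplus_{c\in O}Q(a,c)\otimes_{\mathbb K}P(c,b)$ and unit $\mathbb K_O$ ($\mathbb K$ on the diagonal and $0$ elsewhere). For a map of sets $f:O\to P$ and a quiver $Q$ on $P$ put $(f^*Q)(a,b)=Q(f(a),f(b))$; there are evident maps $f^*Q\otimes f^*R\to f^*(Q\otimes R)$ and $\mathbb K_O\to f^*\mathbb K_P$. Let $\mathbf{fint}$ be the category of the ordinals $[n]=\{0<\dots<n\}$, $n\ge 0$, and the order preserving maps that preserve both endpoints, with monoidal structure $[m]\otimes[n]=[m+n]$. A *templicial vector space* $(X,O)$ is a set $O$ with a colax monoidal functor $X:\mathbf{fint}^{op}\to\mathbb K\text{-}\mathrm{Quiv}_O$ whose counit $\varepsilon:X_0\to\mathbb K_O$ is an isomorphism. Write $d_j:X_n\to X_{n-1}$ $(0<j<n)$, $s_j:X_n\to X_{n+1}$ $(0\le j\le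 n)$ for its inner faces and degeneracies, and $\mu_{i_1,\dots,i_l}:X_{i_1+\dots+i_l}\to X_{i_1}\otimes\dots\otimes X_{i_l}$ for its (iterated) comultiplications. A *templicial map* $(X,O)\to(Y,P)$ is a map of sets $f:O\to P$ with a natural transformation $\alpha_n:X_n\to f^*Y_n$ compatible with comultiplications and counits. An *$A_\infty$-category* $\mathcal A$ is a set $\mathrm{Ob}\,\mathcal A$ with quivers $\mathcal A_i$ $(i\in\mathbb Z)$ on it, quiver maps $m_k:\mathcal A^{\otimes k}\to\mathcal A$ of degree $k-2$ $(k\ge1)$ and $u:\mathbb K_{\mathrm{Ob}\,\mathcal A}\to\mathcal A_0$, such that for all $k\ge 1$ $$\sum_{r+s+t=k,\ s>0}(-1)^{r+st}\,m_{r+1+t}(\mathrm{id}^{\otimes r}\otimes m_s\otimes\mathrm{id}^{\otimes t})=0$$ (with the Koszul sign rule), $m_1u=0$, $m_2(u\otimes\mathrm{id})=\mathrm{id}=m_2(\mathrm{id}\otimes u)$, and, for $k>2$, $m_k$ vanishes as soon as one of its arguments is a unit. Write $\partial=m_1$ and $\epsilon_g(i_1,\dots,i_l)=\sum_{q=1}^{l-1}(l-q)(i_q-1)$.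 A *necklace* is a wedge $U=\Delta^{n_1}\vee\dots\vee\Delta^{n_l}$ with $l\geq 0$ and all $n_i>0$, the last vertex of each bead being identified with the first vertex of the next; put $\ell(U)=l$, $\dim(U^{<k})=\sum_{i<k}(n_i-1)$, $\epsilon(U)=\epsilon_g(n_1,\dots,n_l)$ and $(s\mathcal A)_U=\mathcal A_{n_1-1}\otimes\dots\otimes\mathcal A_{n_l-1}$. The *templicial nerve* $N(\mathcal A)=N^{A_\infty}_{\mathbb K}(\mathcal A)$ is the following templicial vector space with vertex set $\mathrm{Ob}\,\mathcal A$. The quiver $N(\mathcal A)_n$ consists of the families $y=(y_g)_g$ with $y_g\in(s\mathcal A)_U$, indexed by the injective endpoint-preserving necklace maps $g:U\hookrightarrow\Delta^n$, such that for all $g$ and all beads $\Delta^{n_k}$ of $U$ $$\sum_{\nu:S\hookrightarrow\Delta^{n_k}}(-1)^{\epsilon(S)+\ell(S)\dim(U^{<k})}(\mathrm{id}^{\otimes k-1}\otimes m_{\ell(S)}\otimes\mathrm{id}^{\otimes \ell(U)-k})(y_{g\circ_k\nu})=\sum_{j=1}^{n_k-1}(-1)^{j-1}y_{g\circ_k\delta_j},$$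 where $\nu$ runs over the ways of cutting the bead $\Delta^{n_k}$ into a wedge of beads with the same vertices, $g\circ_k\nu$ and $g\circ_k\delta_j$ are obtained from $g$ by precomposing with $\nu$, respectively the inner face $\delta_j$, on the $k$-th bead, and the Koszul sign rule applies. The structure map of $\varphi:[m]\to[n]$ is $(\varphi^*y)_g=\bar e(y_{g'})$, where $\varphi g=g'e$ with $e$ surjective on each bead and $g'$ injective; here $\bar e$ is the tensor product over the beads of the maps which are the identity for an identity of a bead, $u$ for $\Delta^1\to\Delta^0$ and $0$ for every other surjection of a bead. The comultiplication $\mu_{p,q}$ sends $y$ to the element of $N(\mathcal A)_p\otimes N(\mathcal A)_q$ with components $(y_{g_1\vee g_2})_{g_1,g_2}$, and the counit is the identification $N(\mathcal A)_0=\mathbb K_{\mathrm{Ob}\,\mathcal A}$. Let $\pi_n:N(\mathcal A)_n\to\mathcal A_{n-1}$, $y\mapsto y_{\mathrm{id}_{\Delta^n}}$, for $n>0$. **Theorem.** Let $(X,O)$ be a templicial vector space and $\mathcal A$ an $A_\infty$-category. Then $(f,\alpha)\mapsto\big(f,(\beta_n=f^*(\pi_n)\circ\alpha_n)_{n>0}\big)$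 is a bijection from the set of templicial maps $X\to N^{A_\infty}_{\mathbb K}(\mathcal A)$ to the set of pairs consisting of * a map of sets $f:O\to\mathrm{Ob}\,\mathcal A$, and * for all $n>0$ a quiver map $\beta_n:X_n\to f^*\mathcal A_{n-1}$, subject to the following conditions: * for all $n\ge0$ and $0\le j\le n$: $\ \beta_{n+1}\circ s_j=u$ if $n=0$ (that is, the composite $X_0\xrightarrow{\varepsilon}\mathbb K_O\to f^*\mathbb K_{\mathrm{Ob}\,\mathcal A}\xrightarrow{f^*u}f^*\mathcal A_0$), and $\ \beta_{n+1}\circ s_j=0$ if $n>0$; * for all $n>0$: $$\partial\beta_n=\sum_{j=1}^{n-1}(-1)^{j-1}\beta_{n-1}d_j-\sum_{\substack{l\ge2,\ i_1,\dots,i_l>0\\ i_1+\dots+i_l=n}}(-1)^{\epsilon_g(i_1,\dots,i_l)}\,m_l(\beta_{i_1}\otimes\dots\otimes\beta_{i_l})\,\mu_{i_1,\dots,i_l},$$ where $m_l$ denotes the multiplication of $f^*\mathcal A$ and $(\beta_{i_1}\otimes\dots\otimes\beta_{i_l})$ involves no signs. -/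

import Mathlib

open CategoryTheory MonoidalCategory
open scoped TensorProduct DirectSum

universe u

noncomputable section

namespace Templicial

/-- A `K`-linear quiver with vertex set `O`. -/
structure Quiv (K : Type u) [Field K] (O : Type u) where
  obj : O → O → Type u
  [acg : ∀ a b, AddCommGroup (obj a b)]
  [mod : ∀ a b, Module K (obj a b)]

namespace Quiv

variable {K : Type u} [Field K] {O : Type u}

instance : CoeFun (Quiv K O) (fun _ => O → O → Type u) := ⟨Quiv.obj⟩

attribute [instance] Quiv.acg Quiv.mod

/-- A quiver morphism is a family of `K`-linear maps. -/
@[ext] structure Hom (Q P : Quiv K O) where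
  app : ∀ a b, Q a b →ₗ[K] P a b

instance : Category (Quiv K O) where
  Hom := Hom
  id Q := ⟨fun _ _ => LinearMap.id⟩
  comp f g := ⟨fun a b => (g.app a b).comp (f.app a b)⟩

@[ext] theorem hom_ext {Q P : Quiv K O} {f g : Q ⟶ P}
    (h : ∀ a b x, f.app a b x = g.app a b x) : f = g :=
  Hom.ext (funext fun a => funext fun b => LinearMap.ext (h a b))

@[simp] theorem id_app (Q : Quiv K O) (a b : O) (x : Q a b) :
    Hom.app (𝟙 Q) a b x = x := rfl

@[simp] theorem comp_app {Q P R : Quiv K O} (f : Q ⟶ P) (g : P ⟶ R) (a b : O) (x : Q a b) :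
    Hom.app (f ≫ g) a b x = g.app a b (f.app a b x) := rfl

section preadditive

variable {Q P : Quiv K O}

instance : Zero (Q ⟶ P) := ⟨⟨fun _ _ => 0⟩⟩
instance : Add (Q ⟶ P) := ⟨fun f g => ⟨fun a b => f.app a b + g.app a b⟩⟩
instance : Neg (Q ⟶ P) := ⟨fun f => ⟨fun a b => -f.app a b⟩⟩
instance : Sub (Q ⟶ P) := ⟨fun f g => ⟨fun a b => f.app a b - g.app a b⟩⟩
instance : SMul ℕ (Q ⟶ P) := ⟨fun n f => ⟨fun a b => n • f.app a b⟩⟩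
instance : SMul ℤ (Q ⟶ P) := ⟨fun n f => ⟨fun a b => n • f.app a b⟩⟩

@[simp] theorem zero_app (a b : O) (x : Q a b) : Hom.app (0 : Q ⟶ P) a b x = 0 := rfl
@[simp] theorem add_app (f g : Q ⟶ P) (a b : O) (x : Q a b) :
    Hom.app (f + g) a b x = f.app a b x + g.app a b x := rfl

instance : AddCommGroup (Q ⟶ P) :=
  Function.Injective.addCommGroup (fun f : Q ⟶ P => f.app) (fun _ _ h => Hom.ext h)
    rfl (fun _ _ => rfl) (fun _ => rfl) (fun _ _ => rfl) (fun _ _ => rfl) (fun _ _ => rfl)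

end preadditive

instance : Preadditive (Quiv K O) where
  add_comp _ _ _ f f' g := by ext a b x; simp
  comp_add _ _ _ f g g' := by ext a b x; simp

open Classical in
/-- `(Q ⊗ P)(a, b) = ⨁ c, Q(a, c) ⊗ P(c, b)`. -/
def tensor (Q P : Quiv K O) : Quiv K O where
  obj a b := ⨁ c, Q a c ⊗[K] P c b

/-- The unit quiver: `K` on the diagonal and `0` elsewhere. -/
def unit (K : Type u) [Field K] (O : Type u) : Quiv K O where
  obj a b := PLift (a = b) →₀ K

section tmul

variable {Q P R S : Quiv K O}

open Classical in
/-- The elementary tensor `x ⊗ y` in `(Q ⊗ P)(a, b)`. -/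
def tmul {a b : O} (c : O) : Q a c →ₗ[K] P c b →ₗ[K] (tensor Q P) a b :=
  (TensorProduct.mk K (Q a c) (P c b)).compr₂ (DirectSum.lof K O (fun c => Q a c ⊗[K] P c b) c)

open Classical in
/-- A linear map out of `(Q ⊗ P)(a, b)` is a family of bilinear maps. -/
def lift {a b : O} {M : Type u} [AddCommGroup M] [Module K M]
    (f : ∀ c, Q a c →ₗ[K] P c b →ₗ[K] M) : (tensor Q P) a b →ₗ[K] M :=
  DirectSum.toModule K O M (fun c => TensorProduct.lift (f c))

@[simp] theorem lift_tmul {a b : O} {M : Type u} [AddCommGroup M] [Module K M]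
    (f : ∀ c, Q a c →ₗ[K] P c b →ₗ[K] M) (c : O) (x : Q a c) (y : P c b) :
    lift f (tmul c x y) = f c x y := by
  classical
  have h := DirectSum.toModule_lof K (M := fun c => Q a c ⊗[K] P c b) (N := M)
    (φ := fun c => TensorProduct.lift (f c)) c (x ⊗ₜ[K] y)
  exact h.trans (TensorProduct.lift.tmul x y)

theorem tensor_ext {a b : O} {M : Type u} [AddCommGroup M] [Module K M]
    {f g : (tensor Q P) a b →ₗ[K] M} (h : ∀ c x y, f (tmul c x y) = g (tmul c x y)) : f = g := by
  classical
  apply DirectSum.linearMap_ext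
  intro c
  apply TensorProduct.ext'
  intro x y
  exact h c x y

theorem hom_tensor_ext {f g : tensor Q P ⟶ R}
    (h : ∀ a b c x y, f.app a b (tmul c x y) = g.app a b (tmul c x y)) : f = g :=
  Hom.ext (funext fun a => funext fun b => tensor_ext (h a b))

/-- The tensor product of quiver morphisms. -/
def tensorMap (f : Q ⟶ R) (g : P ⟶ S) : tensor Q P ⟶ tensor R S :=
  ⟨fun a b => lift fun c => (tmul c).compl₁₂ (f.app a c) (g.app c b)⟩

@[simp] theorem tensorMap_tmul (f : Q ⟶ R) (g : P ⟶ S) (a b c : O) (x : Q a c) (y : P c b) :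
    (tensorMap f g).app a b (tmul c x y) = tmul c (f.app a c x) (g.app c b y) := by
  simp [tensorMap]

theorem hom_tensor_ext₃ {f g : tensor (tensor Q P) S ⟶ R}
    (h : ∀ a b c d x y z, f.app a b (tmul c (tmul d x y) z) = g.app a b (tmul c (tmul d x y) z)) :
    f = g := by
  apply hom_tensor_ext
  intro a b c x y
  have : ((f.app a b).comp ((tmul c).flip y)) = ((g.app a b).comp ((tmul c).flip y)) :=
    tensor_ext (fun d x' y' => h a b c d x' y' y)
  exact LinearMap.congr_fun this x

theorem hom_tensor_ext₃' {f g : tensor S (tensor Q P) ⟶ R}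
    (h : ∀ a b c d x y z, f.app a b (tmul c z (tmul d x y)) = g.app a b (tmul c z (tmul d x y))) :
    f = g := by
  apply hom_tensor_ext
  intro a b c x y
  have : ((f.app a b).comp (tmul c x)) = ((g.app a b).comp (tmul c x)) :=
    tensor_ext (fun d x' y' => h a b c d x' y' x)
  exact LinearMap.congr_fun this y

theorem hom_tensor_ext₄ {T : Quiv K O} {f g : tensor (tensor (tensor T Q) P) S ⟶ R}
    (h : ∀ a b c d e w x y z, f.app a b (tmul c (tmul d (tmul e w x) y) z) =
      g.app a b (tmul c (tmul d (tmul e w x) y) z)) :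
    f = g := by
  apply hom_tensor_ext₃
  intro a b c d x y z
  have : ((f.app a b).comp (((tmul c).flip z).comp ((tmul d).flip y))) =
      ((g.app a b).comp (((tmul c).flip z).comp ((tmul d).flip y))) :=
    tensor_ext (fun e x' y' => h a b c d e x' y' y z)
  exact LinearMap.congr_fun this x

/-- The canonical basis vector of `unit K O` at `a`. -/
def one (a : O) : (unit K O) a a := Finsupp.single ⟨rfl⟩ 1

/-- A linear map out of `(unit K O)(a, b)` is an element for each proof of `a = b`. -/
def unitLift {a b : O} {M : Type u} [AddCommGroup M] [Module K M] (m : a = b → M) :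
    (unit K O) a b →ₗ[K] M :=
  Finsupp.lift M K (PLift (a = b)) (fun h => m h.down)

@[simp] theorem unitLift_one {a : O} {M : Type u} [AddCommGroup M] [Module K M] (m : a = a → M) :
    unitLift (K := K) m (one a) = m rfl := by
  exact (Finsupp.sum_single_index (by simp)).trans (by simp)

theorem unit_ext {a b : O} {M : Type u} [AddCommGroup M] [Module K M]
    {f g : (unit K O) a b →ₗ[K] M} (h : ∀ e : a = b, f (e ▸ one a) = g (e ▸ one a)) : f = g := by
  apply Finsupp.lhom_ext'
  rintro ⟨rfl⟩
  apply LinearMap.ext_ring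
  exact h rfl

theorem hom_unit_ext {f g : unit K O ⟶ R} (h : ∀ a, f.app a a (one a) = g.app a a (one a)) :
    f = g :=
  Hom.ext (funext fun a => funext fun b => unit_ext (by rintro rfl; exact h a))

theorem hom_unit_tensor_ext {f g : tensor (unit K O) Q ⟶ R}
    (h : ∀ a b x, f.app a b (tmul a (one a) x) = g.app a b (tmul a (one a) x)) : f = g := by
  apply hom_tensor_ext
  intro a b c x y
  have : ((f.app a b).comp ((tmul c).flip y)) = ((g.app a b).comp ((tmul c).flip y)) :=
    unit_ext (by rintro rfl; exact h a b y)
  exact LinearMap.congr_fun this x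

theorem hom_tensor_unit_ext {f g : tensor Q (unit K O) ⟶ R}
    (h : ∀ a b x, f.app a b (tmul b x (one b)) = g.app a b (tmul b x (one b))) : f = g := by
  apply hom_tensor_ext
  intro a b c x y
  have : ((f.app a b).comp (tmul c x)) = ((g.app a b).comp (tmul c x)) :=
    unit_ext (by rintro rfl; exact h a c x)
  exact LinearMap.congr_fun this y

theorem hom_tensor_unit_tensor_ext {f g : tensor (tensor Q (unit K O)) P ⟶ R}
    (h : ∀ a b c x y, f.app a b (tmul c (tmul c x (one c)) y) =
      g.app a b (tmul c (tmul c x (one c)) y)) : f = g := by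
  apply hom_tensor_ext₃
  intro a b c d x y z
  have : ((f.app a b).comp (((tmul c).flip z).comp (tmul d x))) =
      ((g.app a b).comp (((tmul c).flip z).comp (tmul d x))) :=
    unit_ext (by rintro rfl; exact h a b d x z)
  exact LinearMap.congr_fun this y

/-- `(x ⊗ y) ⊗ z ↦ x ⊗ (y ⊗ z)`. -/
def assoc (Q P R : Quiv K O) : tensor (tensor Q P) R ≅ tensor Q (tensor P R) where
  hom := ⟨fun a b => lift fun c => lift fun d =>
    LinearMap.mk₂ K (fun x y => (tmul d x).comp ((tmul c) y))
      (by intros; ext; simp) (by intros; ext; simp) (by intros; ext; simp) (by intros; ext; simp)⟩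
  inv := ⟨fun a b => lift fun d => (lift fun c =>
    LinearMap.mk₂ K (fun y z => ((tmul c).flip z).comp ((tmul d).flip y))
      (by intros; ext; simp) (by intros; ext; simp) (by intros; ext; simp)
      (by intros; ext; simp)).flip⟩
  hom_inv_id := by apply hom_tensor_ext₃; intros; simp
  inv_hom_id := by apply hom_tensor_ext₃'; intros; simp

@[simp] theorem assoc_hom_tmul (a b c d : O) (x : Q a d) (y : P d c) (z : R c b) :
    (assoc Q P R).hom.app a b (tmul c (tmul d x y) z) = tmul d x (tmul c y z) := by
  simp [assoc]

/-- `1 ⊗ x ↦ x`. -/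
def leftUnit (Q : Quiv K O) : tensor (unit K O) Q ≅ Q where
  hom := ⟨fun a b => lift fun c => unitLift fun h => h ▸ LinearMap.id⟩
  inv := ⟨fun a b => tmul a (one a)⟩
  hom_inv_id := by apply hom_unit_tensor_ext; intros; simp
  inv_hom_id := by ext; simp

@[simp] theorem leftUnit_hom_tmul (a b : O) (x : Q a b) :
    (leftUnit Q).hom.app a b (tmul a (one a) x) = x := by
  simp [leftUnit]

/-- `x ⊗ 1 ↦ x`. -/
def rightUnit (Q : Quiv K O) : tensor Q (unit K O) ≅ Q where
  hom := ⟨fun a b => lift fun c => (unitLift fun h => h ▸ LinearMap.id).flip⟩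
  inv := ⟨fun a b => (tmul b).flip (one b)⟩
  hom_inv_id := by apply hom_tensor_unit_ext; intros; simp
  inv_hom_id := by ext; simp

@[simp] theorem rightUnit_hom_tmul (a b : O) (x : Q a b) :
    (rightUnit Q).hom.app a b (tmul b x (one b)) = x := by
  simp [rightUnit]

end tmul

instance : MonoidalCategoryStruct (Quiv K O) where
  tensorObj := tensor
  tensorUnit := unit K O
  tensorHom := tensorMap
  whiskerLeft Q _ _ g := tensorMap (𝟙 Q) g
  whiskerRight f Q := tensorMap f (𝟙 Q)
  associator := assoc
  leftUnitor := leftUnit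
  rightUnitor := rightUnit

instance : MonoidalCategory (Quiv K O) :=
  MonoidalCategory.ofTensorHom
    (id_tensorHom_id := fun _ _ => by apply hom_tensor_ext; intros; simp [tensorHom, tensorObj])
    (id_tensorHom := fun _ _ _ _ => rfl)
    (tensorHom_id := fun _ _ => rfl)
    (tensorHom_comp_tensorHom := fun _ _ _ _ => by
      apply hom_tensor_ext; intros; simp [tensorHom, tensorObj])
    (associator_naturality := fun _ _ _ => by
      apply hom_tensor_ext₃; intros; simp [tensorHom, tensorObj, MonoidalCategoryStruct.associator])
    (leftUnitor_naturality := fun _ => by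
      apply hom_unit_tensor_ext; intros; simp [tensorHom, tensorObj, leftUnitor, tensorUnit])
    (rightUnitor_naturality := fun _ => by
      apply hom_tensor_unit_ext; intros; simp [tensorHom, tensorObj, rightUnitor, tensorUnit])
    (pentagon := fun _ _ _ _ => by
      apply hom_tensor_ext₄; intros; simp [tensorHom, tensorObj, MonoidalCategoryStruct.associator])
    (triangle := fun _ _ => by
      apply hom_tensor_unit_tensor_ext; intros
      simp [tensorHom, tensorObj, MonoidalCategoryStruct.associator, leftUnitor, rightUnitor, tensorUnit])

instance : MonoidalPreadditive (Quiv K O) where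
  whiskerLeft_zero := by
    intros; apply hom_tensor_ext; intros; simp [whiskerLeft, tensorObj]
  zero_whiskerRight := by
    intros; apply hom_tensor_ext; intros; simp [whiskerRight, tensorObj]
  whiskerLeft_add _ _ := by
    apply hom_tensor_ext; intros; simp [whiskerLeft, tensorObj]
  add_whiskerRight _ _ := by
    apply hom_tensor_ext; intros; simp [whiskerRight, tensorObj]

end Quiv

end Templicial

namespace Templicial

/-- The finite interval category: its objects are the ordinals `[n] = {0, ..., n}`. -/
structure Fint where
  len : ℕ

namespace Fint

/-- Morphisms are the order preserving maps that preserve both endpoints. -/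
@[ext] structure Hom (m n : Fint) where
  map : Fin (m.len + 1) →o Fin (n.len + 1)
  map_zero : map 0 = 0
  map_last : map (Fin.last m.len) = Fin.last n.len

instance : Category Fint where
  Hom := Hom
  id n := ⟨OrderHom.id, rfl, rfl⟩
  comp f g := ⟨g.map.comp f.map, by simp [f.map_zero, g.map_zero],
    by simp [f.map_last, g.map_last]⟩

variable {l m n k : Fint}

/-- The values of a morphism as natural numbers, extended to be constant beyond the endpoint. -/
def Hom.nat (f : m ⟶ n) (i : ℕ) : ℕ := f.map ⟨min i m.len, by omega⟩

theorem Hom.map_val (f : m ⟶ n) (i : Fin (m.len + 1)) : (f.map i : ℕ) = Hom.nat f i := by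
  have : i = ⟨min i.val m.len, by omega⟩ := by ext; simp; omega
  unfold Hom.nat
  rw [← this]

theorem Hom.nat_mono (f : m ⟶ n) {i j : ℕ} (h : i ≤ j) : Hom.nat f i ≤ Hom.nat f j :=
  f.map.monotone (by simp only [Fin.mk_le_mk]; omega)

@[simp] theorem Hom.nat_zero (f : m ⟶ n) : Hom.nat f 0 = 0 := by
  have := congrArg Fin.val f.map_zero
  rwa [Hom.map_val] at this

theorem Hom.nat_of_le (f : m ⟶ n) {i : ℕ} (h : m.len ≤ i) : Hom.nat f i = n.len := by
  have h1 := congrArg Fin.val f.map_last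
  rw [Hom.map_val] at h1
  simp only [Fin.val_last] at h1
  rw [← h1]
  simp [Hom.nat, h]

theorem Hom.nat_le (f : m ⟶ n) (i : ℕ) : Hom.nat f i ≤ n.len := by
  have := (f.map ⟨min i m.len, by omega⟩).isLt
  unfold Hom.nat
  omega

theorem Hom.nat_id (i : ℕ) : Hom.nat (𝟙 m) i = min i m.len := rfl

theorem Hom.nat_comp (f : l ⟶ m) (g : m ⟶ n) (i : ℕ) :
    Hom.nat (f ≫ g) i = Hom.nat g (Hom.nat f i) := by
  rw [← Hom.map_val g ⟨Hom.nat f i, Nat.lt_succ_of_le (Hom.nat_le f i)⟩]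
  rfl

theorem hom_ext' {f g : m ⟶ n} (h : ∀ i, i ≤ m.len → Hom.nat f i = Hom.nat g i) : f = g := by
  apply Hom.ext
  ext i
  rw [Hom.map_val, Hom.map_val]
  exact h i (by omega)

/-- A morphism from a function on the natural numbers. -/
def Hom.ofNat (F : ℕ → ℕ) (mono : ∀ i j, i ≤ j → j ≤ m.len → F i ≤ F j) (h0 : F 0 = 0)
    (h1 : F m.len = n.len) : m ⟶ n where
  map :=
    { toFun := fun i => ⟨F i, by have := mono i m.len (by omega) le_rfl; omega⟩
      monotone' := fun i j h => mono i j h (by omega) }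
  map_zero := Fin.ext h0
  map_last := Fin.ext h1

theorem Hom.nat_ofNat (F : ℕ → ℕ) (mono : ∀ i j, i ≤ j → j ≤ m.len → F i ≤ F j) (h0 : F 0 = 0)
    (h1 : F m.len = n.len) (i : ℕ) :
    Hom.nat (Hom.ofNat F mono h0 h1 : m ⟶ n) i = F (min i m.len) := rfl

/-- The identity of underlying sets. -/
def idIso (h : m.len = n.len) : m ≅ n where
  hom := Hom.ofNat id (fun _ _ h _ => h) rfl h
  inv := Hom.ofNat id (fun _ _ h _ => h) rfl h.symm
  hom_inv_id := hom_ext' fun i hi => by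
    rw [Hom.nat_comp, Hom.nat_ofNat, Hom.nat_ofNat, Hom.nat_id]; simp; omega
  inv_hom_id := hom_ext' fun i hi => by
    rw [Hom.nat_comp, Hom.nat_ofNat, Hom.nat_ofNat, Hom.nat_id]; simp; omega

theorem nat_idIso_hom (h : m.len = n.len) (i : ℕ) : Hom.nat (idIso h).hom i = min i m.len := rfl

/-- The sum of morphisms, placing `g` after `f`. -/
def add {m' n' : Fint} (f : m ⟶ n) (g : m' ⟶ n') :
    (⟨m.len + m'.len⟩ : Fint) ⟶ ⟨n.len + n'.len⟩ :=
  Hom.ofNat (fun i => Hom.nat f i + Hom.nat g (i - m.len))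
    (fun _ _ h _ => add_le_add (Hom.nat_mono f h) (Hom.nat_mono g (by omega)))
    (by simp)
    (by rw [Hom.nat_of_le f (by simp), Hom.nat_of_le g (by simp)])

theorem nat_add {m' n' : Fint} (f : m ⟶ n) (g : m' ⟶ n') (i : ℕ) :
    Hom.nat (add f g) i = Hom.nat f i + Hom.nat g (i - m.len) := by
  rcases le_total i (m.len + m'.len) with h | h
  · simp [add, Hom.nat_ofNat, h]
  · rw [Hom.nat_of_le _ (by simpa using h), Hom.nat_of_le f (by omega),
      Hom.nat_of_le g (by omega)]

instance : MonoidalCategoryStruct Fint where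
  tensorObj m n := ⟨m.len + n.len⟩
  tensorUnit := ⟨0⟩
  tensorHom := add
  whiskerLeft m _ _ g := add (𝟙 m) g
  whiskerRight f n := add f (𝟙 n)
  associator _ _ _ := idIso (by simp [add_assoc])
  leftUnitor _ := idIso (by simp)
  rightUnitor _ := idIso (by simp)

@[simp] theorem len_tensor (m n : Fint) : (m ⊗ n).len = m.len + n.len := rfl
@[simp] theorem len_unit : (𝟙_ Fint).len = 0 := rfl
theorem nat_tensor {m' n' : Fint} (f : m ⟶ n) (g : m' ⟶ n') (i : ℕ) :
    Hom.nat (f ⊗ₘ g) i = Hom.nat f i + Hom.nat g (i - m.len) := nat_add f g i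
theorem nat_whiskerLeft {n' : Fint} (g : n ⟶ n') (i : ℕ) :
    Hom.nat (m ◁ g) i = min i m.len + Hom.nat g (i - m.len) := nat_add (𝟙 m) g i
theorem nat_whiskerRight {m' : Fint} (f : m ⟶ n) (i : ℕ) :
    Hom.nat (f ▷ m') i = Hom.nat f i + min (i - m.len) m'.len := nat_add f (𝟙 m') i
theorem nat_assoc_hom (i : ℕ) :
    Hom.nat (α_ l m n).hom i = min i (l.len + m.len + n.len) := rfl
theorem nat_assoc_inv (i : ℕ) :
    Hom.nat (α_ l m n).inv i = min i (l.len + (m.len + n.len)) := rfl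
theorem nat_left_hom (i : ℕ) : Hom.nat (λ_ m).hom i = min i (0 + m.len) := rfl
theorem nat_left_inv (i : ℕ) : Hom.nat (λ_ m).inv i = min i m.len := rfl
theorem nat_right_hom (i : ℕ) : Hom.nat (ρ_ m).hom i = min i (m.len + 0) := rfl
theorem nat_right_inv (i : ℕ) : Hom.nat (ρ_ m).inv i = min i m.len := rfl

theorem tensor_comp_aux {m₁ m₂ m₃ n₁ n₂ n₃ : Fint} (f : m₁ ⟶ m₂) (g : n₁ ⟶ n₂) (f' : m₂ ⟶ m₃)
    (g' : n₂ ⟶ n₃) : (f ⊗ₘ g) ≫ (f' ⊗ₘ g') = (f ≫ f') ⊗ₘ (g ≫ g') := by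
  apply hom_ext'
  intro i _
  simp only [nat_tensor, Hom.nat_comp]
  have h2 := Hom.nat_le f i
  rcases le_total i m₁.len with h | h
  · simp [Nat.sub_eq_zero_of_le h, Nat.sub_eq_zero_of_le h2]
  · rw [Hom.nat_of_le f h, Hom.nat_of_le f' (by omega), Hom.nat_of_le f' le_rfl]
    simp

theorem assoc_nat_aux {m₁ m₂ m₃ n₁ n₂ n₃ : Fint} (f : m₁ ⟶ n₁) (g : m₂ ⟶ n₂) (h : m₃ ⟶ n₃) :
    ((f ⊗ₘ g) ⊗ₘ h) ≫ (α_ n₁ n₂ n₃).hom = (α_ m₁ m₂ m₃).hom ≫ (f ⊗ₘ (g ⊗ₘ h)) := by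
  apply hom_ext'
  intro i hi
  simp only [nat_tensor, Hom.nat_comp, nat_assoc_hom, len_tensor] at hi ⊢
  have h1 := Hom.nat_le f i
  have h2 := Hom.nat_le g (i - m₁.len)
  have h3 := Hom.nat_le h (i - (m₁.len + m₂.len))
  rw [min_eq_left (by omega), min_eq_left hi, Nat.sub_sub]
  omega

instance : MonoidalCategory Fint :=
  MonoidalCategory.ofTensorHom
    (id_tensorHom_id := fun _ _ => hom_ext' fun i hi => by
      simp only [nat_tensor, Hom.nat_id, len_tensor] at hi ⊢; omega)
    (id_tensorHom := fun _ _ _ _ => rfl)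
    (tensorHom_id := fun _ _ => rfl)
    (tensorHom_comp_tensorHom := tensor_comp_aux)
    (associator_naturality := assoc_nat_aux)
    (leftUnitor_naturality := fun {X Y} f => hom_ext' fun i hi => by
      have := Hom.nat_le f i
      simp only [nat_tensor, Hom.nat_comp, nat_left_hom, Hom.nat_id, len_tensor, len_unit] at hi ⊢
      rw [min_eq_left hi]; simp; omega)
    (rightUnitor_naturality := fun {X Y} f => hom_ext' fun i hi => by
      have := Hom.nat_le f i
      simp only [nat_tensor, Hom.nat_comp, nat_right_hom, Hom.nat_id, len_tensor, len_unit] at hi ⊢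
      rw [min_eq_left hi]; simp; omega)
    (pentagon := fun _ _ _ _ => hom_ext' fun i hi => by
      simp only [nat_tensor, Hom.nat_id, Hom.nat_comp, nat_assoc_hom,
        len_tensor] at hi ⊢
      omega)
    (triangle := fun _ _ => hom_ext' fun i hi => by
      simp only [nat_tensor, Hom.nat_id, Hom.nat_comp, nat_assoc_hom, nat_left_hom,
        nat_right_hom, len_tensor, len_unit] at hi ⊢
      omega)

/-- The inner face `δ_{j+1} : [n] → [n+1]` for `j < n`, which omits the value `j + 1`. -/
def face {n : ℕ} (j : Fin n) : (⟨n⟩ : Fint) ⟶ ⟨n + 1⟩ where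
  map := (Fin.succAboveOrderEmb j.succ.castSucc).toOrderHom
  map_zero := by
    change Fin.succAbove j.succ.castSucc 0 = 0
    exact Fin.succAbove_ne_zero_zero (by rw [ne_eq, Fin.ext_iff]; simp)
  map_last := by
    change Fin.succAbove j.succ.castSucc (Fin.last n) = Fin.last (n + 1)
    exact Fin.succAbove_ne_last_last (by rw [ne_eq, Fin.ext_iff]; simp; omega)

/-- The degeneracy `σ_i : [n+1] → [n]` for `0 ≤ i ≤ n`, which takes the value `i` twice. -/
def degen {n : ℕ} (i : Fin (n + 1)) : (⟨n + 1⟩ : Fint) ⟶ ⟨n⟩ where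
  map := ⟨i.predAbove, Fin.predAbove_right_monotone i⟩
  map_zero := by simp
  map_last := by simp

end Fint

end Templicial

namespace Templicial

section tens

variable {C : Type*} [Category C] [MonoidalCategory C] {ι : Type*}

/-- The tensor product `Q i₁ ⊗ (Q i₂ ⊗ (... ⊗ 𝟙))` over a list of indices. -/
@[reducible] def tens (Q : ι → C) : List ι → C
  | [] => 𝟙_ C
  | i :: L => Q i ⊗ tens Q L

/-- The canonical isomorphism splitting a tensor product over a concatenation. -/
def split (Q : ι → C) : ∀ S L : List ι, tens Q (S ++ L) ≅ tens Q S ⊗ tens Q L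
  | [], L => (λ_ (tens Q L)).symm
  | i :: S, L => whiskerLeftIso (Q i) (split Q S L) ≪≫ (α_ (Q i) (tens Q S) (tens Q L)).symm

/-- The map `id^{⊗ L₁} ⊗ φ ⊗ id^{⊗ L₂}` (without any sign). -/
def insertAt (Q : ι → C) : ∀ (L₁ : List ι) {S : List ι} {d : ι} (_ : tens Q S ⟶ Q d)
    (L₂ : List ι), tens Q (L₁ ++ (S ++ L₂)) ⟶ tens Q (L₁ ++ d :: L₂)
  | [], S, _, φ, L₂ => (split Q S L₂).hom ≫ φ ▷ tens Q L₂
  | i :: L₁, _, _, φ, L₂ => Q i ◁ insertAt Q L₁ φ L₂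

theorem unit_whisker_aux {X Y U : C} (u : 𝟙_ C ⟶ U) (f : X ⟶ Y) :
    ((λ_ X).inv ≫ u ▷ X) ≫ U ◁ f = f ≫ (λ_ Y).inv ≫ u ▷ Y := by
  rw [Category.assoc, ← whisker_exchange, leftUnitor_inv_naturality_assoc]

end tens

section AInf

variable (C : Type*) [Category C] [MonoidalCategory C] [Preadditive C]

/-- The data of a graded object with multiplications `m_k` of degree `k - 2` and a unit. The
list `D` records the degrees of the arguments, so that `k` is the length of `D`. -/
structure AInfData where
  hom : ℤ → C
  mul : ∀ (D : List ℤ) (e : ℤ), D ≠ [] → e = D.sum + D.length - 2 → (tens hom D ⟶ hom e)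
  unit : 𝟙_ C ⟶ hom 0

variable {C}

theorem deg_take_drop {D : List ℤ} {e : ℤ} (h : e = D.sum + D.length - 3) (r s : ℕ) :
    e = (D.take r ++ (((D.drop r).take s).sum + ((D.drop r).take s).length - 2) ::
      (D.drop r).drop s).sum + (D.take r ++ (((D.drop r).take s).sum +
        ((D.drop r).take s).length - 2) :: (D.drop r).drop s).length - 2 := by
  have h1 : D.take r ++ ((D.drop r).take s ++ (D.drop r).drop s) = D := by
    rw [List.take_append_drop, List.take_append_drop]
  have h2 := congrArg List.sum h1
  have h3 := congrArg List.length h1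
  simp only [List.sum_append, List.length_append] at h2 h3
  simp only [List.sum_append, List.sum_cons, List.length_append, List.length_cons]
  push_cast
  rw [h, ← h2, ← h3]
  push_cast
  ring

/-- The summand `(-1)^{r + st} m_{r+1+t} (id^{⊗ r} ⊗ m_s ⊗ id^{⊗ t})` on the summand of
multidegree `D`, with `s = s' + 1` and `r + s + t = k`. The second sign is the Koszul sign that
arises from moving `m_s`, of degree `s - 2`, past the first `r` arguments. -/
def AInfData.relTerm (A : AInfData C) (D : List ℤ) (e : ℤ) (h : e = D.sum + D.length - 3)
    (r : Fin D.length) (s' : Fin (D.length - r)) : tens A.hom D ⟶ A.hom e :=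
  let s : ℕ := s' + 1
  let t : ℕ := D.length - r - s
  let D₁ := D.take r
  let D₂ := (D.drop r).take s
  let D₃ := (D.drop r).drop s
  Int.negOnePow ((r : ℤ) + s * t) • Int.negOnePow (((s : ℤ) - 2) * D₁.sum) •
    (eqToHom (congrArg (tens A.hom) (by rw [List.take_append_drop, List.take_append_drop])) ≫
      insertAt A.hom D₁ (A.mul D₂ (D₂.sum + D₂.length - 2)
        (List.ne_nil_of_length_pos (by
          have := s'.isLt; simp only [D₂, s, List.length_take, List.length_drop]; omega)) rfl) D₃ ≫
      A.mul (D₁ ++ (D₂.sum + D₂.length - 2) :: D₃) e (by simp) (deg_take_drop h r s))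

variable (C) in
/-- A strictly unital `A∞`-algebra in graded objects of `C`. -/
structure AInf extends AInfData C where
  rel : ∀ (D : List ℤ) (e : ℤ) (h : e = D.sum + D.length - 3), D ≠ [] →
    ∑ r : Fin D.length, ∑ s' : Fin (D.length - r), toAInfData.relTerm D e h r s' = 0
  /-- `∂ u = 0` -/
  unit_cycle : ∀ (e : ℤ) (h : e = [(0 : ℤ)].sum + [(0 : ℤ)].length - 2),
    insertAt hom [] (S := []) unit [] ≫ mul [0] e (by simp) h = 0
  /-- `m (u ⊗ id) = id` -/
  unit_mul : ∀ (i : ℤ), insertAt hom [] (S := []) unit [i] ≫ mul [0, i] i (by simp) (by simp) =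
    (ρ_ (hom i)).hom
  /-- `m (id ⊗ u) = id` -/
  mul_unit : ∀ (i : ℤ), insertAt hom [i] (S := []) unit [] ≫ mul [i, 0] i (by simp) (by simp) =
    (ρ_ (hom i)).hom
  /-- `m_k (id^{⊗ j-1} ⊗ u ⊗ id^{⊗ k-j}) = 0` for `k > 2` -/
  mul_unit_eq_zero : ∀ (D₁ D₂ : List ℤ) (e : ℤ)
    (h : e = (D₁ ++ 0 :: D₂).sum + (D₁ ++ 0 :: D₂).length - 2), 2 < (D₁ ++ 0 :: D₂).length →
    insertAt hom D₁ (S := []) unit D₂ ≫ mul (D₁ ++ 0 :: D₂) e (by simp) h = 0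

namespace AInf

variable (A : AInf C)

/-- The suspension `(s𝒜)_n = 𝒜_{n-1}`. -/
def sus (n : ℕ) : C := A.hom ((n : ℤ) - 1)

/-- The unit as a map to `(s𝒜)_1 = 𝒜_0`. -/
def susUnit : 𝟙_ C ⟶ A.sus 1 := A.unit

/-- The identification of tensor products of suspensions with tensor products of the degree
pieces of `𝒜`. -/
def desus : ∀ S : List ℕ, tens A.sus S ⟶ tens A.hom (S.map fun n : ℕ => (n : ℤ) - 1)
  | [] => 𝟙 _
  | n :: S => A.hom ((n : ℤ) - 1) ◁ desus S

theorem sum_map_pred (S : List ℕ) :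
    (S.map fun n : ℕ => (n : ℤ) - 1).sum = (S.sum : ℤ) - S.length := by
  induction S with
  | nil => simp
  | cons n S ih => simp only [List.map_cons, List.sum_cons, ih, List.length_cons]; push_cast; ring

/-- The multiplication `m_{ℓ(S)} : (s𝒜)_S → 𝒜_{d-1}` with `d + 1 = n₁ + ... + n_l` for
`S = (n₁, ..., n_l)`. -/
def susMul (S : List ℕ) (d : ℕ) (hS : S ≠ []) (h : S.sum = d + 1) : tens A.sus S ⟶ A.sus d :=
  A.desus S ≫ A.mul _ ((d : ℤ) - 1) (by simpa using hS)
    (by rw [sum_map_pred, h, List.length_map]; push_cast; ring)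

theorem mul_congr {D D' : List ℤ} (hD : D = D') (e : ℤ) (h₁ h₂) (h₁' h₂') :
    A.mul D e h₁ h₂ = eqToHom (congrArg (tens A.hom) hD) ≫ A.mul D' e h₁' h₂' := by
  subst hD; simp

/-- `desus` with a variable list of degrees. -/
def desusTo (S : List ℕ) (D : List ℤ) (h : (S.map fun n : ℕ => (n : ℤ) - 1) = D) :
    tens A.sus S ⟶ tens A.hom D := A.desus S ≫ eqToHom (congrArg (tens A.hom) h)

theorem susMul_eq (S : List ℕ) (d : ℕ) (hS h) (D : List ℤ)
    (hD : (S.map fun n : ℕ => (n : ℤ) - 1) = D) (h₁ h₂) :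
    A.susMul S d hS h = A.desusTo S D hD ≫ A.mul D ((d : ℤ) - 1) h₁ h₂ := by
  subst hD
  exact congrArg (· ≫ A.mul _ _ _ _) (Category.comp_id _).symm

theorem desusTo_cons (n : ℕ) (S : List ℕ) (D : List ℤ)
    (h : (S.map fun n : ℕ => (n : ℤ) - 1) = D) :
    A.desusTo (n :: S) (((n : ℤ) - 1) :: D) (by simp [h]) =
      A.hom ((n : ℤ) - 1) ◁ A.desusTo S D h := by
  subst h
  exact (Category.comp_id _).trans (congrArg (A.hom ((n : ℤ) - 1) ◁ ·) (Category.comp_id _).symm)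

theorem susUnit_desusTo (S₁ S₂ : List ℕ) (D₁ D₂ : List ℤ)
    (h₁ : (S₁.map fun n : ℕ => (n : ℤ) - 1) = D₁) (h₂ : (S₂.map fun n : ℕ => (n : ℤ) - 1) = D₂) :
    insertAt A.sus S₁ (S := []) A.susUnit S₂ ≫ A.desusTo (S₁ ++ 1 :: S₂) (D₁ ++ 0 :: D₂)
      (by simp [h₁, h₂]) =
    A.desusTo (S₁ ++ ([] ++ S₂)) (D₁ ++ ([] ++ D₂)) (by simp [h₁, h₂]) ≫
      insertAt A.hom D₁ (S := []) A.unit D₂ := by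
  subst h₁
  induction S₁ with
  | nil =>
    have := A.desusTo_cons 1 S₂ D₂ h₂
    exact Eq.trans (congrArg (insertAt A.sus [] (S := []) A.susUnit S₂ ≫ ·) this)
      (unit_whisker_aux A.susUnit (A.desusTo S₂ D₂ h₂))
  | cons n S₁ ih =>
    have e1 := A.desusTo_cons n _ _ (show (S₁ ++ 1 :: S₂).map (fun n : ℕ => (n : ℤ) - 1) =
      (S₁.map fun n : ℕ => (n : ℤ) - 1) ++ 0 :: D₂ by simp [h₂])
    have e2 := A.desusTo_cons n _ _ (show (S₁ ++ ([] ++ S₂)).map (fun n : ℕ => (n : ℤ) - 1) =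
      (S₁.map fun n : ℕ => (n : ℤ) - 1) ++ ([] ++ D₂) by simp [h₂])
    refine Eq.trans (congrArg (insertAt A.sus (n :: S₁) (S := []) A.susUnit S₂ ≫ ·) e1) ?_
    refine Eq.trans ?_ (congrArg (· ≫ insertAt A.hom (_ :: _) (S := []) A.unit D₂) e2.symm)
    exact ((whiskerLeft_comp _ _ _).symm.trans (congrArg (A.hom ((n : ℤ) - 1) ◁ ·) ih)).trans
      (whiskerLeft_comp _ _ _)

theorem desusTo_single (n : ℕ) {X : C} (f : A.hom ((n : ℤ) - 1) ⊗ 𝟙_ C ⟶ X) :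
    A.desusTo [n] [(n : ℤ) - 1] rfl ≫ f = f := by
  have h : A.desusTo [n] [(n : ℤ) - 1] rfl = 𝟙 (A.hom ((n : ℤ) - 1) ⊗ 𝟙_ C) :=
    (Category.comp_id _).trans (whiskerLeft_id _ _)
  exact (congrArg (· ≫ f) h).trans (Category.id_comp f)

theorem comp_susMul (S₁ S₂ : List ℕ) (D₁ D₂ : List ℤ)
    (h₁ : (S₁.map fun n : ℕ => (n : ℤ) - 1) = D₁) (h₂ : (S₂.map fun n : ℕ => (n : ℤ) - 1) = D₂)
    (d : ℕ) (hS h) (h₃ h₄) {f : tens A.hom (D₁ ++ ([] ++ D₂)) ⟶ A.hom ((d : ℤ) - 1)}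
    (hf : insertAt A.hom D₁ (S := []) A.unit D₂ ≫ A.mul (D₁ ++ 0 :: D₂) ((d : ℤ) - 1) h₃ h₄ = f) :
    insertAt A.sus S₁ (S := []) A.susUnit S₂ ≫ A.susMul (S₁ ++ 1 :: S₂) d hS h =
      A.desusTo (S₁ ++ ([] ++ S₂)) (D₁ ++ ([] ++ D₂)) (by simp [h₁, h₂]) ≫ f := by
  rw [A.susMul_eq (S₁ ++ 1 :: S₂) d hS h (D₁ ++ 0 :: D₂) (by simp [h₁, h₂]) h₃ h₄, ← hf]
  refine (Category.assoc _ _ _).symm.trans (Eq.trans ?_ (Category.assoc _ _ _))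
  exact congrArg (· ≫ A.mul _ _ _ _) (A.susUnit_desusTo S₁ S₂ D₁ D₂ h₁ h₂)



theorem susMul_unit_zero (S₁ S₂ : List ℕ) (d : ℕ) (hS h) (hl : 2 < (S₁ ++ 1 :: S₂).length) :
    insertAt A.sus S₁ (S := []) A.susUnit S₂ ≫ A.susMul (S₁ ++ 1 :: S₂) d hS h = 0 := by
  refine (A.comp_susMul S₁ S₂ _ _ rfl rfl d hS h (by simp) ?_
    (A.mul_unit_eq_zero _ _ _ ?_ (by simpa using hl))).trans Limits.comp_zero
  all_goals
    have e : ((S₁ ++ 1 :: S₂).map fun n : ℕ => (n : ℤ) - 1) =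
      (S₁.map fun n : ℕ => (n : ℤ) - 1) ++ 0 :: (S₂.map fun n : ℕ => (n : ℤ) - 1) := by simp
    rw [← e, sum_map_pred, h, List.length_map]; push_cast; ring

theorem susMul_unit_cycle (hS h) :
    insertAt A.sus [] (S := []) A.susUnit [] ≫ A.susMul [1] 0 hS h = 0 :=
  (A.comp_susMul [] [] [] [] rfl rfl 0 hS h (by simp) (by simp)
    (A.unit_cycle _ (by simp))).trans Limits.comp_zero

theorem susMul_unit_left (n : ℕ) (hS h) :
    insertAt A.sus [] (S := []) A.susUnit [n] ≫ A.susMul [1, n] n hS h = (ρ_ (A.sus n)).hom :=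
  (A.comp_susMul [] [n] [] [(n : ℤ) - 1] rfl rfl n hS h (by simp) (by simp)
    (A.unit_mul _)).trans (A.desusTo_single n _)

theorem susMul_unit_right (n : ℕ) (hS h) :
    insertAt A.sus [n] (S := []) A.susUnit [] ≫ A.susMul [n, 1] n hS h = (ρ_ (A.sus n)).hom :=
  (A.comp_susMul [n] [] [(n : ℤ) - 1] [] rfl rfl n hS h (by simp) (by simp)
    (A.mul_unit _)).trans (A.desusTo_single n _)

end AInf

end AInf

end Templicial

namespace Templicial

section chains

variable {V : Type*} [DecidableEq V]

/-- Remove from the chain `v, F` (after its start `v`) all entries equal to their predecessor. -/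
def red : V → List V → List V
  | _, [] => []
  | v, w :: F => if w = v then red v F else w :: red w F

/-- The end of the chain `v, F`. -/
def endOf : V → List V → V
  | v, [] => v
  | _, w :: F => endOf w F

/-- For beads of sizes `U` along the chain `v, F`, the sizes of their images. -/
def imSizes : V → List ℕ → List V → List ℕ
  | _, [], _ => []
  | v, n :: U, F => (red v (F.take n)).length :: imSizes (endOf v (F.take n)) U (F.drop n)

/-- Remove the zeros of a list. -/
def nz : List ℕ → List ℕ
  | [] => []
  | 0 :: M => nz M
  | (m + 1) :: M => (m + 1) :: nz M

theorem endOf_append (v : V) (F G : List V) : endOf v (F ++ G) = endOf (endOf v F) G := by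
  induction F generalizing v with
  | nil => rfl
  | cons w F ih => exact ih w

theorem endOf_red (v : V) (F : List V) : endOf v (red v F) = endOf v F := by
  induction F generalizing v with
  | nil => rfl
  | cons w F ih =>
    unfold red
    split_ifs with h
    · subst h; exact ih w
    · exact ih w

theorem red_append (v : V) (F G : List V) : red v (F ++ G) = red v F ++ red (endOf v F) G := by
  induction F generalizing v with
  | nil => rfl
  | cons w F ih =>
    simp only [List.cons_append, red, endOf]
    split_ifs with h
    · subst h; exact ih w
    · rw [ih]; rfl

theorem red_length_le (v : V) (F : List V) : (red v F).length ≤ F.length := by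
  induction F generalizing v with
  | nil => rfl
  | cons w F ih =>
    unfold red
    split_ifs with h
    · exact (ih v).trans (by simp)
    · simpa using ih w

theorem red_eq_of_chain {v : V} {F : List V} (h : (v :: F).IsChain (· ≠ ·)) : red v F = F := by
  induction F generalizing v with
  | nil => rfl
  | cons w F ih =>
    rw [List.isChain_cons_cons] at h
    rw [red, if_neg h.1.symm, ih h.2]

theorem chain_red (v : V) (F : List V) : (v :: red v F).IsChain (· ≠ ·) := by
  induction F generalizing v with
  | nil => simp [red]
  | cons w F ih =>
    unfold red
    split_ifs with h
    · exact ih v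
    · rw [List.isChain_cons_cons]; exact ⟨fun e => h e.symm, ih w⟩

theorem red_length_lt {v : V} {F : List V} (h : ¬ (v :: F).IsChain (· ≠ ·)) :
    (red v F).length < F.length := by
  induction F generalizing v with
  | nil => simp at h
  | cons w F ih =>
    unfold red
    split_ifs with h1
    · exact Nat.lt_succ_of_le (red_length_le v F)
    · rw [List.isChain_cons_cons, not_and] at h
      simpa using ih (h (fun e => h1 e.symm))

theorem imSizes_cons (v : V) (U : List ℕ) (F G : List V) :
    imSizes v (F.length :: U) (F ++ G) = (red v F).length :: imSizes (endOf v F) U G := by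
  simp [imSizes]

theorem nz_append (M N : List ℕ) : nz (M ++ N) = nz M ++ nz N := by
  induction M with
  | nil => rfl
  | cons m M ih => cases m <;> simp [nz, ih]

theorem nz_pos (M : List ℕ) : ∀ n ∈ nz M, 0 < n := by
  induction M with
  | nil => simp [nz]
  | cons m M ih => cases m <;> simpa [nz] using ih

theorem nz_sum (M : List ℕ) : (nz M).sum = M.sum := by
  induction M with
  | nil => rfl
  | cons m M ih => cases m <;> simp [nz, ih]

theorem nz_of_pos {M : List ℕ} (h : ∀ n ∈ M, 0 < n) : nz M = M := by
  induction M with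
  | nil => rfl
  | cons m M ih =>
    cases m with
    | zero => simp at h
    | succ m => simp only [nz]; rw [ih (fun n hn => h n (by simp [hn]))]

theorem imSizes_sum (v : V) (U : List ℕ) (F : List V) (h : F.length = U.sum) :
    (imSizes v U F).sum = (red v F).length := by
  induction U generalizing v F with
  | nil => simp at h; subst h; rfl
  | cons n U ih =>
    have e : F = F.take n ++ F.drop n := (List.take_append_drop n F).symm
    simp only [List.sum_cons] at h
    rw [imSizes, List.sum_cons, ih _ _ (by simp; omega)]
    conv_rhs => rw [e, red_append, List.length_append]

end chains

section ebar

variable {C : Type*} [Category C] [MonoidalCategory C] [Preadditive C] (A : AInf C)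

/-- Let `e` be the active surjective necklace map from the necklace with beads `U` which sends the
`i`-th bead onto a simplex of dimension `Mᵢ`. This is the induced map `(s𝒜)_{nz M} → (s𝒜)_U`: on a
bead it is the unit for `Δ¹ → Δ⁰`, the identity for an identity, and zero otherwise. -/
def ebar : ∀ U M : List ℕ, tens A.sus (nz M) ⟶ tens A.sus U
  | [], [] => 𝟙 _
  | n :: U, 0 :: M =>
    if h : n = 1 then
      ebar U M ≫ insertAt A.sus [] (S := []) A.susUnit U ≫
        eqToHom (congrArg (fun k => tens A.sus (k :: U)) h.symm)
    else 0
  | n :: U, (m + 1) :: M =>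
    if h : m + 1 = n then
      A.sus (m + 1) ◁ ebar U M ≫ eqToHom (congrArg (fun k => tens A.sus (k :: U)) h)
    else 0
  | [], _ :: _ => 0
  | _ :: _, [] => 0

theorem ebar_unit (U M : List ℕ) :
    ebar A (1 :: U) (0 :: M) = ebar A U M ≫ insertAt A.sus [] (S := []) A.susUnit U := by
  simp only [ebar, dif_pos]
  exact congrArg (ebar A U M ≫ ·) (Category.comp_id _)

theorem ebar_id (m : ℕ) (U M : List ℕ) :
    ebar A ((m + 1) :: U) ((m + 1) :: M) = A.sus (m + 1) ◁ ebar A U M := by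
  simp only [ebar, dif_pos, eqToHom_refl]
  exact Category.comp_id _

theorem ebar_zero {n m : ℕ} (U M : List ℕ) (h : m < n) (h1 : n ≠ 1) :
    ebar A (n :: U) (m :: M) = 0 := by
  cases m with
  | zero => simp [ebar, h1]
  | succ m => simp [ebar, h.ne]

theorem ebar_self {M : List ℕ} (h : ∀ n ∈ M, 0 < n) :
    ebar A M M = eqToHom (congrArg (tens A.sus) (nz_of_pos h)) := by
  induction M with
  | nil => rfl
  | cons m M ih =>
    cases m with
    | zero => simp at h
    | succ m =>
      have h' : ∀ n ∈ M, 0 < n := fun n hn => h n (by simp [hn])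
      rw [ebar_id, ih h']
      generalize_proofs p q
      revert p q
      simp only [nz]
      rw [nz_of_pos h']
      intro p q
      exact whiskerLeft_id _ _

variable {V : Type*} [DecidableEq V]

/-- A family `h` indexed by chains, evaluated at the image of a bead decomposition. -/
def extendAux {Z : C} (𝓕 : C ⥤ C) (h : ∀ (U : List ℕ) (_ : List V), Z ⟶ 𝓕.obj (tens A.sus U))
    (U M : List ℕ) (R : List V) : Z ⟶ 𝓕.obj (tens A.sus U) :=
  h (nz M) R ≫ 𝓕.map (ebar A U M)

/-- The extension of a family from injective necklace maps to all necklace maps. -/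
def extend {Z : C} (𝓕 : C ⥤ C) (h : ∀ (U : List ℕ) (_ : List V), Z ⟶ 𝓕.obj (tens A.sus U))
    (v : V) (U : List ℕ) (F : List V) : Z ⟶ 𝓕.obj (tens A.sus U) :=
  extendAux A 𝓕 h U (imSizes v U F) (red v F)

variable {A} {Z : C} {𝓕 : C ⥤ C} {h : ∀ (U : List ℕ) (_ : List V), Z ⟶ 𝓕.obj (tens A.sus U)}

theorem extend_nil (v : V) : extend A 𝓕 h v [] [] = h [] [] := by
  simp only [extend, extendAux, imSizes, ebar]
  exact (congrArg (h [] [] ≫ ·) (𝓕.map_id _)).trans (Category.comp_id _)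

theorem extend_id {v : V} {F : List V} (hF : (v :: F).IsChain (· ≠ ·)) (hF0 : F ≠ [])
    (U : List ℕ) (G : List V) :
    extend A 𝓕 h v (F.length :: U) (F ++ G) =
      extend A (tensorLeft (A.sus F.length) ⋙ 𝓕) (fun U' G' => h (F.length :: U') (F ++ G'))
        (endOf v F) U G := by
  unfold extend
  rw [imSizes_cons, red_append, red_eq_of_chain hF]
  obtain ⟨w, F, rfl⟩ := List.exists_cons_of_ne_nil hF0
  simp only [extendAux, List.length_cons]
  rw [ebar_id]
  rfl

theorem extend_unit (v : V) (U : List ℕ) (G : List V) :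
    extend A 𝓕 h v (1 :: U) (v :: G) =
      extend A 𝓕 h v U G ≫ 𝓕.map (insertAt A.sus [] (S := []) A.susUnit U) := by
  unfold extend
  have e1 : imSizes v (1 :: U) (v :: G) = 0 :: imSizes v U G := by simp [imSizes, red, endOf]
  have e2 : red v (v :: G) = red v G := by simp [red]
  rw [e1, e2]
  simp only [extendAux]
  rw [ebar_unit]
  exact (congrArg (_ ≫ ·) (𝓕.map_comp _ _)).trans (Category.assoc _ _ _).symm

theorem extend_zero [𝓕.Additive] {v : V} {F : List V} (hF : ¬ (v :: F).IsChain (· ≠ ·))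
    (hF1 : F.length ≠ 1) (U : List ℕ) (G : List V) :
    extend A 𝓕 h v (F.length :: U) (F ++ G) = 0 := by
  unfold extend
  rw [imSizes_cons]
  simp only [extendAux]
  rw [ebar_zero A _ _ (red_length_lt hF) hF1, Functor.map_zero, Limits.comp_zero]

/-- Case distinction on the first bead of a chain. -/
theorem bead_cases {v : V} {F : List V} (h0 : F ≠ []) :
    (v :: F).IsChain (· ≠ ·) ∨ F = [v] ∨ (¬ (v :: F).IsChain (· ≠ ·) ∧ F.length ≠ 1) := by
  by_cases h1 : (v :: F).IsChain (· ≠ ·)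
  · exact Or.inl h1
  · by_cases h2 : F.length = 1
    · obtain ⟨w, rfl⟩ := List.length_eq_one_iff.mp h2
      rw [List.isChain_cons_cons] at h1
      right; left
      by_contra h3
      exact h1 ⟨fun e => h3 (by rw [e]), by simp⟩
    · exact Or.inr (Or.inr ⟨h1, h2⟩)

theorem split_bead {n : ℕ} {U : List ℕ} {F : List V} (hF : F.length = (n :: U).sum) :
    ∃ F₁ F₂, F = F₁ ++ F₂ ∧ F₁.length = n ∧ F₂.length = U.sum :=
  ⟨F.take n, F.drop n, (List.take_append_drop n F).symm,
    by simp only [List.sum_cons] at hF; simp; omega,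
    by simp only [List.sum_cons] at hF; simp; omega⟩

end ebar

end Templicial

namespace Templicial

section extendLemmas

variable {C : Type*} [Category C] [MonoidalCategory C] [Preadditive C] {A : AInf C}
variable {V : Type*} [DecidableEq V] {Z : C} {𝓕 𝓖 : C ⥤ C}
  {h : ∀ (U : List ℕ) (_ : List V), Z ⟶ 𝓕.obj (tens A.sus U)}

/-- The natural map `X → (s𝒜)_1 ⊗ X` inserting the unit. -/
def unitNat (A : AInf C) (𝓕 : C ⥤ C) : 𝓕 ⟶ tensorLeft (A.sus 1) ⋙ 𝓕 where
  app X := 𝓕.map ((λ_ X).inv ≫ A.susUnit ▷ X)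
  naturality X Y f := by
    dsimp
    rw [← 𝓕.map_comp, ← 𝓕.map_comp]
    exact congrArg 𝓕.map (unit_whisker_aux A.susUnit f).symm

theorem extend_nat (θ : 𝓕 ⟶ 𝓖) (v : V) (U : List ℕ) (F : List V) :
    extend A 𝓖 (fun U' G' => h U' G' ≫ θ.app _) v U F = extend A 𝓕 h v U F ≫ θ.app _ := by
  simp [extend, extendAux]

theorem endOf_map {W : Type*} (f : W → V) (v : W) (F : List W) :
    endOf (f v) (F.map f) = f (endOf v F) := by
  induction F generalizing v with
  | nil => rfl
  | cons w F ih => exact ih w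

theorem extend_zero_family {v : V} {U : List ℕ} {F : List V} :
    extend A 𝓕 (fun U' _ => (0 : Z ⟶ 𝓕.obj (tens A.sus U'))) v U F = 0 := Limits.zero_comp

theorem extend_map [MonoidalPreadditive C] [𝓕.Additive] {W : Type*} [DecidableEq W] (f : W → V)
    (v : W) (U : List ℕ) (F : List W) (hU : ∀ n ∈ U, 0 < n) (hF : F.length = U.sum) :
    extend A 𝓕 (fun U' G' => extend A 𝓕 h (f v) U' (G'.map f)) v U F =
      extend A 𝓕 h (f v) U (F.map f) := by
  induction U generalizing 𝓕 v F with
  | nil =>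
    simp only [List.sum_nil, List.length_eq_zero_iff] at hF
    subst hF
    rw [extend_nil]
  | cons n U ih =>
    obtain ⟨F₁, F₂, rfl, rfl, h2⟩ := split_bead hF
    have hU' : ∀ n ∈ U, 0 < n := fun n hn => hU n (by simp [hn])
    have h0 : F₁ ≠ [] := List.ne_nil_of_length_pos (hU _ (by simp))
    rcases bead_cases (v := v) h0 with h1 | rfl | ⟨h1, h3⟩
    · refine (extend_id h1 h0 U F₂).trans ?_
      have h0' : F₁.map f ≠ [] := by simpa using h0
      have e0 : ∀ G' : List W, (F₁ ++ G').map f = F₁.map f ++ G'.map f := fun _ => List.map_append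
      rcases bead_cases (v := f v) h0' with h1' | h1' | ⟨h1', h3'⟩
      · have e1 : ∀ (U' : List ℕ) (G' : List W),
            extend A 𝓕 h (f v) (F₁.length :: U') ((F₁ ++ G').map f) =
            extend A (tensorLeft (A.sus F₁.length) ⋙ 𝓕)
              (fun U'' G'' => h (F₁.length :: U'') (F₁.map f ++ G''))
              (f (endOf v F₁)) U' (G'.map f) := fun U' G' => by
          have := extend_id (h := h) h1' h0' U' (G'.map f)
          rw [List.length_map, endOf_map, ← e0] at this
          exact this
        refine Eq.trans (congrArg (fun hh => extend A (tensorLeft (A.sus F₁.length) ⋙ 𝓕)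
          hh (endOf v F₁) U F₂) (funext fun U' => funext fun G' => e1 U' G')) ?_
        refine Eq.trans ?_ (e1 U F₂).symm
        exact ih (𝓕 := tensorLeft (A.sus F₁.length) ⋙ 𝓕) _ _ hU' h2
      · have hl : F₁.length = 1 := by simpa using congrArg List.length h1'
        obtain ⟨w, rfl⟩ := List.length_eq_one_iff.mp hl
        have he : f w = f v := by simpa using h1'
        have e1 : ∀ (U' : List ℕ) (G' : List W),
            extend A 𝓕 h (f v) (1 :: U') (([w] ++ G').map f) =
            extend A 𝓕 h (f w) U' (G'.map f) ≫ (unitNat A 𝓕).app _ := fun U' G' => by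
          rw [e0, h1', he]
          exact extend_unit _ _ _
        refine Eq.trans (congrArg (fun hh => extend A (tensorLeft (A.sus 1) ⋙ 𝓕)
          hh w U F₂) (funext fun U' => funext fun G' => e1 U' G')) ?_
        refine Eq.trans ?_ (e1 U F₂).symm
        refine (extend_nat (unitNat A 𝓕) w U F₂).trans ?_
        exact congrArg (· ≫ (unitNat A 𝓕).app _) (ih _ _ hU' h2)
      · have e1 : ∀ (U' : List ℕ) (G' : List W),
            extend A 𝓕 h (f v) (F₁.length :: U') ((F₁ ++ G').map f) = 0 := fun U' G' => by
          have := extend_zero (𝓕 := 𝓕) (h := h) h1' h3' U' (G'.map f)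
          rw [List.length_map, ← e0] at this
          exact this
        refine Eq.trans (congrArg (fun hh => extend A (tensorLeft (A.sus F₁.length) ⋙ 𝓕)
          hh (endOf v F₁) U F₂) (funext fun U' => funext fun G' => e1 U' G')) ?_
        refine Eq.trans ?_ (e1 U F₂).symm
        exact extend_zero_family
    · refine (extend_unit _ _ _).trans ?_
      refine Eq.trans ?_ (extend_unit _ _ _).symm
      exact congrArg (· ≫ 𝓕.map _) (ih _ _ hU' h2)
    · refine (extend_zero h1 h3 U F₂).trans ?_
      have h1' : ¬ (f v :: F₁.map f).IsChain (· ≠ ·) := by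
        rw [← List.map_cons, List.isChain_map]
        exact fun hc => h1 (hc.imp fun _ _ hne he => hne (by rw [he]))
      have := extend_zero (𝓕 := 𝓕) (h := h) h1' (by simpa using h3) U (F₂.map f)
      rw [List.length_map] at this
      rw [List.map_append]
      exact this.symm

theorem unit_split_aux {B X Y W : C} (u : 𝟙_ C ⟶ B) (s : X ⟶ Y ⊗ W) :
    ((λ_ X).inv ≫ u ▷ X) ≫ B ◁ s ≫ (α_ B Y W).inv = s ≫ ((λ_ Y).inv ≫ u ▷ Y) ▷ W := by
  rw [← Category.assoc, unit_whisker_aux]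
  simp

theorem unit_split (S L : List ℕ) :
    insertAt A.sus [] (S := []) A.susUnit (S ++ L) ≫ (split A.sus (1 :: S) L).hom =
      (split A.sus S L).hom ≫ insertAt A.sus [] (S := []) A.susUnit S ▷ tens A.sus L :=
  unit_split_aux A.susUnit (split A.sus S L).hom

end extendLemmas

end Templicial

namespace Templicial

section extendSplit

variable {C : Type*} [Category C] [MonoidalCategory C]

theorem split_step_aux {B X Y W Y' W' X' : C} (f : X ⟶ X') (s : X' ⟶ Y' ⊗ W') (s' : X ⟶ Y ⊗ W)
    (p : Y ⟶ Y') (q : W ⟶ W') (h : f ≫ s = s' ≫ (p ⊗ₘ q)) :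
    (B ◁ f) ≫ (B ◁ s ≫ (α_ B Y' W').inv) = (B ◁ s' ≫ (α_ B Y W).inv) ≫ ((B ◁ p) ⊗ₘ q) := by
  rw [← Category.assoc, ← whiskerLeft_comp, h, whiskerLeft_comp, Category.assoc, Category.assoc,
    ← id_tensorHom, ← id_tensorHom, ← id_tensorHom, ← associator_inv_naturality]

theorem split_nil_aux {X Y : C} (f : X ⟶ Y) :
    f ≫ (λ_ Y).inv = (λ_ X).inv ≫ (𝟙 (𝟙_ C) ⊗ₘ f) := by
  rw [id_tensorHom, leftUnitor_inv_naturality]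

theorem split_unit_aux {X Y W X' Y' W' B : C} (f : X ⟶ X') (s : X' ⟶ Y' ⊗ W') (s' : X ⟶ Y ⊗ W)
    (p : Y ⟶ Y') (q : W ⟶ W') (h : f ≫ s = s' ≫ (p ⊗ₘ q)) (r : Y' ⟶ B) :
    f ≫ s ≫ r ▷ W' = s' ≫ ((p ≫ r) ⊗ₘ q) := by
  rw [← Category.assoc, h, Category.assoc, ← tensorHom_id, tensorHom_comp_tensorHom,
    Category.comp_id]

variable [Preadditive C] {A : AInf C}

theorem whisker_eqToHom_tens {ι : Type*} (Q : ι → C) (i : ι) {S S' : List ι} (h : S = S') :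
    Q i ◁ eqToHom (congrArg (tens Q) h) =
      eqToHom (congrArg (fun S => tens Q (i :: S)) h) := by
  subst h; exact whiskerLeft_id _ _

theorem ebar_split [MonoidalPreadditive C] (U₁ M₁ U₂ M₂ : List ℕ) (hl : U₁.length = M₁.length) :
    ebar A (U₁ ++ U₂) (M₁ ++ M₂) ≫ (split A.sus U₁ U₂).hom =
      eqToHom (congrArg (tens A.sus) (nz_append M₁ M₂)) ≫ (split A.sus (nz M₁) (nz M₂)).hom ≫
        (ebar A U₁ M₁ ⊗ₘ ebar A U₂ M₂) := by
  induction U₁ generalizing M₁ with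
  | nil =>
    obtain rfl : M₁ = [] := by simpa using hl.symm
    refine Eq.trans (split_nil_aux (ebar A U₂ M₂)) (Eq.symm (Category.id_comp _))
  | cons n U₁ ih =>
    obtain _ | ⟨m, M₁⟩ := M₁
    · simp at hl
    have hl' : U₁.length = M₁.length := by simpa using hl
    have ih := ih M₁ hl'
    by_cases h1 : n = 1 ∧ m = 0
    · obtain ⟨rfl, rfl⟩ := h1
      refine Eq.trans (congrArg (· ≫ (split A.sus (1 :: U₁) U₂).hom)
        (ebar_unit A (U₁ ++ U₂) (M₁ ++ M₂))) ?_
      refine Eq.trans ?_ (congrArg (fun t => eqToHom (congrArg (tens A.sus) (nz_append M₁ M₂)) ≫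
        (split A.sus (nz M₁) (nz M₂)).hom ≫ (t ⊗ₘ ebar A U₂ M₂)) (ebar_unit A U₁ M₁).symm)
      refine (Category.assoc _ _ _).trans ?_
      refine (congrArg (ebar A (U₁ ++ U₂) (M₁ ++ M₂) ≫ ·) (unit_split U₁ U₂)).trans ?_
      refine Eq.trans (split_unit_aux _ _ _ _ _ (ih.trans (Category.assoc _ _ _).symm)
        (insertAt A.sus [] (S := []) A.susUnit U₁)) ?_
      exact Category.assoc _ _ _
    · by_cases h2 : n = m ∧ m ≠ 0
      · obtain ⟨rfl, h2⟩ := h2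
        obtain ⟨m, rfl⟩ := Nat.exists_eq_succ_of_ne_zero h2
        refine Eq.trans (congrArg (· ≫ (split A.sus ((m + 1) :: U₁) U₂).hom)
          (ebar_id A m (U₁ ++ U₂) (M₁ ++ M₂))) ?_
        refine Eq.trans (split_step_aux _ _ _ _ _ (ih.trans (Category.assoc _ _ _).symm)) ?_
        refine Eq.trans ?_ (congrArg (fun t => eqToHom (congrArg (tens A.sus)
          (nz_append ((m + 1) :: M₁) M₂)) ≫
          (split A.sus ((m + 1) :: nz M₁) (nz M₂)).hom ≫ (t ⊗ₘ ebar A U₂ M₂)) (ebar_id A m U₁ M₁).symm)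
        refine Eq.trans ?_ (Category.assoc _ _ _)
        refine congrArg (· ≫ _) ?_
        rw [whiskerLeft_comp, whisker_eqToHom_tens A.sus (m + 1) (nz_append M₁ M₂)]
        exact Category.assoc _ _ _
      · have h3 : ∀ U M : List ℕ, ebar A (n :: U) (m :: M) = 0 := by
          intro U M
          cases m with
          | zero => simp only [ebar]; rw [dif_neg]; tauto
          | succ m => simp only [ebar]; rw [dif_neg]; intro h; exact h2 ⟨h.symm, by simp⟩
        refine Eq.trans (congrArg (· ≫ (split A.sus (n :: U₁) U₂).hom)
          (h3 (U₁ ++ U₂) (M₁ ++ M₂))) ?_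
        refine Eq.trans Limits.zero_comp ?_
        rw [h3, MonoidalPreadditive.zero_tensor, Limits.comp_zero, Limits.comp_zero]

variable {V : Type*} [DecidableEq V] {Z : C} {𝓕 : C ⥤ C}
  {h : ∀ (U : List ℕ) (_ : List V), Z ⟶ 𝓕.obj (tens A.sus U)}

theorem imSizes_append (v : V) (U₁ U₂ : List ℕ) (F₁ F₂ : List V) (hF : F₁.length = U₁.sum) :
    imSizes v (U₁ ++ U₂) (F₁ ++ F₂) = imSizes v U₁ F₁ ++ imSizes (endOf v F₁) U₂ F₂ := by
  induction U₁ generalizing v F₁ with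
  | nil =>
    obtain rfl : F₁ = [] := by simpa using hF
    rfl
  | cons n U ih =>
    obtain ⟨F₁, F₃, rfl, rfl, h2⟩ := split_bead hF
    rw [List.append_assoc, List.cons_append, imSizes_cons, imSizes_cons, ih _ _ h2, endOf_append]
    rfl

theorem imSizes_length (v : V) (U : List ℕ) (F : List V) : (imSizes v U F).length = U.length := by
  induction U generalizing v F with
  | nil => rfl
  | cons n U ih => simp [imSizes, ih]

theorem apply_eqToHom (h : ∀ (U : List ℕ) (_ : List V), Z ⟶ 𝓕.obj (tens A.sus U)) {U U' : List ℕ}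
    {F F' : List V} (hU : U = U') (hF : F = F') :
    h U F ≫ 𝓕.map (eqToHom (congrArg (tens A.sus) hU)) = h U' F' := by
  subst hU hF
  exact (congrArg (h U F ≫ ·) (𝓕.map_id _)).trans (Category.comp_id _)

/-- The extension of a family, on a concatenation of two necklaces. -/
theorem extend_split [MonoidalPreadditive C] (v : V) (U₁ U₂ : List ℕ)
    (F₁ F₂ : List V) (hF : F₁.length = U₁.sum) :
    extend A 𝓕 h v (U₁ ++ U₂) (F₁ ++ F₂) ≫ 𝓕.map (split A.sus U₁ U₂).hom =
      h (nz (imSizes v U₁ F₁) ++ nz (imSizes (endOf v F₁) U₂ F₂))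
        (red v F₁ ++ red (endOf v F₁) F₂) ≫
      𝓕.map ((split A.sus _ _).hom ≫
        (ebar A U₁ (imSizes v U₁ F₁) ⊗ₘ ebar A U₂ (imSizes (endOf v F₁) U₂ F₂))) := by
  have e1 := imSizes_append v U₁ U₂ F₁ F₂ hF
  have e2 := red_append v F₁ F₂
  have e3 := ebar_split (A := A) U₁ (imSizes v U₁ F₁) U₂ (imSizes (endOf v F₁) U₂ F₂)
    (imSizes_length _ _ _).symm
  unfold extend
  rw [e1, e2]
  simp only [extendAux]
  rw [Category.assoc, ← 𝓕.map_comp, e3, 𝓕.map_comp, ← Category.assoc]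
  rw [apply_eqToHom h (nz_append _ _) rfl]

end extendSplit

end Templicial

namespace Templicial

/-- `ε(n₁, ..., n_r) = ∑_{l=1}^{r-1} (r - l) (n_l - 1)`. -/
def sig : List ℕ → ℤ
  | [] => 0
  | n :: S => S.length * ((n : ℤ) - 1) + sig S

/-- The sign `(-1)^{ε(S) + ℓ(S) a}` times the Koszul sign `(-1)^{(ℓ(S) - 2) a}` that arises from
moving `m_{ℓ(S)}` past arguments of total degree `a`. -/
def tanSign (a : ℤ) (S : List ℕ) : ℤˣ :=
  Int.negOnePow (sig S + S.length * a) * Int.negOnePow (((S.length : ℤ) - 2) * a)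

theorem tanSign_eq (a : ℤ) (S : List ℕ) : tanSign a S = Int.negOnePow (sig S) := by
  rw [tanSign, ← Int.negOnePow_add]
  rw [Int.negOnePow_eq_iff]
  refine ⟨(S.length - 1) * a, ?_⟩
  ring

theorem blocks_ne_nil {d : ℕ} (c : Composition (d + 1)) : c.blocks ≠ [] := by
  intro h
  have := c.blocks_sum
  rw [h] at this
  simp at this

section TAN

variable {C : Type*} [Category C] [MonoidalCategory C] [Preadditive C] (A : AInf C)
variable {V : Type*} {Z : C} (𝓕 : C ⥤ C) {𝓖 : C ⥤ C}
  (h : ∀ (U : List ℕ) (_ : List V), Z ⟶ 𝓕.obj (tens A.sus U))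

/-- The left hand side of the relation imposed on a family `h` by the bead of dimension `d + 1` of
the chain `F` with beads `U₁ ++ (d + 1) :: U₂`, namely the signed sum of
`(id ⊗ m ⊗ id) (h_{g ∘ ν})` over the ways `ν` of cutting this bead into smaller ones. -/
def tanL (U₁ : List ℕ) (d : ℕ) (U₂ : List ℕ) (F : List V) :
    Z ⟶ 𝓕.obj (tens A.sus (U₁ ++ d :: U₂)) :=
  ∑ c : Composition (d + 1), tanSign ((U₁.sum : ℤ) - U₁.length) c.blocks •
      (h (U₁ ++ (c.blocks ++ U₂)) F ≫
        𝓕.map (insertAt A.sus U₁ (A.susMul c.blocks d (blocks_ne_nil c) c.blocks_sum) U₂))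

/-- The right hand side of this relation, namely the alternating sum of `h_{g ∘ δ}` over the inner
faces `δ` of this bead, which omit a vertex from the chain. -/
def tanR (U₁ : List ℕ) (d : ℕ) (U₂ : List ℕ) (F : List V) :
    Z ⟶ 𝓕.obj (tens A.sus (U₁ ++ d :: U₂)) :=
  ∑ j : Fin d, Int.negOnePow (j : ℤ) • h (U₁ ++ d :: U₂) (F.eraseIdx (U₁.sum + j))

/-- The relation imposed on a family `h` by a bead. -/
def TAN (U₁ : List ℕ) (d : ℕ) (U₂ : List ℕ) (F : List V) : Prop :=
  tanL A 𝓕 h U₁ d U₂ F = tanR A 𝓕 h U₁ d U₂ F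

variable {A 𝓕 h}

theorem TAN_iff (U₁ : List ℕ) (d : ℕ) (U₂ : List ℕ) (F : List V) :
    TAN A 𝓕 h U₁ d U₂ F ↔
  ∑ c : Composition (d + 1), Int.negOnePow (sig c.blocks) •
      (h (U₁ ++ (c.blocks ++ U₂)) F ≫
        𝓕.map (insertAt A.sus U₁ (A.susMul c.blocks d (blocks_ne_nil c) c.blocks_sum) U₂)) =
    ∑ j : Fin d, Int.negOnePow (j : ℤ) • h (U₁ ++ d :: U₂) (F.eraseIdx (U₁.sum + j)) := by
  simp only [TAN, tanL, tanR, tanSign_eq]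

theorem TAN_cons (U₁ : List ℕ) (d : ℕ) (U₂ : List ℕ) (F G : List V) :
    TAN A (tensorLeft (A.sus F.length) ⋙ 𝓕) (fun U' G' => h (F.length :: U') (F ++ G')) U₁ d U₂ G ↔
    TAN A 𝓕 h (F.length :: U₁) d U₂ (F ++ G) := by
  rw [TAN_iff, TAN_iff]
  have e : ∀ j : Fin d, (F ++ G).eraseIdx ((F.length :: U₁).sum + j) =
      F ++ G.eraseIdx (U₁.sum + j) := fun j => by
    rw [List.eraseIdx_append_of_length_le (by simp; omega)]
    congr 2
    simp; omega
  simp only [e]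
  rfl

theorem TAN_congr {h' : ∀ (U : List ℕ) (_ : List V), Z ⟶ 𝓕.obj (tens A.sus U)}
    (U₁ : List ℕ) (d : ℕ) (U₂ : List ℕ) (F : List V)
    (e₁ : ∀ c : Composition (d + 1), h (U₁ ++ (c.blocks ++ U₂)) F = h' (U₁ ++ (c.blocks ++ U₂)) F)
    (e₂ : ∀ j : Fin d, h (U₁ ++ d :: U₂) (F.eraseIdx (U₁.sum + j)) =
      h' (U₁ ++ d :: U₂) (F.eraseIdx (U₁.sum + j))) :
    TAN A 𝓕 h U₁ d U₂ F ↔ TAN A 𝓕 h' U₁ d U₂ F := by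
  simp only [TAN, tanL, tanR, e₁, e₂]

theorem TAN_zero (U₁ : List ℕ) (d : ℕ) (U₂ : List ℕ) (F : List V) :
    TAN A 𝓕 (fun U' _ => (0 : Z ⟶ 𝓕.obj (tens A.sus U'))) U₁ d U₂ F := by
  simp [TAN, tanL, tanR]

theorem TAN_nat (θ : 𝓕 ⟶ 𝓖) {U₁ : List ℕ} {d : ℕ} {U₂ : List ℕ} {F : List V}
    (H : TAN A 𝓕 h U₁ d U₂ F) : TAN A 𝓖 (fun U' G' => h U' G' ≫ θ.app _) U₁ d U₂ F := by
  rw [TAN_iff] at H ⊢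
  have := congrArg (· ≫ θ.app _) H
  simp only [Preadditive.sum_comp, Linear.units_smul_comp, Category.assoc, NatTrans.naturality]
    at this
  simp only [Category.assoc]
  exact this

theorem tanL_map {Y : C} (M : Y ⟶ 𝓖.obj Z) (h : ∀ (U : List ℕ) (_ : List V), Z ⟶ tens A.sus U)
    [𝓖.Additive] (U₁ : List ℕ) (d : ℕ) (U₂ : List ℕ) (F : List V) :
    M ≫ 𝓖.map (tanL A (𝟭 C) h U₁ d U₂ F) =
      tanL A 𝓖 (fun U' G' => M ≫ 𝓖.map (h U' G')) U₁ d U₂ F := by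
  simp only [tanL, Functor.map_sum, Preadditive.comp_sum, Functor.map_units_smul,
    Linear.comp_units_smul]
  refine Finset.sum_congr rfl fun c _ => congrArg _ ?_
  exact (congrArg (M ≫ ·) (𝓖.map_comp _ _)).trans (Category.assoc _ _ _).symm

theorem tanR_map {Y : C} (M : Y ⟶ 𝓖.obj Z) (h : ∀ (U : List ℕ) (_ : List V), Z ⟶ tens A.sus U)
    [𝓖.Additive] (U₁ : List ℕ) (d : ℕ) (U₂ : List ℕ) (F : List V) :
    M ≫ 𝓖.map (tanR A (𝟭 C) h U₁ d U₂ F) =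
      tanR A 𝓖 (fun U' G' => M ≫ 𝓖.map (h U' G')) U₁ d U₂ F := by
  simp only [tanR, Functor.map_sum, Preadditive.comp_sum, Functor.map_units_smul,
    Linear.comp_units_smul]

end TAN

end Templicial

namespace Templicial

section lists

variable {V : Type*}

theorem ne_chain_cases {v : V} {F : List V} (h : ¬ (v :: F).IsChain (· ≠ ·)) :
    (∃ F', F = v :: F') ∨ ∃ P x H, F = P ++ x :: x :: H := by
  induction F generalizing v with
  | nil => simp at h
  | cons w F ih =>
    by_cases e : v = w
    · exact Or.inl ⟨F, by rw [e]⟩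
    · rw [List.isChain_cons_cons, not_and] at h
      rcases ih (h e) with ⟨F', rfl⟩ | ⟨P, x, H, rfl⟩
      · exact Or.inr ⟨[], w, F', rfl⟩
      · exact Or.inr ⟨w :: P, x, H, rfl⟩

theorem not_chain_of_repeat (P : List V) (x : V) (H : List V) :
    ¬ (P ++ x :: x :: H).IsChain (· ≠ ·) := by
  intro h
  have := h.right_of_append
  rw [List.isChain_cons_cons] at this
  exact this.1 rfl

theorem not_chain_eraseIdx (P : List V) (x : V) (H : List V) (j : ℕ)
    (h1 : j ≠ P.length) (h2 : j ≠ P.length + 1) :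
    ¬ ((P ++ x :: x :: H).eraseIdx j).IsChain (· ≠ ·) := by
  rcases Nat.lt_or_ge j P.length with h | h
  · rw [List.eraseIdx_append_of_lt_length h]
    exact not_chain_of_repeat _ _ _
  · rw [List.eraseIdx_append_of_length_le h]
    obtain ⟨k, hk⟩ := Nat.exists_eq_add_of_le h
    obtain ⟨i, rfl⟩ : ∃ i, k = i + 2 := ⟨k - 2, by omega⟩
    have : j - P.length = i + 2 := by omega
    rw [this]
    exact not_chain_of_repeat _ _ _

theorem endOf_concat [DecidableEq V] (v : V) (P : List V) (x : V) : endOf v (P ++ [x]) = x := by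
  rw [endOf_append]; rfl

end lists

section kill

variable {C : Type*} [Category C] [MonoidalCategory C] [Preadditive C] {A : AInf C}

theorem ebar_kill {X : C} (U M : List ℕ) (hM : M.sum < U.sum) (𝓕 : C ⥤ C)
    [MonoidalPreadditive C] [𝓕.Additive] (φ : 𝓕.obj (tens A.sus U) ⟶ X)
    (hφ : ∀ (U₁ U₂ : List ℕ) (e : U = U₁ ++ 1 :: U₂),
      𝓕.map (insertAt A.sus U₁ (S := []) A.susUnit U₂) ≫
        cast (congrArg (fun U => 𝓕.obj (tens A.sus U) ⟶ X) e) φ = 0) :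
    𝓕.map (ebar A U M) ≫ φ = 0 := by
  induction U generalizing M 𝓕 with
  | nil => simp at hM
  | cons n U ih =>
    obtain _ | ⟨m, M⟩ := M
    · simp only [ebar, Functor.map_zero, Limits.zero_comp]
    by_cases h1 : n = 1 ∧ m = 0
    · obtain ⟨rfl, rfl⟩ := h1
      refine Eq.trans (congrArg (fun t => 𝓕.map t ≫ φ) (ebar_unit A U M)) ?_
      refine Eq.trans (congrArg (· ≫ φ) (𝓕.map_comp _ _)) ?_
      refine (Category.assoc _ _ _).trans ?_
      exact Eq.trans (congrArg (𝓕.map (ebar A U M) ≫ ·) (hφ [] U rfl)) Limits.comp_zero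
    · by_cases h2 : n = m ∧ m ≠ 0
      · obtain ⟨rfl, h2⟩ := h2
        obtain ⟨m, rfl⟩ := Nat.exists_eq_succ_of_ne_zero h2
        rw [ebar_id]
        refine ih M (by simpa using hM) (tensorLeft (A.sus (m + 1)) ⋙ 𝓕) φ ?_
        rintro U₁ U₂ rfl
        exact hφ ((m + 1) :: U₁) U₂ rfl
      · have h3 : ∀ U M : List ℕ, ebar A (n :: U) (m :: M) = 0 := by
          intro U M
          cases m with
          | zero => simp only [ebar]; rw [dif_neg]; tauto
          | succ m => simp only [ebar]; rw [dif_neg]; intro h; exact h2 ⟨h.symm, by simp⟩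
        rw [h3, Functor.map_zero, Limits.zero_comp]

theorem ebar_susMul [MonoidalPreadditive C] (S M : List ℕ) (d : ℕ) (hS h) (hM : M.sum < S.sum)
    (hl : 2 < S.length) :
    ebar A S M ≫ A.susMul S d hS h = 0 := by
  refine ebar_kill S M hM (𝟭 C) (A.susMul S d hS h) ?_
  rintro U₁ U₂ rfl
  exact A.susMul_unit_zero U₁ U₂ d hS h hl

end kill

end Templicial

namespace Templicial

section lists

variable {V : Type*} [LinearOrder V]

theorem red_lt {v : V} {F : List V} (h : (v :: F).IsChain (· ≤ ·)) :
    (v :: red v F).IsChain (· < ·) := by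
  induction F generalizing v with
  | nil => simp [red]
  | cons w F ih =>
    rw [List.isChain_cons_cons] at h
    unfold red
    split_ifs with e
    · subst e; exact ih h.2
    · rw [List.isChain_cons_cons]
      exact ⟨lt_of_le_of_ne h.1 (fun e' => e e'.symm), ih h.2⟩

theorem imSizes_of_chain {v : V} {U : List ℕ} {F : List V} (hF : F.length = U.sum)
    (h : (v :: F).IsChain (· ≠ ·)) : imSizes v U F = U := by
  induction U generalizing v F with
  | nil => rfl
  | cons n U ih =>
    obtain ⟨F₁, F₂, rfl, rfl, h2⟩ := split_bead hF
    have h1 : (v :: F₁).IsChain (· ≠ ·) := List.IsChain.left_of_append (l₂ := F₂) (by simpa using h)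
    have h3 : (endOf v F₁ :: F₂).IsChain (· ≠ ·) := by
      clear hF h2 ih h1
      induction F₁ generalizing v with
      | nil => exact h
      | cons w F₁ ih => exact ih (List.isChain_cons_cons.mp h).2
    rw [imSizes_cons, ih h2 h3, red_eq_of_chain h1]

theorem chain_endOf {R : V → V → Prop} {v : V} {F₁ F₂ : List V} (h : (v :: (F₁ ++ F₂)).IsChain R) :
    (endOf v F₁ :: F₂).IsChain R := by
  induction F₁ generalizing v with
  | nil => exact h
  | cons w F₁ ih => exact ih (List.isChain_cons_cons.mp h).2

theorem chain_append_of {R : V → V → Prop} {v : V} {F₁ F₂ : List V} (h : (v :: F₁).IsChain R)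
    (h' : (endOf v F₁ :: F₂).IsChain R) : (v :: (F₁ ++ F₂)).IsChain R := by
  induction F₁ generalizing v with
  | nil => exact h'
  | cons w F₁ ih =>
    rw [List.isChain_cons_cons] at h
    rw [List.cons_append, List.isChain_cons_cons]
    exact ⟨h.1, ih h.2 h'⟩

theorem endOf_eraseIdx (v : V) (F : List V) (j : ℕ) (hj : j + 1 < F.length) :
    endOf v (F.eraseIdx j) = endOf v F := by
  induction F generalizing v j with
  | nil => simp at hj
  | cons w F ih =>
    cases j with
    | zero =>
      obtain ⟨x, F, rfl⟩ := List.exists_cons_of_length_pos (l := F) (by simpa using hj)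
      rfl
    | succ j => exact ih w j (by simpa using hj)

theorem eraseIdx_lt {v : V} {F : List V} (h : (v :: F).IsChain (· < ·)) (j : ℕ) :
    (v :: F.eraseIdx j).IsChain (· < ·) := by
  rw [List.isChain_iff_pairwise] at h ⊢
  exact h.sublist (List.Sublist.cons_cons v (List.eraseIdx_sublist F j))

theorem ne_of_lt_chain {v : V} {F : List V} (h : (v :: F).IsChain (· < ·)) :
    (v :: F).IsChain (· ≠ ·) := h.imp fun _ _ => ne_of_lt

end lists

section base

variable {C : Type*} [Category C] [MonoidalCategory C] [Preadditive C] {A : AInf C}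
variable {V : Type*} [LinearOrder V] {Z : C} {𝓕 : C ⥤ C}
  {h : ∀ (U : List ℕ) (_ : List V), Z ⟶ 𝓕.obj (tens A.sus U)}

theorem term_eq [MonoidalPreadditive C] (v : V) (S U₂ : List ℕ) (F₁ F₂ : List V)
    (hF : F₁.length = S.sum) {X : C} (m : tens A.sus S ⟶ X) :
    extend A 𝓕 h v (S ++ U₂) (F₁ ++ F₂) ≫ 𝓕.map ((split A.sus S U₂).hom ≫ m ▷ tens A.sus U₂) =
      h (nz (imSizes v S F₁) ++ nz (imSizes (endOf v F₁) U₂ F₂))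
        (red v F₁ ++ red (endOf v F₁) F₂) ≫
      𝓕.map ((split A.sus _ _).hom ≫
        ((ebar A S (imSizes v S F₁) ≫ m) ⊗ₘ ebar A U₂ (imSizes (endOf v F₁) U₂ F₂))) := by
  rw [𝓕.map_comp, ← Category.assoc, extend_split v S U₂ F₁ F₂ hF, Category.assoc, ← 𝓕.map_comp,
    Category.assoc, ← tensorHom_id, tensorHom_comp_tensorHom, Category.comp_id]

theorem term_strict_aux (N S L L' : List ℕ) (R : List V) (hN : N = S)
    (e : tens A.sus N ⟶ tens A.sus S) (he : e = eqToHom (congrArg (tens A.sus) hN)) {X : C}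
    (m : tens A.sus S ⟶ X) (g : tens A.sus L ⟶ tens A.sus L') :
    h (N ++ L) R ≫ 𝓕.map ((split A.sus N L).hom ≫ ((e ≫ m) ⊗ₘ g)) =
      (h (S ++ L) R ≫ 𝓕.map ((split A.sus S L).hom ≫ m ▷ tens A.sus L)) ≫ 𝓕.map (X ◁ g) := by
  subst hN
  subst he
  rw [Category.assoc, ← 𝓕.map_comp, Category.assoc, eqToHom_refl, Category.id_comp, MonoidalCategory.tensorHom_def]

theorem term_strict [MonoidalPreadditive C] (v : V) (S U₂ : List ℕ) (F₁ F₂ : List V)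
    (hF : F₁.length = S.sum) (hS : ∀ n ∈ S, 0 < n) (hc : (v :: F₁).IsChain (· ≠ ·))
    {X : C} (m : tens A.sus S ⟶ X) :
    extend A 𝓕 h v (S ++ U₂) (F₁ ++ F₂) ≫ 𝓕.map ((split A.sus S U₂).hom ≫ m ▷ tens A.sus U₂) =
      (h (S ++ nz (imSizes (endOf v F₁) U₂ F₂)) (F₁ ++ red (endOf v F₁) F₂) ≫
        𝓕.map ((split A.sus S _).hom ≫ m ▷ _)) ≫
      𝓕.map (X ◁ ebar A U₂ (imSizes (endOf v F₁) U₂ F₂)) := by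
  rw [term_eq v S U₂ F₁ F₂ hF m, imSizes_of_chain hF hc, red_eq_of_chain hc]
  exact term_strict_aux _ _ _ _ _ (nz_of_pos hS) _ (ebar_self A hS) _ _

theorem term_three [MonoidalPreadditive C] [𝓕.Additive] (v : V) (S U₂ : List ℕ) (F₁ F₂ : List V)
    (hF : F₁.length = S.sum) (hc : ¬ (v :: F₁).IsChain (· ≠ ·)) (d : ℕ) (hS hs)
    (hl : 2 < S.length) :
    extend A 𝓕 h v (S ++ U₂) (F₁ ++ F₂) ≫
      𝓕.map ((split A.sus S U₂).hom ≫ A.susMul S d hS hs ▷ tens A.sus U₂) = 0 := by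
  rw [term_eq v S U₂ F₁ F₂ hF, ebar_susMul _ _ d hS hs _ hl, MonoidalPreadditive.zero_tensor,
    Limits.comp_zero, Functor.map_zero, Limits.comp_zero]
  rw [imSizes_sum _ _ _ hF, ← hF]
  exact red_length_lt hc

theorem erase_strict (v : V) {d : ℕ} (hd : 0 < d) (U₂ : List ℕ) (F₁ F₂ : List V)
    (hF : F₁.length = d) (hc : (v :: F₁).IsChain (· ≠ ·)) :
    extend A 𝓕 h v (d :: U₂) (F₁ ++ F₂) =
      h (d :: nz (imSizes (endOf v F₁) U₂ F₂)) (F₁ ++ red (endOf v F₁) F₂) ≫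
        𝓕.map (A.sus d ◁ ebar A U₂ (imSizes (endOf v F₁) U₂ F₂)) := by
  subst hF
  exact extend_id hc (List.ne_nil_of_length_pos hd) U₂ F₂

end base

end Templicial

namespace Templicial

section base

variable {C : Type*} [Category C] [MonoidalCategory C] [Preadditive C] {A : AInf C}
variable {V : Type*} [LinearOrder V] {Z : C} {𝓕 : C ⥤ C}
  {h : ∀ (U : List ℕ) (_ : List V), Z ⟶ 𝓕.obj (tens A.sus U)}

/-- The left hand side terms of the relation at the first bead. -/
theorem insertAt_nil (S : List ℕ) (d : ℕ) (hS hs) (U : List ℕ) :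
    insertAt A.sus [] (A.susMul S d hS hs) U =
      (split A.sus S U).hom ≫ A.susMul S d hS hs ▷ tens A.sus U := rfl

theorem unit_left_aux {X Y U : C} (u : 𝟙_ C ⟶ U) (m : U ⊗ (X ⊗ 𝟙_ C) ⟶ X)
    (hm : ((λ_ (X ⊗ 𝟙_ C)).inv ≫ u ▷ _) ≫ m = (ρ_ X).hom) :
    ((λ_ (X ⊗ Y)).inv ≫ u ▷ _) ≫ (U ◁ (X ◁ (λ_ Y).inv ≫ (α_ _ _ _).inv) ≫ (α_ _ _ _).inv) ≫
      m ▷ Y = 𝟙 _ := by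
  rw [← Category.assoc, unit_split_aux, Category.assoc, ← comp_whiskerRight, hm]
  simp

theorem unit_right_aux {X Y U : C} (u : 𝟙_ C ⟶ U) (m : X ⊗ (U ⊗ 𝟙_ C) ⟶ X)
    (hm : X ◁ ((λ_ (𝟙_ C)).inv ≫ u ▷ _) ≫ m = (ρ_ X).hom) :
    X ◁ ((λ_ Y).inv ≫ u ▷ Y) ≫ (X ◁ (U ◁ (λ_ Y).inv ≫ (α_ _ _ _).inv) ≫ (α_ _ _ _).inv) ≫
      m ▷ Y = 𝟙 _ := by
  have e : X ◁ ((λ_ Y).inv ≫ u ▷ Y) ≫ (X ◁ (U ◁ (λ_ Y).inv ≫ (α_ _ _ _).inv) ≫ (α_ _ _ _).inv) =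
      (X ◁ (λ_ Y).inv ≫ (α_ _ _ _).inv) ≫ (X ◁ ((λ_ (𝟙_ C)).inv ≫ u ▷ _)) ▷ Y := by
    rw [← Category.assoc, ← whiskerLeft_comp, unit_split_aux]
    simp only [whiskerLeft_comp, comp_whiskerRight, Category.assoc]
    monoidal
  rw [← Category.assoc, e, Category.assoc, ← comp_whiskerRight, hm]
  simp

theorem unit_left_insert (n : ℕ) (U : List ℕ) (hS hs) :
    insertAt A.sus [] (S := []) A.susUnit (n :: U) ≫
      insertAt A.sus [] (A.susMul [1, n] n hS hs) U = 𝟙 (tens A.sus (n :: U)) :=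
  unit_left_aux A.susUnit (A.susMul [1, n] n hS hs) (A.susMul_unit_left n hS hs)

theorem unit_right_insert (n : ℕ) (U : List ℕ) (hS hs) :
    insertAt A.sus [n] (S := []) A.susUnit U ≫
      insertAt A.sus [] (A.susMul [n, 1] n hS hs) U = 𝟙 (tens A.sus (n :: U)) :=
  unit_right_aux A.susUnit (A.susMul [n, 1] n hS hs) (A.susMul_unit_right n hS hs)

theorem unit_cycle_insert [MonoidalPreadditive C] (U : List ℕ) (hS hs) :
    insertAt A.sus [] (S := []) A.susUnit U ≫ insertAt A.sus [] (A.susMul [1] 0 hS hs) U = 0 := by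
  refine (Category.assoc _ _ _).symm.trans ?_
  refine (congrArg (· ≫ A.susMul [1] 0 hS hs ▷ tens A.sus U) (unit_split (A := A) [] U)).trans ?_
  refine (Category.assoc _ _ _).trans ?_
  refine (congrArg ((split A.sus [] U).hom ≫ ·) (comp_whiskerRight _ _ _).symm).trans ?_
  refine (congrArg (fun t => (split A.sus [] U).hom ≫ t ▷ tens A.sus U)
    (A.susMul_unit_cycle hS hs)).trans ?_
  rw [MonoidalPreadditive.zero_whiskerRight, Limits.comp_zero]

/-- The term for `[1, d]` when the chain starts with a repetition. -/
theorem term_left (v : V) (d : ℕ) (U : List ℕ) (G : List V) (hS hs) :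
    extend A 𝓕 h v (1 :: d :: U) (v :: G) ≫
      𝓕.map (insertAt A.sus [] (A.susMul [1, d] d hS hs) U) = extend A 𝓕 h v (d :: U) G := by
  refine (congrArg (· ≫ 𝓕.map (insertAt A.sus [] (A.susMul [1, d] d hS hs) U))
    (extend_unit v (d :: U) G)).trans ?_
  refine (Category.assoc _ _ _).trans ?_
  refine (congrArg (extend A 𝓕 h v (d :: U) G ≫ ·) (𝓕.map_comp _ _).symm).trans ?_
  refine (congrArg (fun t => extend A 𝓕 h v (d :: U) G ≫ 𝓕.map t)
    (unit_left_insert d U hS hs)).trans ?_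
  rw [𝓕.map_id, Category.comp_id]

theorem extend_second_unit [𝓕.Additive] [MonoidalPreadditive C] (v : V) (P : List V) (hP : P ≠ [])
    (U : List ℕ) (G : List V) :
    extend A 𝓕 h v (P.length :: 1 :: U) (P ++ endOf v P :: G) =
      extend A 𝓕 h v (P.length :: U) (P ++ G) ≫
        𝓕.map (insertAt A.sus [P.length] (S := []) A.susUnit U) := by
  rcases bead_cases (v := v) hP with h1 | rfl | ⟨h1, h3⟩
  · refine (extend_id h1 hP (1 :: U) (endOf v P :: G)).trans ?_
    refine (extend_unit (endOf v P) U G).trans ?_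
    exact congrArg (· ≫ 𝓕.map (insertAt A.sus [P.length] (S := []) A.susUnit U))
      (extend_id h1 hP U G).symm
  · refine (extend_unit v (1 :: U) (v :: G)).trans ?_
    refine (congrArg (· ≫ 𝓕.map (insertAt A.sus [] (S := []) A.susUnit (1 :: U)))
      (extend_unit v U G)).trans ?_
    refine Eq.trans ?_ (congrArg (· ≫ 𝓕.map (insertAt A.sus [1] (S := []) A.susUnit U))
      (extend_unit v U G)).symm
    refine (Category.assoc _ _ _).trans (Eq.trans ?_ (Category.assoc _ _ _).symm)
    refine congrArg (extend A 𝓕 h v U G ≫ ·) ?_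
    refine (𝓕.map_comp _ _).symm.trans (Eq.trans ?_ (𝓕.map_comp _ _))
    refine congrArg 𝓕.map ?_
    exact (unit_whisker_aux A.susUnit (insertAt A.sus [] (S := []) A.susUnit U)).symm
  · rw [extend_zero h1 h3, extend_zero h1 h3, Limits.zero_comp]

/-- The term for `[d, 1]` when the chain ends with a repetition. -/
theorem term_right [𝓕.Additive] [MonoidalPreadditive C] (v : V) (P : List V) (hP : P ≠ [])
    (U : List ℕ) (G : List V) (hS hs) :
    extend A 𝓕 h v (P.length :: 1 :: U) (P ++ endOf v P :: G) ≫
      𝓕.map (insertAt A.sus [] (A.susMul [P.length, 1] P.length hS hs) U) =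
    extend A 𝓕 h v (P.length :: U) (P ++ G) := by
  refine (congrArg (· ≫ 𝓕.map (insertAt A.sus [] (A.susMul [P.length, 1] P.length hS hs) U))
    (extend_second_unit v P hP U G)).trans ?_
  refine (Category.assoc _ _ _).trans ?_
  refine (congrArg (extend A 𝓕 h v (P.length :: U) (P ++ G) ≫ ·) (𝓕.map_comp _ _).symm).trans ?_
  refine (congrArg (fun t => extend A 𝓕 h v (P.length :: U) (P ++ G) ≫ 𝓕.map t)
    (unit_right_insert P.length U hS hs)).trans ?_
  rw [𝓕.map_id, Category.comp_id]

end base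

end Templicial

namespace Templicial

section base

variable {C : Type*} [Category C] [MonoidalCategory C] [Preadditive C] [MonoidalPreadditive C]
variable {A : AInf C} {V : Type*} [LinearOrder V] {Z : C} {𝓕 : C ⥤ C}
  {h : ∀ (U : List ℕ) (_ : List V), Z ⟶ 𝓕.obj (tens A.sus U)}

theorem term_zero [𝓕.Additive] (v : V) (S : List ℕ) (d : ℕ) (hS hs) (hpos : ∀ n ∈ S, 0 < n)
    (U : List ℕ) (F₁ F₂ : List V) (hF : F₁.length = S.sum) (hc : ¬ (v :: F₁).IsChain (· ≠ ·))
    (hd : 0 < d) :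
    extend A 𝓕 h v (S ++ U) (F₁ ++ F₂) ≫ 𝓕.map (insertAt A.sus [] (A.susMul S d hS hs) U) = 0 ∨
    (∃ G, S = [1, d] ∧ F₁ = v :: G) ∨
    (∃ P, P ≠ [] ∧ (v :: P).IsChain (· ≠ ·) ∧ S = [P.length, 1] ∧ F₁ = P ++ [endOf v P]) := by
  match S, hS, hs, hpos, hF with
  | [], hS, _, _, _ => exact absurd rfl hS
  | [n], hS, hs, hpos, hF =>
    left
    have hn : F₁.length = n := by simpa using hF
    have : extend A 𝓕 h v ([n] ++ U) (F₁ ++ F₂) = 0 := by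
      rw [← hn]
      exact extend_zero hc (by simp at hs; omega) U F₂
    rw [this, Limits.zero_comp]
  | [p, q], hS, hs, hpos, hF =>
    obtain ⟨P, Q, rfl, rfl, hQ⟩ := split_bead hF
    obtain rfl : Q.length = q := by simpa using hQ
    have hP0 : P ≠ [] := List.ne_nil_of_length_pos (hpos _ (by simp))
    have hQ0 : Q ≠ [] := List.ne_nil_of_length_pos (hpos Q.length (by simp))
    have hadd : P.length + Q.length = d + 1 := by simpa using hs
    rcases bead_cases (v := v) hP0 with h1 | rfl | ⟨h1, h3⟩
    · rcases bead_cases (v := endOf v P) hQ0 with h2 | h2 | ⟨h2, h4⟩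
      · exact absurd (chain_append_of h1 h2) hc
      · subst h2
        exact Or.inr (Or.inr ⟨P, hP0, h1, rfl, rfl⟩)
      · left
        have : extend A 𝓕 h v ([P.length, Q.length] ++ U) ((P ++ Q) ++ F₂) = 0 := by
          rw [List.append_assoc]
          refine (extend_id h1 hP0 (Q.length :: U) (Q ++ F₂)).trans ?_
          exact extend_zero (𝓕 := tensorLeft (A.sus P.length) ⋙ 𝓕) h2 h4 U F₂
        rw [this, Limits.zero_comp]
    · refine Or.inr (Or.inl ⟨Q, ?_, rfl⟩)
      rw [List.length_singleton] at hadd ⊢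
      rw [show Q.length = d by omega]
    · left
      have : extend A 𝓕 h v ([P.length, Q.length] ++ U) ((P ++ Q) ++ F₂) = 0 := by
        rw [List.append_assoc]
        exact extend_zero h1 h3 (Q.length :: U) (Q ++ F₂)
      rw [this, Limits.zero_comp]
  | a :: b :: c :: S, hS, hs, hpos, hF =>
    left
    exact term_three v _ U F₁ F₂ hF hc d hS hs (by simp)

theorem tan_strict [𝓕.Additive] (v : V) (d : ℕ) (U : List ℕ) (F₁ F₂ : List V)
    (hF₁ : F₁.length = d + 1) (hc : (v :: F₁).IsChain (· < ·))
    (H : TAN A 𝓕 h [] d (nz (imSizes (endOf v F₁) U F₂)) (F₁ ++ red (endOf v F₁) F₂)) :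
    TAN A 𝓕 (extend A 𝓕 h v) [] d U (F₁ ++ F₂) := by
  have hc' := ne_of_lt_chain hc
  rw [TAN_iff] at H ⊢
  have H' := congrArg (· ≫ 𝓕.map (A.sus d ◁ ebar A U (imSizes (endOf v F₁) U F₂))) H
  simp only [Preadditive.sum_comp, Linear.units_smul_comp] at H'
  refine Eq.trans (Finset.sum_congr rfl fun c _ => ?_) (H'.trans
    (Finset.sum_congr rfl fun j _ => ?_))
  · exact congrArg _ (term_strict v c.blocks U F₁ F₂ (hF₁.trans c.blocks_sum.symm)
      (fun n hn => c.blocks_pos hn) hc' (A.susMul c.blocks d (blocks_ne_nil c) c.blocks_sum))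
  · refine congrArg _ ?_
    have hj := j.isLt
    have hlt : (([] : List ℕ).sum + j) < F₁.length := by simp; omega
    have e1 : endOf v (F₁.eraseIdx (([] : List ℕ).sum + j)) = endOf v F₁ :=
      endOf_eraseIdx v F₁ _ (by simp; omega)
    have := erase_strict (h := h) (𝓕 := 𝓕) v (d := d) (by omega) U
      (F₁.eraseIdx (([] : List ℕ).sum + j)) F₂
      (by rw [List.length_eraseIdx_of_lt hlt]; omega) (ne_of_lt_chain (eraseIdx_lt hc _))
    rw [e1, ← List.eraseIdx_append_of_lt_length hlt, ← List.eraseIdx_append_of_lt_length hlt] at this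
    exact this.symm

theorem tan_unit [𝓕.Additive] (v : V) (U : List ℕ) (F₂ : List V) :
    TAN A 𝓕 (extend A 𝓕 h v) [] 0 U ([v] ++ F₂) := by
  rw [TAN_iff]
  refine Eq.trans (Finset.sum_eq_zero fun c _ => ?_) (by simp)
  have key : ∀ (S : List ℕ) (hS : S ≠ []) (hs : S.sum = 0 + 1), (∀ n ∈ S, 0 < n) →
      extend A 𝓕 h v (S ++ U) ([v] ++ F₂) ≫
        𝓕.map (insertAt A.sus [] (A.susMul S 0 hS hs) U) = 0 := by
    intro S hS hs hp
    match S, hS, hs, hp with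
    | [], hS, _, _ => exact absurd rfl hS
    | [n], hS, hs, hp =>
      obtain rfl : n = 1 := by simpa using hs
      refine (congrArg (· ≫ 𝓕.map (insertAt A.sus [] (A.susMul [1] 0 hS hs) U))
        (extend_unit v U F₂)).trans ?_
      refine (Category.assoc _ _ _).trans ?_
      refine (congrArg (extend A 𝓕 h v U F₂ ≫ ·) (𝓕.map_comp _ _).symm).trans ?_
      refine (congrArg (fun t => extend A 𝓕 h v U F₂ ≫ 𝓕.map t)
        (unit_cycle_insert U hS hs)).trans ?_
      rw [𝓕.map_zero, Limits.comp_zero]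
    | a :: b :: S, _, hs, hp =>
      have h1 := hp a (by simp)
      have h2 := hp b (by simp)
      simp only [List.sum_cons] at hs
      omega
  exact (congrArg _ (key c.blocks (blocks_ne_nil c) c.blocks_sum
    fun n hn => c.blocks_pos hn)).trans (smul_zero _)

theorem erase_zero [𝓕.Additive] (v : V) (d : ℕ) (U : List ℕ) (F₁ F₂ : List V) (j : ℕ)
    (hF : F₁.length = d + 1) (hj : j < d) (hd : d ≠ 1)
    (hc : ¬ (v :: F₁.eraseIdx j).IsChain (· ≠ ·)) :
    extend A 𝓕 h v ([] ++ d :: U) ((F₁ ++ F₂).eraseIdx (([] : List ℕ).sum + j)) = 0 := by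
  rw [List.sum_nil, zero_add, List.eraseIdx_append_of_lt_length (by omega)]
  have hl : (F₁.eraseIdx j).length = d := by
    rw [List.length_eraseIdx_of_lt (by omega)]; omega
  have := extend_zero (A := A) (h := h) (𝓕 := 𝓕) hc (by omega) U F₂
  rwa [hl] at this

theorem tan_left [𝓕.Additive] (v : V) (d : ℕ) (hd : 0 < d) (U : List ℕ) (G F₂ : List V)
    (hF : (v :: G).length = d + 1) :
    TAN A 𝓕 (extend A 𝓕 h v) [] d U (v :: G ++ F₂) := by
  have hc : ¬ (v :: v :: G).IsChain (· ≠ ·) := not_chain_of_repeat [] v G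
  have hG : G.length = d := by simpa using hF
  rw [TAN_iff]
  let c₀ : Composition (d + 1) := ⟨[1, d], by simp; omega, by simp; omega⟩
  let j₀ : Fin d := ⟨0, hd⟩
  rw [Finset.sum_eq_single c₀, Finset.sum_eq_single j₀]
  · have e := term_left (A := A) (h := h) (𝓕 := 𝓕) v d U (G ++ F₂) (blocks_ne_nil c₀) c₀.blocks_sum
    refine (congrArg (Int.negOnePow (sig c₀.blocks) • ·) e).trans ?_
    have : sig c₀.blocks = 0 := by simp [c₀, sig]
    rw [this]
    simp [j₀]
  · intro j _ hj
    have hj0 : (j : ℕ) ≠ 0 := fun e => hj (Fin.ext e)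
    rw [erase_zero v d U (v :: G) F₂ j hF j.isLt (by omega), smul_zero]
    obtain ⟨i, hi⟩ := Nat.exists_eq_succ_of_ne_zero hj0
    rw [hi]
    exact not_chain_of_repeat [] v _
  · simp
  · intro c _ hne
    rcases term_zero (A := A) (h := h) (𝓕 := 𝓕) v c.blocks d (blocks_ne_nil c) c.blocks_sum
      (fun n hn => c.blocks_pos hn) U (v :: G) F₂ (hF.trans c.blocks_sum.symm) hc hd with
      h0 | ⟨G', h1, -⟩ | ⟨P, hP, hP', h1, h2⟩
    · exact (congrArg _ h0).trans (smul_zero _)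
    · exact absurd (Composition.ext h1) hne
    · exfalso
      obtain ⟨w, P, rfl⟩ := List.exists_cons_of_ne_nil hP
      rw [List.cons_append, List.cons.injEq] at h2
      obtain ⟨rfl, -⟩ := h2
      exact not_chain_of_repeat [] v _ hP'
  · simp

theorem tan_right [𝓕.Additive] (v : V) (d : ℕ) (U : List ℕ) (P F₂ : List V) (x : V)
    (hF : (P ++ [x, x]).length = d + 1) (hv : ∀ G, P ++ [x, x] ≠ v :: G) :
    TAN A 𝓕 (extend A 𝓕 h v) [] d U (P ++ [x, x] ++ F₂) := by
  have hc : ¬ (v :: (P ++ [x, x])).IsChain (· ≠ ·) := not_chain_of_repeat (v :: P) x []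
  have hP : P.length + 1 = d := by simpa using hF
  subst hP
  rw [TAN_iff]
  let c₀ : Composition (P.length + 1 + 1) := ⟨[P.length + 1, 1], by simp, by simp⟩
  let j₀ : Fin (P.length + 1) := ⟨P.length, by omega⟩
  have hQ : P ++ [x, x] = (P ++ [x]) ++ endOf v (P ++ [x]) :: [] := by simp [endOf_concat]
  have hQl : (P ++ [x]).length = P.length + 1 := by simp
  rw [Finset.sum_eq_single c₀, Finset.sum_eq_single j₀]
  · have e := fun hS hs => term_right (A := A) (h := h) (𝓕 := 𝓕) v (P ++ [x]) (by simp) U F₂ hS hs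
    rw [endOf_concat, hQl] at e
    have e' := e (blocks_ne_nil c₀) c₀.blocks_sum
    have e2 : P ++ [x, x] ++ F₂ = (P ++ [x]) ++ x :: F₂ := by simp
    have e3 : (P ++ [x] ++ x :: F₂).eraseIdx (([] : List ℕ).sum + j₀) = P ++ [x] ++ F₂ := by
      rw [List.append_assoc, List.eraseIdx_append_of_length_le (by simp [j₀])]
      simp [j₀]
    rw [e2, e3]
    refine (congrArg (Int.negOnePow (sig c₀.blocks) • ·) e').trans ?_
    have : sig c₀.blocks = (j₀ : ℕ) := by simp [c₀, sig, j₀]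
    rw [this]
    rfl
  · intro j _ hj
    have hj0 : (j : ℕ) ≠ P.length := fun e => hj (Fin.ext e)
    have hlt : (j : ℕ) < P.length := by omega
    rw [erase_zero v _ U (P ++ [x, x]) F₂ j hF j.isLt (by omega), smul_zero]
    rw [List.eraseIdx_append_of_lt_length hlt]
    exact not_chain_of_repeat (v :: P.eraseIdx j) x []
  · simp
  · intro c _ hne
    rcases term_zero (A := A) (h := h) (𝓕 := 𝓕) v c.blocks _ (blocks_ne_nil c) c.blocks_sum
      (fun n hn => c.blocks_pos hn) U (P ++ [x, x]) F₂ (hF.trans c.blocks_sum.symm) hc (by omega)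
      with h0 | ⟨G', -, h1⟩ | ⟨P', -, -, h1, h2⟩
    · exact (congrArg _ h0).trans (smul_zero _)
    · exact absurd h1 (hv _)
    · have hl := congrArg List.length h2
      simp only [List.length_append, List.length_cons, List.length_nil] at hl
      exact absurd (Composition.ext (h1.trans (by simp [c₀]; omega))) hne
  · simp

theorem tan_middle [𝓕.Additive] (v : V) (d : ℕ) (U : List ℕ) (P H F₂ : List V) (x : V)
    (hF : (P ++ x :: x :: H).length = d + 1) (hv : ∀ G, P ++ x :: x :: H ≠ v :: G)
    (hx : ∀ Q y, P ++ x :: x :: H ≠ Q ++ [y, y]) :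
    TAN A 𝓕 (extend A 𝓕 h v) [] d U (P ++ x :: x :: H ++ F₂) := by
  have hc : ¬ (v :: (P ++ x :: x :: H)).IsChain (· ≠ ·) := not_chain_of_repeat (v :: P) x H
  have hH : H ≠ [] := by rintro rfl; exact hx P x rfl
  have hH' := List.length_pos_iff.mpr hH
  have hP : P.length + H.length + 1 = d := by simp at hF; omega
  rw [TAN_iff]
  refine Eq.trans (Finset.sum_eq_zero fun c _ => ?_) (Eq.symm ?_)
  · rcases term_zero (A := A) (h := h) (𝓕 := 𝓕) v c.blocks _ (blocks_ne_nil c) c.blocks_sum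
      (fun n hn => c.blocks_pos hn) U (P ++ x :: x :: H) F₂ (hF.trans c.blocks_sum.symm) hc
      (by omega) with h0 | ⟨G', -, h1⟩ | ⟨P', h0, -, h1, h2⟩
    · exact (congrArg _ h0).trans (smul_zero _)
    · exact absurd h1 (hv _)
    · obtain ⟨Q, y, rfl⟩ := List.eq_nil_or_concat P' |>.resolve_left h0
      exact absurd (h2.trans (by simp [endOf_concat])) (hx Q y)
  · let j₁ : Fin d := ⟨P.length, by omega⟩
    let j₂ : Fin d := ⟨P.length + 1, by omega⟩
    have hne : j₁ ≠ j₂ := by simp [j₁, j₂]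
    rw [Finset.sum_eq_add j₁ j₂ hne]
    · have e1 : (P ++ x :: x :: H ++ F₂).eraseIdx (([] : List ℕ).sum + j₁) =
          P ++ x :: H ++ F₂ := by
        rw [List.append_assoc, List.eraseIdx_append_of_length_le (by simp [j₁])]
        simp [j₁]
      have e2 : (P ++ x :: x :: H ++ F₂).eraseIdx (([] : List ℕ).sum + j₂) =
          P ++ x :: H ++ F₂ := by
        rw [List.append_assoc, List.eraseIdx_append_of_length_le (by simp [j₂])]
        simp [j₂]
      rw [e1, e2]
      have : Int.negOnePow ((j₂ : ℕ) : ℤ) = - Int.negOnePow ((j₁ : ℕ) : ℤ) := by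
        simp only [j₁, j₂]
        push_cast
        exact Int.negOnePow_succ _
      rw [this, Units.neg_smul, add_neg_cancel]
    · intro j _ hj
      rw [erase_zero v _ U (P ++ x :: x :: H) F₂ j hF j.isLt (by omega), smul_zero]
      have h1 : (j : ℕ) ≠ P.length := fun e => hj.1 (Fin.ext e)
      have h2 : (j : ℕ) ≠ P.length + 1 := fun e => hj.2 (Fin.ext e)
      have := not_chain_eraseIdx (v :: P) x H (j + 1) (by simpa using h1) (by simpa using h2)
      simpa using this
    · simp
    · simp

/-- The relations are inherited by the extension of a family to all necklace maps. -/
theorem tan_extend [𝓕.Additive] (e v : V)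
    (H : ∀ (U₁ : List ℕ) (d : ℕ) (U₂ : List ℕ) (F : List V), (∀ n ∈ U₁, 0 < n) →
      (∀ n ∈ U₂, 0 < n) → F.length = (U₁ ++ (d + 1) :: U₂).sum → (v :: F).IsChain (· < ·) →
      endOf v F = e → TAN A 𝓕 h U₁ d U₂ F)
    (U₁ : List ℕ) (d : ℕ) (U₂ : List ℕ) (F : List V) (hU₁ : ∀ n ∈ U₁, 0 < n)
    (hU₂ : ∀ n ∈ U₂, 0 < n) (hF : F.length = (U₁ ++ (d + 1) :: U₂).sum)
    (hc : (v :: F).IsChain (· ≤ ·)) (he : endOf v F = e) :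
    TAN A 𝓕 (extend A 𝓕 h v) U₁ d U₂ F := by
  induction U₁ generalizing 𝓕 v F with
  | nil =>
    obtain ⟨F₁, F₂, rfl, h1, h2⟩ := split_bead (n := d + 1) (U := U₂) hF
    by_cases hc' : (v :: F₁).IsChain (· ≠ ·)
    · have h3 : red v (F₁ ++ F₂) = F₁ ++ red (endOf v F₁) F₂ := by
        rw [red_append, red_eq_of_chain hc']
      have h4 := red_lt hc
      rw [h3] at h4
      refine tan_strict v d U₂ F₁ F₂ h1 (List.IsChain.left_of_append (l₂ := red (endOf v F₁) F₂)
        (by simpa using h4)) (H [] d _ _ (by simp) (nz_pos _) ?_ h4 ?_)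
      · simp [nz_sum, imSizes_sum _ _ _ h2, h1]
      · rw [← h3, endOf_red, he]
    · rcases Nat.eq_zero_or_pos d with rfl | hd
      · obtain ⟨w, rfl⟩ := List.length_eq_one_iff.mp h1
        rcases ne_chain_cases hc' with ⟨F', h3⟩ | ⟨P, x, H', h3⟩
        · rw [h3] at h1 ⊢
          obtain rfl : F' = [] := by simpa using h1
          exact tan_unit v U₂ F₂
        · have := congrArg List.length h3
          simp at this
          omega
      · by_cases hv : ∃ G, F₁ = v :: G
        · obtain ⟨G, rfl⟩ := hv
          exact tan_left v d hd U₂ G F₂ h1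
        · by_cases hx : ∃ P x, F₁ = P ++ [x, x]
          · obtain ⟨P, x, rfl⟩ := hx
            exact tan_right v d U₂ P F₂ x h1 (fun G hG => hv ⟨G, hG⟩)
          · rcases ne_chain_cases hc' with h3 | ⟨P, x, H', rfl⟩
            · exact absurd h3 hv
            · exact tan_middle v d U₂ P H' F₂ x h1 (fun G hG => hv ⟨G, hG⟩)
                (fun Q y hQ => hx ⟨Q, y, hQ⟩)
  | cons n U₁ ih =>
    obtain ⟨F₁, F₂, rfl, rfl, h2⟩ := split_bead (U := U₁ ++ (d + 1) :: U₂) hF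
    have hU : ∀ n ∈ U₁, 0 < n := fun n hn => hU₁ n (by simp [hn])
    have h0 : F₁ ≠ [] := List.ne_nil_of_length_pos (hU₁ F₁.length (by simp))
    have hc2 := chain_endOf hc
    rw [endOf_append] at he
    rw [← TAN_cons]
    rcases bead_cases (v := v) h0 with h1 | rfl | ⟨h1, h3⟩
    · have hlt : (v :: F₁).IsChain (· < ·) := by
        have := red_lt (List.IsChain.left_of_append (l₂ := F₂) (by simpa using hc) :
          (v :: F₁).IsChain (· ≤ ·))
        rwa [red_eq_of_chain h1] at this
      rw [TAN_congr (h' := extend A (tensorLeft (A.sus F₁.length) ⋙ 𝓕)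
        (fun U' G' => h (F₁.length :: U') (F₁ ++ G')) (endOf v F₁))
        (e₁ := fun c => extend_id h1 h0 _ _) (e₂ := fun j => extend_id h1 h0 _ _)]
      refine ih (𝓕 := tensorLeft (A.sus F₁.length) ⋙ 𝓕) _ ?_ F₂ hU h2 hc2 he
      intro U₁' d' U₂' G hU₁' hU₂' hG hGc hGe
      rw [TAN_cons]
      refine H _ d' U₂' _ ?_ hU₂' ?_ (chain_append_of hlt hGc) ?_
      · intro n hn
        rcases List.mem_cons.mp hn with rfl | hn
        · exact List.length_pos_iff.mpr h0
        · exact hU₁' n hn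
      · simp [hG]
      · rw [endOf_append, hGe]
    · refine (TAN_congr (𝓕 := tensorLeft (A.sus 1) ⋙ 𝓕)
        (h := fun U' G' => extend A 𝓕 h v (1 :: U') (v :: G'))
        (h' := fun U' G' => extend A 𝓕 h v U' G' ≫ (unitNat A 𝓕).app _) U₁ d U₂ F₂
        (fun c => extend_unit v _ _) (fun j => extend_unit v _ _)).mpr ?_
      exact TAN_nat (unitNat A 𝓕) (ih v H F₂ hU h2 hc2 he)
    · rw [TAN_congr (h' := fun U' _ => 0)
        (e₁ := fun c => extend_zero h1 h3 _ _) (e₂ := fun j => extend_zero h1 h3 _ _)]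
      exact TAN_zero _ _ _ _

end base

end Templicial

namespace Templicial

namespace Quiv

variable {K : Type u} [Field K] {O : Type u}

section pi

variable {ι : Type} (Q : ι → Quiv K O)

/-- The product of a family of quivers. -/
def pi : Quiv K O where
  obj a b := (i : ι) → Q i a b

/-- The projections of a product. -/
def proj (i : ι) : pi Q ⟶ Q i := ⟨fun _ _ => LinearMap.proj i⟩

variable {Q} {Z : Quiv K O}

/-- The map into a product given by its components. -/
def piLift (f : ∀ i, Z ⟶ Q i) : Z ⟶ pi Q := ⟨fun a b => LinearMap.pi fun i => (f i).app a b⟩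

theorem piLift_proj (f : ∀ i, Z ⟶ Q i) (i : ι) : piLift f ≫ proj Q i = f i := rfl

theorem pi_hom_ext {f g : Z ⟶ pi Q} (h : ∀ i, f ≫ proj Q i = g ≫ proj Q i) : f = g := by
  ext a b x
  funext i
  exact congrArg (fun t : Z ⟶ Q i => t.app a b x) (h i)

variable [DecidableEq ι]

variable (Q) in
/-- The inclusions into a product. -/
def inj (i : ι) : Q i ⟶ pi Q :=
  piLift fun j => if h : i = j then eqToHom (congrArg Q h) else 0

theorem inj_proj_self (i : ι) : inj Q i ≫ proj Q i = 𝟙 _ := by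
  rw [inj, piLift_proj, dif_pos rfl, eqToHom_refl]

theorem inj_proj_ne {i j : ι} (h : i ≠ j) : inj Q i ≫ proj Q j = 0 := by
  rw [inj, piLift_proj, dif_neg h]

theorem sum_proj_inj [Fintype ι] : ∑ i, proj Q i ≫ inj Q i = 𝟙 (pi Q) := by
  apply pi_hom_ext
  intro j
  rw [Preadditive.sum_comp, Finset.sum_eq_single j]
  · rw [Category.assoc, inj_proj_self, Category.comp_id, Category.id_comp]
  · intro i _ h
    rw [Category.assoc, inj_proj_ne h, Limits.comp_zero]
  · simp

end pi

section ker

variable {R W : Quiv K O} (Φ : R ⟶ W)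

/-- The kernel of a quiver morphism. -/
def ker : Quiv K O where
  obj a b := LinearMap.ker (Φ.app a b)

/-- The inclusion of the kernel. -/
def kerι : ker Φ ⟶ R := ⟨fun a b => (LinearMap.ker (Φ.app a b)).subtype⟩

theorem kerι_comp : kerι Φ ≫ Φ = 0 := by
  ext a b x
  exact LinearMap.mem_ker.mp x.2

variable {Φ} {Z : Quiv K O}

/-- The universal property of the kernel. -/
def kerLift (f : Z ⟶ R) (hf : f ≫ Φ = 0) : Z ⟶ ker Φ :=
  ⟨fun a b => (f.app a b).codRestrict _ fun x =>
    LinearMap.mem_ker.mpr (congrArg (fun t : Z ⟶ W => t.app a b x) hf)⟩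

theorem kerLift_ι (f : Z ⟶ R) (hf : f ≫ Φ = 0) : kerLift f hf ≫ kerι Φ = f := rfl

theorem ker_hom_ext {f g : Z ⟶ ker Φ} (h : f ≫ kerι Φ = g ≫ kerι Φ) : f = g := by
  ext a b x
  exact Subtype.ext (congrArg (fun t : Z ⟶ R => t.app a b x) h)

theorem linear_inverse {E F : Type u} [AddCommGroup E] [Module K E] [AddCommGroup F] [Module K F]
    (φ : E →ₗ[K] F) : ∃ s : F →ₗ[K] E, ∀ x, φ (s (φ x)) = φ x := by
  obtain ⟨p, hp⟩ := (LinearMap.range φ).subtype.exists_leftInverse_of_injective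
    (Submodule.ker_subtype _)
  obtain ⟨t, ht⟩ := φ.rangeRestrict.exists_rightInverse_of_surjective φ.range_rangeRestrict
  refine ⟨t.comp p, fun x => ?_⟩
  have h1 : p (φ x) = φ.rangeRestrict x := LinearMap.congr_fun hp (φ.rangeRestrict x)
  have h2 := congrArg Subtype.val (LinearMap.congr_fun ht (φ.rangeRestrict x))
  rw [LinearMap.comp_apply, h1]
  exact h2

/-- The kernel is a retract. -/
theorem ker_retract (Φ : R ⟶ W) : ∃ (r : R ⟶ ker Φ) (s : W ⟶ R),
    kerι Φ ≫ r = 𝟙 _ ∧ r ≫ kerι Φ = 𝟙 _ - Φ ≫ s := by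
  choose s hs using fun a b => linear_inverse (Φ.app a b)
  let s' : W ⟶ R := ⟨s⟩
  have h : (𝟙 R - Φ ≫ s') ≫ Φ = 0 := by
    rw [Preadditive.sub_comp, sub_eq_zero, Category.id_comp]
    ext a b x
    exact (hs a b x).symm
  refine ⟨kerLift (𝟙 _ - Φ ≫ s') h, s', ?_, kerLift_ι _ _⟩
  apply ker_hom_ext
  rw [Category.assoc, kerLift_ι, Preadditive.comp_sub, ← Category.assoc, kerι_comp,
    Limits.zero_comp, sub_zero, Category.comp_id, Category.id_comp]

end ker

section tensor

theorem sub_whiskerRight_aux {X Y : Quiv K O} (f g : X ⟶ Y) (Z : Quiv K O) :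
    (f - g) ▷ Z = f ▷ Z - g ▷ Z := by
  exact (tensorRight Z).map_sub

theorem whiskerLeft_sub_aux {X Y : Quiv K O} (f g : X ⟶ Y) (Z : Quiv K O) :
    Z ◁ (f - g) = Z ◁ f - Z ◁ g := by
  exact (tensorLeft Z).map_sub

variable {ι κ ι' κ' : Type} [Fintype ι] [Fintype κ] [Fintype ι'] [Fintype κ']
  {Q : ι → Quiv K O} {W : ι' → Quiv K O} (Φ : pi Q ⟶ pi W)
  {Q' : κ → Quiv K O} {W' : κ' → Quiv K O} (Φ' : pi Q' ⟶ pi W') {Z : Quiv K O}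

theorem pi_tensor_ext {Y : Quiv K O} {f g : Z ⟶ pi Q ⊗ Y}
    (h : ∀ i, f ≫ proj Q i ▷ Y = g ≫ proj Q i ▷ Y) : f = g := by
  classical
  have e : ∀ f : Z ⟶ pi Q ⊗ Y, f = ∑ i, (f ≫ proj Q i ▷ Y) ≫ inj Q i ▷ Y := fun f => by
    conv_lhs => rw [← Category.comp_id f, ← id_whiskerRight, ← sum_proj_inj]
    rw [sum_whiskerRight, Preadditive.comp_sum]
    simp
  rw [e f, e g]
  simp only [h]

theorem tensor_pi_ext {Y : Quiv K O} {f g : Z ⟶ Y ⊗ pi Q}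
    (h : ∀ i, f ≫ Y ◁ proj Q i = g ≫ Y ◁ proj Q i) : f = g := by
  classical
  have e : ∀ f : Z ⟶ Y ⊗ pi Q, f = ∑ i, (f ≫ Y ◁ proj Q i) ≫ Y ◁ inj Q i := fun f => by
    conv_lhs => rw [← Category.comp_id f, ← whiskerLeft_id, ← sum_proj_inj]
    rw [whiskerLeft_sum, Preadditive.comp_sum]
    simp
  rw [e f, e g]
  simp only [h]

theorem ker_tensor_ext {Y : Quiv K O} {f g : Z ⟶ ker Φ ⊗ Y}
    (h : ∀ i, f ≫ (kerι Φ ≫ proj Q i) ▷ Y = g ≫ (kerι Φ ≫ proj Q i) ▷ Y) : f = g := by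
  obtain ⟨r, s, h1, -⟩ := ker_retract Φ
  have e : f ≫ kerι Φ ▷ Y = g ≫ kerι Φ ▷ Y := pi_tensor_ext fun i => by simpa using h i
  have e' := congrArg (· ≫ r ▷ Y) e
  simpa only [Category.assoc, ← comp_whiskerRight, h1, id_whiskerRight, Category.comp_id] using e'

theorem tensor_ker_ext {Y : Quiv K O} {f g : Z ⟶ Y ⊗ ker Φ}
    (h : ∀ i, f ≫ Y ◁ (kerι Φ ≫ proj Q i) = g ≫ Y ◁ (kerι Φ ≫ proj Q i)) : f = g := by
  obtain ⟨r, s, h1, -⟩ := ker_retract Φ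
  have e : f ≫ Y ◁ kerι Φ = g ≫ Y ◁ kerι Φ := tensor_pi_ext fun i => by simpa using h i
  have e' := congrArg (· ≫ Y ◁ r) e
  simpa only [Category.assoc, ← whiskerLeft_comp, h1, whiskerLeft_id, Category.comp_id] using e'

theorem ker_tensor_ker_ext {f g : Z ⟶ ker Φ ⊗ ker Φ'}
    (h : ∀ i j, f ≫ ((kerι Φ ≫ proj Q i) ⊗ₘ (kerι Φ' ≫ proj Q' j)) =
      g ≫ ((kerι Φ ≫ proj Q i) ⊗ₘ (kerι Φ' ≫ proj Q' j))) : f = g := by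
  refine ker_tensor_ext Φ fun i => tensor_ker_ext Φ' fun j => ?_
  rw [Category.assoc, Category.assoc, ← MonoidalCategory.tensorHom_def]
  exact h i j

/-- A map into the tensor product of two kernels in finite products is given by components which
satisfy the equations of both kernels. -/
theorem existsUnique_tensor_lift (P : ∀ i j, Z ⟶ Q i ⊗ Q' j)
    (H₁ : ∀ j k (M : Z ⟶ pi Q ⊗ Q' j), (∀ i, M ≫ proj Q i ▷ Q' j = P i j) →
      M ≫ (Φ ≫ proj W k) ▷ Q' j = 0)
    (H₂ : ∀ i k (M : Z ⟶ Q i ⊗ pi Q'), (∀ j, M ≫ Q i ◁ proj Q' j = P i j) →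
      M ≫ Q i ◁ (Φ' ≫ proj W' k) = 0) :
    ∃! μ : Z ⟶ ker Φ ⊗ ker Φ',
      ∀ i j, μ ≫ ((kerι Φ ≫ proj Q i) ⊗ₘ (kerι Φ' ≫ proj Q' j)) = P i j := by
  classical
  obtain ⟨r, s, h1, h2⟩ := ker_retract Φ
  obtain ⟨r', s', h1', h2'⟩ := ker_retract Φ'
  let M : Z ⟶ pi Q ⊗ pi Q' := ∑ i, ∑ j, P i j ≫ (inj Q i ⊗ₘ inj Q' j)
  have hM : ∀ i j, M ≫ (proj Q i ⊗ₘ proj Q' j) = P i j := by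
    intro i j
    simp only [M, Preadditive.sum_comp, Category.assoc, tensorHom_comp_tensorHom]
    rw [Finset.sum_eq_single i, Finset.sum_eq_single j]
    · rw [inj_proj_self, inj_proj_self, id_tensorHom_id, Category.comp_id]
    · intro j' _ hj
      rw [inj_proj_ne hj, MonoidalPreadditive.tensor_zero, Limits.comp_zero]
    · simp
    · intro i' _ hi
      refine Finset.sum_eq_zero fun j' _ => ?_
      rw [inj_proj_ne hi, MonoidalPreadditive.zero_tensor, Limits.comp_zero]
    · simp
  have hM₁ : M ≫ Φ ▷ _ = 0 := by
    refine tensor_pi_ext fun j => pi_tensor_ext fun k => ?_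
    have := H₁ j k (M ≫ _ ◁ proj Q' j) fun i => by
      rw [Category.assoc, ← MonoidalCategory.tensorHom_def', hM]
    rw [Limits.zero_comp, Limits.zero_comp, ← this, Category.assoc, Category.assoc, Category.assoc,
      comp_whiskerRight, ← whisker_exchange_assoc]
  have hM₂ : M ≫ _ ◁ Φ' = 0 := by
    refine pi_tensor_ext fun i => tensor_pi_ext fun k => ?_
    have := H₂ i k (M ≫ proj Q i ▷ _) fun j => by
      rw [Category.assoc, ← MonoidalCategory.tensorHom_def, hM]
    rw [Limits.zero_comp, Limits.zero_comp, ← this, Category.assoc, Category.assoc, Category.assoc,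
      MonoidalCategory.whiskerLeft_comp, whisker_exchange_assoc]
  refine ⟨M ≫ (r ⊗ₘ r'), fun i j => ?_, fun μ hμ => ?_⟩
  · rw [Category.assoc, tensorHom_comp_tensorHom, ← Category.assoc r, ← Category.assoc r', h2, h2']
    rw [← tensorHom_comp_tensorHom, ← Category.assoc]
    have : M ≫ ((𝟙 _ - Φ ≫ s) ⊗ₘ (𝟙 _ - Φ' ≫ s')) = M := by
      have e1 : M ≫ (𝟙 _ - Φ ≫ s) ▷ _ = M := by
        rw [sub_whiskerRight_aux, Preadditive.comp_sub, comp_whiskerRight, ← Category.assoc, hM₁,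
          Limits.zero_comp, sub_zero, id_whiskerRight, Category.comp_id]
      have e2 : M ≫ _ ◁ (𝟙 _ - Φ' ≫ s') = M := by
        rw [whiskerLeft_sub_aux, Preadditive.comp_sub, MonoidalCategory.whiskerLeft_comp,
          ← Category.assoc, hM₂,
          Limits.zero_comp, sub_zero, MonoidalCategory.whiskerLeft_id, Category.comp_id]
      rw [MonoidalCategory.tensorHom_def, ← Category.assoc, e1, e2]
    rw [this, hM]
  · have e : μ ≫ (kerι Φ ⊗ₘ kerι Φ') = M := by
      refine pi_tensor_ext fun i => tensor_pi_ext fun j => ?_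
      rw [Category.assoc, Category.assoc, Category.assoc, ← MonoidalCategory.tensorHom_def, hM,
        tensorHom_comp_tensorHom, hμ]
    rw [← e, Category.assoc, tensorHom_comp_tensorHom, h1, h1', id_tensorHom_id, Category.comp_id]

end tensor

end Quiv

end Templicial

namespace Templicial

theorem le_endOf {v : ℕ} {F : List ℕ} (h : (v :: F).IsChain (· ≤ ·)) : v ≤ endOf v F := by
  induction F generalizing v with
  | nil => exact le_rfl
  | cons w F ih =>
    rw [List.isChain_cons_cons] at h
    exact h.1.trans (ih h.2)

theorem mem_le_endOf {v : ℕ} {F : List ℕ} (h : (v :: F).IsChain (· ≤ ·)) :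
    ∀ x ∈ F, x ≤ endOf v F := by
  induction F generalizing v with
  | nil => simp
  | cons w F ih =>
    rw [List.isChain_cons_cons] at h
    intro x hx
    rcases List.mem_cons.mp hx with rfl | hx
    · exact le_endOf h.2
    · exact ih h.2 x hx

theorem length_le_endOf {v : ℕ} {F : List ℕ} (h : (v :: F).IsChain (· < ·)) :
    v + F.length ≤ endOf v F := by
  induction F generalizing v with
  | nil => exact le_rfl
  | cons w F ih =>
    rw [List.isChain_cons_cons] at h
    have := ih h.2
    have h1 := h.1
    simp only [List.length_cons, endOf]
    omega

theorem mem_le_sum {U : List ℕ} : ∀ x ∈ U, x ≤ U.sum := by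
  induction U with
  | nil => simp
  | cons n U ih =>
    intro x hx
    rcases List.mem_cons.mp hx with rfl | hx
    · simp
    · have := ih x hx; simp; omega

theorem length_le_sum {U : List ℕ} (h : ∀ x ∈ U, 0 < x) : U.length ≤ U.sum := by
  induction U with
  | nil => simp
  | cons n U ih =>
    have h1 := h n (by simp)
    have := ih fun x hx => h x (by simp [hx])
    simp; omega

/-- `(U, F)` encodes an injective necklace map `Δ^{n₁} ∨ ... ∨ Δ^{n_k} → Δⁿ`: the list `U` consists
of the dimensions `n₁, ..., n_k` of the beads, and the vertices of the necklace are sent to the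
increasing sequence `0, F₁, F₂, ..., n`. -/
structure Valid (n : ℕ) (U F : List ℕ) : Prop where
  pos : ∀ m ∈ U, 0 < m
  len : F.length = U.sum
  chain : (0 :: F).IsChain (· < ·)
  last : endOf 0 F = n

/-- The injective necklace maps to `Δⁿ`. -/
structure Idx (n : ℕ) where
  U : List ℕ
  F : List ℕ
  valid : Valid n U F

/-- The injective necklace maps to `Δⁿ` with a chosen bead, of dimension `d + 1`. -/
structure BeadIdx (n : ℕ) where
  U₁ : List ℕ
  d : ℕ
  U₂ : List ℕ
  F : List ℕ
  valid : Valid n (U₁ ++ (d + 1) :: U₂) F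

theorem Valid.mem_le {n : ℕ} {U F : List ℕ} (h : Valid n U F) : ∀ x ∈ F, x ≤ n := by
  have := mem_le_endOf (h.chain.imp fun _ _ => le_of_lt)
  rwa [h.last] at this

theorem Valid.length_le {n : ℕ} {U F : List ℕ} (h : Valid n U F) : F.length ≤ n := by
  have := length_le_endOf h.chain
  rw [h.last] at this
  omega

/-- A list of numbers at most `n`. -/
def clamp (n : ℕ) (L : List ℕ) : List (Fin (n + 1)) := L.map fun x => ⟨min x n, by omega⟩

theorem clamp_inj {n : ℕ} {L L' : List ℕ} (h : ∀ x ∈ L, x ≤ n) (h' : ∀ x ∈ L', x ≤ n)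
    (e : clamp n L = clamp n L') : L = L' := by
  have key : ∀ L : List ℕ, (∀ x ∈ L, x ≤ n) → (clamp n L).map Fin.val = L := by
    intro L hL
    rw [clamp, List.map_map]
    conv_rhs => rw [← List.map_id L]
    exact List.map_congr_left fun x hx => min_eq_left (hL x hx)
  rw [← key L h, ← key L' h', e]

instance (n : ℕ) : Finite (Idx n) := by
  have hf := List.finite_length_le (Fin (n + 1)) n
  have : Finite {l : List (Fin (n + 1)) | l.length ≤ n} := hf
  have hU : ∀ g : Idx n, g.U.sum ≤ n := fun g => g.valid.len ▸ g.valid.length_le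
  let f : Idx n → {l : List (Fin (n + 1)) | l.length ≤ n} × {l : List (Fin (n + 1)) | l.length ≤ n} :=
    fun g => (⟨clamp n g.U, by
      have := length_le_sum g.valid.pos
      have := hU g
      simp [clamp]; omega⟩, ⟨clamp n g.F, by
      have := g.valid.length_le
      simpa [clamp] using this⟩)
  refine Finite.of_injective f fun g g' h => ?_
  have h1 := congrArg (fun t => t.1.1) h
  have h2 := congrArg (fun t => t.2.1) h
  have e1 := clamp_inj (fun x hx => (mem_le_sum x hx).trans (hU g))
    (fun x hx => (mem_le_sum x hx).trans (hU g')) h1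
  have e2 := clamp_inj g.valid.mem_le g'.valid.mem_le h2
  cases g
  cases g'
  simp only at e1 e2
  subst e1 e2
  rfl

instance (n : ℕ) : Finite (BeadIdx n) := by
  let f : BeadIdx n → Σ g : Idx n, Fin g.U.length :=
    fun b => ⟨⟨_, _, b.valid⟩, ⟨b.U₁.length, by simp⟩⟩
  refine Finite.of_injective f fun b b' h => ?_
  have h1 := congrArg (fun t => t.1.U) h
  have h2 := congrArg (fun t => t.1.F) h
  have h3 := congrArg (fun t : Σ g : Idx n, Fin g.U.length => (t.2 : ℕ)) h
  have h4 := List.append_inj h1 h3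
  have h5 := List.cons_eq_cons.mp h4.2
  cases b
  cases b'
  obtain ⟨h6, h7, h8⟩ := And.intro h4.1 h5
  simp only [Nat.add_right_cancel_iff] at h6 h7 h8 h2
  subst h6 h7 h8
  obtain rfl : _ = _ := h2
  rfl

noncomputable instance (n : ℕ) : Fintype (Idx n) := Fintype.ofFinite _
noncomputable instance (n : ℕ) : Fintype (BeadIdx n) := Fintype.ofFinite _

namespace Nerve

variable {K : Type u} [Field K] {O : Type u} (A : AInf (Quiv K O))

/-- `∏_g (s𝒜)_U`, over the injective necklace maps `g : U → Δⁿ`. -/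
abbrev raw (n : ℕ) : Quiv K O := Quiv.pi fun g : Idx n => tens A.sus g.U

open Classical in
/-- The component `y ↦ y_g` for `g = (U, F)`, with value `0` if `(U, F)` does not encode an
injective necklace map. -/
def rawProj (n : ℕ) (U F : List ℕ) : raw A n ⟶ tens A.sus U :=
  if hv : Valid n U F then Quiv.proj (fun g : Idx n => tens A.sus g.U) ⟨U, F, hv⟩ else 0

theorem rawProj_idx {n : ℕ} (g : Idx n) :
    rawProj A n g.U g.F = Quiv.proj (fun g : Idx n => tens A.sus g.U) g := dif_pos g.valid

/-- The difference of the two sides of the nerve relation at every bead. -/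
def tanMap (n : ℕ) :
    raw A n ⟶ Quiv.pi fun b : BeadIdx n => tens A.sus (b.U₁ ++ b.d :: b.U₂) :=
  Quiv.piLift fun b => tanL A (𝟭 _) (rawProj A n) b.U₁ b.d b.U₂ b.F -
    tanR A (𝟭 _) (rawProj A n) b.U₁ b.d b.U₂ b.F

/-- The quiver of `n`-simplices of the nerve, which consists of the collections `(y_g)_g` that
satisfy the nerve relation at every bead of every injective necklace map `g : U → Δⁿ`. -/
def obj (n : ℕ) : Quiv K O := Quiv.ker (tanMap A n)

/-- The component `y ↦ y_g`. -/
def π (n : ℕ) (U F : List ℕ) : obj A n ⟶ tens A.sus U := Quiv.kerι (tanMap A n) ≫ rawProj A n U F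

variable {A} {n : ℕ} {Z : Quiv K O}

theorem valid_cut {U₁ U₂ F : List ℕ} {d : ℕ} (h : Valid n (U₁ ++ (d + 1) :: U₂) F)
    (c : Composition (d + 1)) : Valid n (U₁ ++ (c.blocks ++ U₂)) F where
  pos m hm := by
    simp only [List.mem_append] at hm
    rcases hm with hm | hm | hm
    · exact h.pos m (by simp [hm])
    · exact c.blocks_pos hm
    · exact h.pos m (by simp [hm])
  len := by
    rw [h.len]
    simp [c.blocks_sum]
  chain := h.chain
  last := h.last

theorem valid_face {U₁ U₂ F : List ℕ} {d : ℕ} (h : Valid n (U₁ ++ (d + 1) :: U₂) F) (j : Fin d) :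
    Valid n (U₁ ++ d :: U₂) (F.eraseIdx (U₁.sum + j)) where
  pos m hm := by
    have := j.isLt
    simp only [List.mem_append, List.mem_cons] at hm
    rcases hm with hm | rfl | hm
    · exact h.pos m (by simp [hm])
    · omega
    · exact h.pos m (by simp [hm])
  len := by
    have := h.len
    have := j.isLt
    simp only [List.sum_append, List.sum_cons] at *
    rw [List.length_eraseIdx_of_lt (by omega)]
    omega
  chain := eraseIdx_lt h.chain _
  last := by
    have := h.len
    have := j.isLt
    simp only [List.sum_append, List.sum_cons] at *
    rw [endOf_eraseIdx _ _ _ (by omega), h.last]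

theorem tan_congr' {𝓕 : Quiv K O ⥤ Quiv K O}
    {h h' : ∀ (U : List ℕ) (_ : List ℕ), Z ⟶ 𝓕.obj (tens A.sus U)}
    (e : ∀ U F, Valid n U F → h U F = h' U F) (b : BeadIdx n) :
    TAN A 𝓕 h b.U₁ b.d b.U₂ b.F ↔ TAN A 𝓕 h' b.U₁ b.d b.U₂ b.F :=
  TAN_congr _ _ _ _ (fun c => e _ _ (valid_cut b.valid c)) (fun j => e _ _ (valid_face b.valid j))

/-- A map `Z → ∏_g (s𝒜)_U` is killed by the nerve relation at a bead if and only if its components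
satisfy this relation. -/
theorem comp_tanMap {𝓖 : Quiv K O ⥤ Quiv K O} [𝓖.Additive] (M : Z ⟶ 𝓖.obj (raw A n))
    (b : BeadIdx n) :
    M ≫ 𝓖.map (tanMap A n ≫ Quiv.proj _ b) = 0 ↔
      TAN A 𝓖 (fun U F => M ≫ 𝓖.map (rawProj A n U F)) b.U₁ b.d b.U₂ b.F := by
  rw [tanMap, Quiv.piLift_proj, 𝓖.map_sub, Preadditive.comp_sub, sub_eq_zero, tanL_map, tanR_map]
  rfl

theorem π_tan (b : BeadIdx n) : TAN A (𝟭 _) (π A n) b.U₁ b.d b.U₂ b.F := by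
  refine (comp_tanMap (𝓖 := 𝟭 _) (Quiv.kerι (tanMap A n)) b).mp ?_
  change Quiv.kerι (tanMap A n) ≫ tanMap A n ≫ Quiv.proj _ b = 0
  rw [← Category.assoc, Quiv.kerι_comp, Limits.zero_comp]

theorem hom_ext {f g : Z ⟶ obj A n} (h : ∀ U F, Valid n U F → f ≫ π A n U F = g ≫ π A n U F) :
    f = g := by
  refine Quiv.ker_hom_ext (Quiv.pi_hom_ext fun i => ?_)
  have := h i.U i.F i.valid
  rwa [π, rawProj_idx] at this

theorem lift_aux (h : ∀ (U _ : List ℕ), Z ⟶ tens A.sus U)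
    (H : ∀ b : BeadIdx n, TAN A (𝟭 _) h b.U₁ b.d b.U₂ b.F) :
    (Quiv.piLift fun g : Idx n => h g.U g.F) ≫ tanMap A n = 0 := by
  refine Quiv.pi_hom_ext fun b => ?_
  rw [Limits.zero_comp, Category.assoc]
  refine (comp_tanMap (𝓖 := 𝟭 _) (Quiv.piLift fun g : Idx n => h g.U g.F) b).mpr ?_
  refine (tan_congr' (fun U F hv => ?_) b).mp (H b)
  change _ = Quiv.piLift _ ≫ rawProj A n U F
  exact (congrArg (Quiv.piLift (fun g : Idx n => h g.U g.F) ≫ ·)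
    (rawProj_idx A ⟨U, F, hv⟩)).symm

/-- The map to the nerve with given components. -/
def lift (h : ∀ (U _ : List ℕ), Z ⟶ tens A.sus U)
    (H : ∀ b : BeadIdx n, TAN A (𝟭 _) h b.U₁ b.d b.U₂ b.F) : Z ⟶ obj A n :=
  Quiv.kerLift (Quiv.piLift fun g : Idx n => h g.U g.F) (lift_aux h H)

theorem lift_π (h : ∀ (U _ : List ℕ), Z ⟶ tens A.sus U)
    (H : ∀ b : BeadIdx n, TAN A (𝟭 _) h b.U₁ b.d b.U₂ b.F) (U F : List ℕ) (hv : Valid n U F) :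
    lift h H ≫ π A n U F = h U F :=
  congrArg (Quiv.piLift (fun g : Idx n => h g.U g.F) ≫ ·) (rawProj_idx A ⟨U, F, hv⟩)

end Nerve

end Templicial

namespace Templicial

namespace Nerve

variable {K : Type u} [Field K] {O : Type u} {A : AInf (Quiv K O)} {n : ℕ} {Z : Quiv K O}

/-- `(U, F)` encodes a necklace map `Δ^{n₁} ∨ ... ∨ Δ^{n_k} → Δⁿ` which preserves endpoints but need
not be injective. -/
structure WValid (n : ℕ) (U F : List ℕ) : Prop where
  pos : ∀ m ∈ U, 0 < m
  len : F.length = U.sum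
  chain : (0 :: F).IsChain (· ≤ ·)
  last : endOf 0 F = n

theorem _root_.Templicial.Valid.weak {U F : List ℕ} (h : Valid n U F) : WValid n U F :=
  ⟨h.pos, h.len, h.chain.imp fun _ _ => le_of_lt, h.last⟩

theorem WValid.red {U F : List ℕ} (h : WValid n U F) :
    Valid n (nz (imSizes 0 U F)) (red 0 F) where
  pos := nz_pos _
  len := by rw [nz_sum, imSizes_sum _ _ _ h.len]
  chain := red_lt h.chain
  last := by rw [endOf_red, h.last]

theorem chain_map {v : ℕ} {F : List ℕ} {f : ℕ → ℕ} (hf : ∀ i j, i ≤ j → f i ≤ f j)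
    (h : (v :: F).IsChain (· ≤ ·)) : (f v :: F.map f).IsChain (· ≤ ·) := by
  rw [← List.map_cons, List.isChain_map]
  exact h.imp fun a b hab => hf a b hab

theorem WValid.map {m n : Fint} {U F : List ℕ} (h : WValid m.len U F) (f : m ⟶ n) :
    WValid n.len U (F.map (Fint.Hom.nat f)) where
  pos := h.pos
  len := by rw [List.length_map, h.len]
  chain := by
    have := chain_map (f := Fint.Hom.nat f) (fun _ _ => Fint.Hom.nat_mono f) h.chain
    rwa [Fint.Hom.nat_zero] at this
  last := by
    have := endOf_map (Fint.Hom.nat f) 0 F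
    rw [Fint.Hom.nat_zero, h.last, Fint.Hom.nat_of_le f le_rfl] at this
    exact this

theorem extend_congr {h h' : ∀ (U _ : List ℕ), Z ⟶ tens A.sus U}
    (e : ∀ U F, Valid n U F → h U F = h' U F) {U F : List ℕ} (hv : WValid n U F) :
    extend A (𝟭 _) h 0 U F = extend A (𝟭 _) h' 0 U F := by
  simp only [extend, extendAux]
  rw [e _ _ hv.red]

theorem extend_comp {Y : Quiv K O} (M : Y ⟶ Z) (h : ∀ (U _ : List ℕ), Z ⟶ tens A.sus U)
    (U F : List ℕ) :
    M ≫ extend A (𝟭 _) h 0 U F = extend A (𝟭 _) (fun U F => M ≫ h U F) 0 U F := by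
  simp only [extend, extendAux]
  exact (Category.assoc _ _ _).symm

theorem extend_valid (h : ∀ (U _ : List ℕ), Z ⟶ tens A.sus U) {U F : List ℕ}
    (hv : Valid n U F) : extend A (𝟭 _) h 0 U F = h U F := by
  have hc := ne_of_lt_chain hv.chain
  have e1 := imSizes_of_chain hv.len hc
  have e2 : extend A (𝟭 _) h 0 U F = extendAux A (𝟭 _) h U U F := by
    rw [extend, e1, red_eq_of_chain hc]
  rw [e2, extendAux, ebar_self A hv.pos]
  exact apply_eqToHom (𝓕 := 𝟭 _) h (nz_of_pos hv.pos) rfl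

theorem extend_tan {h : ∀ (U _ : List ℕ), Z ⟶ tens A.sus U}
    (H : ∀ b : BeadIdx n, TAN A (𝟭 _) h b.U₁ b.d b.U₂ b.F) {U₁ U₂ F : List ℕ} {d : ℕ}
    (hv : WValid n (U₁ ++ (d + 1) :: U₂) F) :
    TAN A (𝟭 _) (extend A (𝟭 _) h 0) U₁ d U₂ F := by
  refine tan_extend n 0 ?_ U₁ d U₂ F (fun m hm => hv.pos m (by simp [hm]))
    (fun m hm => hv.pos m (by simp [hm])) hv.len hv.chain hv.last
  intro U₁' d' U₂' F' h1 h2 h3 h4 h5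
  refine H ⟨U₁', d', U₂', F', ⟨?_, h3, h4, h5⟩⟩
  intro m hm
  simp only [List.mem_append, List.mem_cons] at hm
  rcases hm with hm | rfl | hm
  · exact h1 m hm
  · omega
  · exact h2 m hm

theorem map_tan {m n : Fint} (f : m ⟶ n) (b : BeadIdx m.len) :
    TAN A (𝟭 _) (fun U F => extend A (𝟭 _) (π A n.len) 0 U (F.map (Fint.Hom.nat f)))
      b.U₁ b.d b.U₂ b.F := by
  have := extend_tan (A := A) π_tan (WValid.map b.valid.weak f)
  rw [TAN_iff] at this ⊢
  simp only [List.eraseIdx_map] at this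
  exact this

/-- The map `f^*` of simplices of the nerve: `f^*(y)_g = ē(y_{g'})` where `f ∘ g = g' ∘ e` with `e`
active surjective and `g'` injective. -/
def map {m n : Fint} (f : m ⟶ n) : obj A n.len ⟶ obj A m.len :=
  lift (fun U F => extend A (𝟭 _) (π A n.len) 0 U (F.map (Fint.Hom.nat f))) (map_tan f)

theorem map_π {m n : Fint} (f : m ⟶ n) {U F : List ℕ} (hv : Valid m.len U F) :
    map f ≫ π A m.len U F = extend A (𝟭 _) (π A n.len) 0 U (F.map (Fint.Hom.nat f)) :=
  lift_π _ (map_tan f) U F hv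

theorem map_id (n : Fint) : map (𝟙 n) = 𝟙 (obj A n.len) := by
  refine hom_ext fun U F hv => ?_
  rw [map_π _ hv, Category.id_comp]
  have : F.map (Fint.Hom.nat (𝟙 n)) = F := by
    conv_rhs => rw [← List.map_id F]
    refine List.map_congr_left fun x hx => ?_
    rw [Fint.Hom.nat_id]
    exact min_eq_left (hv.mem_le x hx)
  rw [this, extend_valid _ hv]

theorem map_comp {l m n : Fint} (f : l ⟶ m) (g : m ⟶ n) :
    map (A := A) (f ≫ g) = map g ≫ map f := by
  refine hom_ext fun U F hv => ?_
  rw [map_π _ hv, Category.assoc, map_π _ hv, extend_comp,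
    extend_congr (fun U F hv => map_π g hv) (WValid.map hv.weak f)]
  have := extend_map (𝓕 := 𝟭 _) (h := π A n.len) (Fint.Hom.nat g) 0 U (F.map (Fint.Hom.nat f)) hv.pos
    (by rw [List.length_map, hv.len])
  rw [Fint.Hom.nat_zero] at this
  refine Eq.trans ?_ this.symm
  rw [List.map_map]
  have e : F.map (Fint.Hom.nat (f ≫ g)) = F.map (Fint.Hom.nat g ∘ Fint.Hom.nat f) :=
    List.map_congr_left fun x _ => Fint.Hom.nat_comp f g x
  rw [e]

variable (A) in
/-- The presheaf on finite intervals underlying the nerve. -/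
def functor : Fintᵒᵖ ⥤ Quiv K O where
  obj m := obj A m.unop.len
  map f := map f.unop
  map_id m := map_id m.unop
  map_comp f g := map_comp g.unop f.unop

end Nerve

end Templicial

namespace Templicial

section split

variable {C : Type*} [Category C] [MonoidalCategory C] {ι : Type*} (Q : ι → C)

theorem split_assoc_aux {B X Y X' D P R W : C} (s₁ : X ⟶ Y ⊗ W) (s₂ : Y ⟶ P ⊗ R) (e : X ⟶ X')
    (s₃ : X' ⟶ P ⊗ D) (s₄ : D ⟶ R ⊗ W)
    (h : s₁ ≫ s₂ ▷ W ≫ (α_ P R W).hom = e ≫ s₃ ≫ P ◁ s₄) :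
    (B ◁ s₁ ≫ (α_ B Y W).inv) ≫ (B ◁ s₂ ≫ (α_ B P R).inv) ▷ W ≫ (α_ (B ⊗ P) R W).hom =
      B ◁ e ≫ (B ◁ s₃ ≫ (α_ B P D).inv) ≫ (B ⊗ P) ◁ s₄ := by
  have h' := congrArg (fun t => B ◁ t ≫ (α_ B P (R ⊗ W)).inv) h
  simp only [MonoidalCategory.whiskerLeft_comp, comp_whiskerRight, Category.assoc] at h' ⊢
  rw [← associator_inv_naturality_right, ← h', ← associator_inv_naturality_middle_assoc]
  congr 2
  monoidal

theorem split_whisker_aux {B X Y Y' W : C} (s : X ⟶ Y ⊗ W) (m : Y ⟶ Y') :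
    B ◁ (s ≫ m ▷ W) ≫ (α_ B Y' W).inv = (B ◁ s ≫ (α_ B Y W).inv) ≫ (B ◁ m) ▷ W := by
  simp

theorem split_whisker_aux' {B X Y W W' : C} (s : X ⟶ Y ⊗ W) (m : W ⟶ W') :
    B ◁ (s ≫ Y ◁ m) ≫ (α_ B Y W').inv = (B ◁ s ≫ (α_ B Y W).inv) ≫ (B ⊗ Y) ◁ m := by
  simp

theorem whisker_eqToHom_tens' (i : ι) {S S' : List ι} (h : S = S') :
    Q i ◁ eqToHom (congrArg (tens Q) h) = eqToHom (congrArg (fun S => tens Q (i :: S)) h) := by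
  subst h; exact MonoidalCategory.whiskerLeft_id _ _

theorem split_assoc (S L W : List ι) :
    (split Q (S ++ L) W).hom ≫ (split Q S L).hom ▷ tens Q W ≫ (α_ _ _ _).hom =
      eqToHom (congrArg (tens Q) (List.append_assoc S L W)) ≫ (split Q S (L ++ W)).hom ≫
        tens Q S ◁ (split Q L W).hom := by
  induction S with
  | nil =>
    change (split Q L W).hom ≫ (λ_ _).inv ▷ tens Q W ≫ (α_ _ _ _).hom =
      𝟙 _ ≫ (λ_ _).inv ≫ 𝟙_ C ◁ (split Q L W).hom
    simp
  | cons i S ih =>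
    refine (split_assoc_aux (B := Q i) _ _ _ _ _ ih).trans ?_
    exact congrArg (· ≫ (split Q (i :: S) (L ++ W)).hom ≫ tens Q (i :: S) ◁ (split Q L W).hom)
      (whisker_eqToHom_tens' Q i (List.append_assoc S L W))

theorem split_nil (S : List ι) :
    (split Q S []).hom = eqToHom (congrArg (tens Q) (List.append_nil S)) ≫ (ρ_ _).inv := by
  induction S with
  | nil =>
    change (λ_ (𝟙_ C)).inv = 𝟙 _ ≫ (ρ_ (𝟙_ C)).inv
    rw [Category.id_comp, unitors_inv_equal]
  | cons i S ih =>
    change Q i ◁ (split Q S []).hom ≫ (α_ _ _ _).inv = _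
    rw [ih]
    refine Eq.trans ?_ (congrArg (· ≫ (ρ_ (tens Q (i :: S))).inv)
      (whisker_eqToHom_tens' Q i (List.append_nil S)))
    simp

theorem insertAt_split_right (U₁ : List ι) {S : List ι} {d : ι} (m : tens Q S ⟶ Q d)
    (U₂ W : List ι) (h₁ : (U₁ ++ (S ++ U₂)) ++ W = U₁ ++ (S ++ (U₂ ++ W)))
    (h₂ : U₁ ++ d :: (U₂ ++ W) = (U₁ ++ d :: U₂) ++ W) :
    eqToHom (congrArg (tens Q) h₁) ≫
      insertAt Q U₁ m (U₂ ++ W) ≫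
      eqToHom (congrArg (tens Q) h₂) ≫
      (split Q (U₁ ++ d :: U₂) W).hom =
    (split Q (U₁ ++ (S ++ U₂)) W).hom ≫ insertAt Q U₁ m U₂ ▷ tens Q W := by
  induction U₁ with
  | nil =>
    have h := split_assoc Q S U₂ W
    change eqToHom (congrArg (tens Q) (List.append_assoc S U₂ W)) ≫
      ((split Q S (U₂ ++ W)).hom ≫ m ▷ tens Q (U₂ ++ W)) ≫ 𝟙 _ ≫
      (Q d ◁ (split Q U₂ W).hom ≫ (α_ _ _ _).inv) =
      (split Q (S ++ U₂) W).hom ≫ ((split Q S U₂).hom ≫ m ▷ tens Q U₂) ▷ tens Q W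
    have h' : (split Q (S ++ U₂) W).hom ≫ (split Q S U₂).hom ▷ tens Q W =
        eqToHom (congrArg (tens Q) (List.append_assoc S U₂ W)) ≫ (split Q S (U₂ ++ W)).hom ≫
        tens Q S ◁ (split Q U₂ W).hom ≫ (α_ _ _ _).inv := by
      rw [← cancel_mono (α_ (tens Q S) (tens Q U₂) (tens Q W)).hom]
      simpa only [Category.assoc, Iso.inv_hom_id, Category.comp_id] using h
    rw [comp_whiskerRight, ← Category.assoc (split Q (S ++ U₂) W).hom, h']
    simp only [Category.assoc, Category.id_comp]
    rw [← associator_inv_naturality_left, whisker_exchange_assoc]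
  | cons i U₁ ih =>
    have h₁' : (U₁ ++ (S ++ U₂)) ++ W = U₁ ++ (S ++ (U₂ ++ W)) := (List.cons.inj h₁).2
    have h₂' : U₁ ++ d :: (U₂ ++ W) = (U₁ ++ d :: U₂) ++ W := (List.cons.inj h₂).2
    refine Eq.trans (b := Q i ◁ eqToHom (congrArg (tens Q) h₁') ≫ Q i ◁ insertAt Q U₁ m (U₂ ++ W) ≫ 
      Q i ◁ eqToHom (congrArg (tens Q) h₂') ≫
      Q i ◁ (split Q (U₁ ++ d :: U₂) W).hom ≫ (α_ _ _ _).inv) ?_ ?_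
    · rw [whisker_eqToHom_tens' Q i h₁', whisker_eqToHom_tens' Q i h₂']
      rfl
    · refine Eq.trans ?_ (split_whisker_aux (split Q (U₁ ++ (S ++ U₂)) W).hom _)
      rw [← ih h₁' h₂']
      simp only [MonoidalCategory.whiskerLeft_comp, Category.assoc]

theorem insertAt_split_left (W U₁ : List ι) {S : List ι} {d : ι} (m : tens Q S ⟶ Q d)
    (U₂ : List ι) (h₁ : W ++ (U₁ ++ (S ++ U₂)) = (W ++ U₁) ++ (S ++ U₂))
    (h₂ : (W ++ U₁) ++ d :: U₂ = W ++ (U₁ ++ d :: U₂)) :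
    eqToHom (congrArg (tens Q) h₁) ≫
      insertAt Q (W ++ U₁) m U₂ ≫
      eqToHom (congrArg (tens Q) h₂) ≫
      (split Q W (U₁ ++ d :: U₂)).hom =
    (split Q W (U₁ ++ (S ++ U₂))).hom ≫ tens Q W ◁ insertAt Q U₁ m U₂ := by
  induction W with
  | nil =>
    change 𝟙 _ ≫ insertAt Q U₁ m U₂ ≫ 𝟙 _ ≫ (λ_ _).inv = (λ_ _).inv ≫ 𝟙_ C ◁ insertAt Q U₁ m U₂
    rw [Category.id_comp, Category.id_comp, leftUnitor_inv_naturality]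
  | cons i W ih =>
    have h₁' : W ++ (U₁ ++ (S ++ U₂)) = (W ++ U₁) ++ (S ++ U₂) := (List.cons.inj h₁).2
    have h₂' : (W ++ U₁) ++ d :: U₂ = W ++ (U₁ ++ d :: U₂) := (List.cons.inj h₂).2
    refine Eq.trans (b := Q i ◁ eqToHom (congrArg (tens Q) h₁') ≫ Q i ◁ insertAt Q (W ++ U₁) m U₂ ≫ 
      Q i ◁ eqToHom (congrArg (tens Q) h₂') ≫
      Q i ◁ (split Q W (U₁ ++ d :: U₂)).hom ≫ (α_ _ _ _).inv) ?_ ?_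
    · rw [whisker_eqToHom_tens' Q i h₁', whisker_eqToHom_tens' Q i h₂']
      rfl
    · refine Eq.trans ?_ (split_whisker_aux' (split Q W (U₁ ++ (S ++ U₂))).hom _)
      rw [← ih h₁' h₂']
      simp only [MonoidalCategory.whiskerLeft_comp, Category.assoc]

end split

end Templicial

namespace Templicial

section

variable {C : Type*} [Category C] [MonoidalCategory C] [Preadditive C] {A : AInf C} {Z : C}
variable {V : Type*}

theorem apply_eqToHom' (h : ∀ (U : List ℕ) (_ : List V), Z ⟶ tens A.sus U) {U U' : List ℕ}
    (F : List V) (hU : U = U') :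
    h U F ≫ eqToHom (congrArg (tens A.sus) hU) = h U' F := by
  subst hU
  exact Category.comp_id _

/-- A relation at a bead of the left part of a concatenation. -/
theorem TAN_append_right {h : ∀ (U : List ℕ) (_ : List V), Z ⟶ tens A.sus U} (U₁ : List ℕ) (d : ℕ)
    (U₂ W : List ℕ) (F G : List V) (hF : F.length = (U₁ ++ (d + 1) :: U₂).sum)
    (H : TAN A (𝟭 C) h U₁ d (U₂ ++ W) (F ++ G)) :
    TAN A (tensorRight (tens A.sus W))
      (fun U F' => h (U ++ W) (F' ++ G) ≫ (split A.sus U W).hom) U₁ d U₂ F := by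
  rw [TAN_iff] at H ⊢
  have h₂ : U₁ ++ d :: (U₂ ++ W) = (U₁ ++ d :: U₂) ++ W := by simp
  have H' := congrArg (· ≫ eqToHom (congrArg (tens A.sus) h₂) ≫
    (split A.sus (U₁ ++ d :: U₂) W).hom) H
  simp only [Preadditive.sum_comp, Linear.units_smul_comp] at H'
  refine Eq.trans (Finset.sum_congr rfl fun c _ => congrArg _ ?_) (H'.trans
    (Finset.sum_congr rfl fun j _ => congrArg _ ?_))
  · have h₁ : (U₁ ++ (c.blocks ++ U₂)) ++ W = U₁ ++ (c.blocks ++ (U₂ ++ W)) := by simp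
    have e := insertAt_split_right A.sus U₁
      (A.susMul c.blocks d (blocks_ne_nil c) c.blocks_sum) U₂ W h₁ h₂
    refine (Category.assoc _ _ _).trans ?_
    refine (congrArg (h ((U₁ ++ (c.blocks ++ U₂)) ++ W) (F ++ G) ≫ ·) e.symm).trans ?_
    refine (Category.assoc _ _ _).symm.trans ?_
    refine (congrArg (· ≫ _) (apply_eqToHom' h (F ++ G) h₁)).trans ?_
    exact (Category.assoc _ _ _).symm
  · have hj := j.isLt
    simp only [List.sum_append, List.sum_cons] at hF
    rw [List.eraseIdx_append_of_lt_length (by omega)]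
    refine (Category.assoc _ _ _).symm.trans ?_
    exact congrArg (· ≫ _) (apply_eqToHom' h _ h₂)

/-- A relation at a bead of the right part of a concatenation. -/
theorem TAN_append_left {h : ∀ (U : List ℕ) (_ : List V), Z ⟶ tens A.sus U} (W U₁ : List ℕ) (d : ℕ)
    (U₂ : List ℕ) (G : List V) {V' : Type*} (f : V' → V) (F : List V') (hG : G.length = W.sum)
    (H : TAN A (𝟭 C) h (W ++ U₁) d U₂ (G ++ F.map f)) :
    TAN A (tensorLeft (tens A.sus W))
      (fun U F' => h (W ++ U) (G ++ F'.map f) ≫ (split A.sus W U).hom) U₁ d U₂ F := by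
  rw [TAN_iff] at H ⊢
  have h₂ : (W ++ U₁) ++ d :: U₂ = W ++ (U₁ ++ d :: U₂) := by simp
  have H' := congrArg (· ≫ eqToHom (congrArg (tens A.sus) h₂) ≫
    (split A.sus W (U₁ ++ d :: U₂)).hom) H
  simp only [Preadditive.sum_comp, Linear.units_smul_comp] at H'
  refine Eq.trans (Finset.sum_congr rfl fun c _ => congrArg _ ?_) (H'.trans
    (Finset.sum_congr rfl fun j _ => congrArg _ ?_))
  · have h₁ : W ++ (U₁ ++ (c.blocks ++ U₂)) = (W ++ U₁) ++ (c.blocks ++ U₂) := by simp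
    have e := insertAt_split_left A.sus W U₁
      (A.susMul c.blocks d (blocks_ne_nil c) c.blocks_sum) U₂ h₁ h₂
    refine (Category.assoc _ _ _).trans ?_
    refine (congrArg (h (W ++ (U₁ ++ (c.blocks ++ U₂))) (G ++ F.map f) ≫ ·) e.symm).trans ?_
    refine (Category.assoc _ _ _).symm.trans ?_
    refine (congrArg (· ≫ _) (apply_eqToHom' h (G ++ F.map f) h₁)).trans ?_
    exact (Category.assoc _ _ _).symm
  · have e : (G ++ F.map f).eraseIdx ((W ++ U₁).sum + j) =
        G ++ (F.eraseIdx (U₁.sum + j)).map f := by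
      rw [List.sum_append, List.eraseIdx_append_of_length_le (by omega), ← List.eraseIdx_map]
      congr 2
      omega
    rw [e]
    refine (Category.assoc _ _ _).symm.trans ?_
    exact congrArg (· ≫ _) (apply_eqToHom' h _ h₂)

end

namespace Nerve

variable {K : Type u} [Field K] {O : Type u} {A : AInf (Quiv K O)} {Z : Quiv K O}

/-- The vertices of the second part of a concatenation. -/
def shift (p : ℕ) (F : List ℕ) : List ℕ := F.map (p + ·)

theorem endOf_shift (p v : ℕ) (F : List ℕ) : endOf (p + v) (shift p F) = p + endOf v F :=
  endOf_map (p + ·) v F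

theorem valid_append {p q : ℕ} {U F U' F' : List ℕ} (h : Valid p U F) (h' : Valid q U' F') :
    Valid (p + q) (U ++ U') (F ++ shift p F') where
  pos m hm := (List.mem_append.mp hm).elim (h.pos m) (h'.pos m)
  len := by simp [shift, h.len, h'.len]
  chain := by
    refine chain_append_of h.chain ?_
    rw [h.last]
    change ((p + 0) :: F'.map (p + ·)).IsChain (· < ·)
    rw [← List.map_cons (f := (p + ·)), List.isChain_map]
    exact h'.chain.imp fun a b hab => by omega
  last := by
    rw [endOf_append, h.last]
    exact (endOf_shift p 0 F').trans (by rw [h'.last])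

theorem valid_cast {n : ℕ} {U U' F : List ℕ} (e : U = U') (h : Valid n U F) : Valid n U' F := e ▸ h

variable (A) in
/-- The component of the comultiplication at a pair of injective necklace maps, namely
`y ↦ y_{ν_{p,q} ∘ (g₁ ∨ g₂)}`. -/
def comulComp (p q : ℕ) (U₁ F₁ U₂ F₂ : List ℕ) :
    obj A (p + q) ⟶ tens A.sus U₁ ⊗ tens A.sus U₂ :=
  π A (p + q) (U₁ ++ U₂) (F₁ ++ shift p F₂) ≫ (split A.sus U₁ U₂).hom

variable (A) in
theorem existsUnique_comul (p q : ℕ) : ∃! μ : obj A (p + q) ⟶ obj A p ⊗ obj A q,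
    ∀ (g₁ : Idx p) (g₂ : Idx q), μ ≫ (π A p g₁.U g₁.F ⊗ₘ π A q g₂.U g₂.F) =
      comulComp A p q g₁.U g₁.F g₂.U g₂.F := by
  have key := Quiv.existsUnique_tensor_lift (tanMap A p) (tanMap A q)
    (fun g₁ g₂ => comulComp A p q g₁.U g₁.F g₂.U g₂.F) ?_ ?_
  · simp only [π, rawProj_idx]
    exact key
  · intro g b M hM
    refine (comp_tanMap (𝓖 := tensorRight (tens A.sus g.U)) M b).mpr ?_
    refine (tan_congr' (fun U F hv => ?_) b).mp (TAN_append_right (h := π A (p + q)) b.U₁ b.d b.U₂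
      g.U b.F (shift p g.F) b.valid.len
      (π_tan (⟨b.U₁, b.d, b.U₂ ++ g.U, b.F ++ shift p g.F,
        valid_cast (by simp) (valid_append b.valid g.valid)⟩ : BeadIdx (p + q))))
    exact (hM ⟨U, F, hv⟩).symm.trans
      (congrArg (fun t => M ≫ t ▷ tens A.sus g.U) (rawProj_idx A ⟨U, F, hv⟩).symm)
  · intro g b M hM
    refine (comp_tanMap (𝓖 := tensorLeft (tens A.sus g.U)) M b).mpr ?_
    refine (tan_congr' (fun U F hv => ?_) b).mp (TAN_append_left (h := π A (p + q)) g.U b.U₁ b.d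
      b.U₂ g.F (p + ·) b.F g.valid.len
      (π_tan (⟨g.U ++ b.U₁, b.d, b.U₂, g.F ++ shift p b.F,
        valid_cast (by simp) (valid_append g.valid b.valid)⟩ : BeadIdx (p + q))))
    exact (hM ⟨U, F, hv⟩).symm.trans
      (congrArg (fun t => M ≫ tens A.sus g.U ◁ t) (rawProj_idx A ⟨U, F, hv⟩).symm)

variable (A) in
/-- The comultiplication `μ_{p,q}` of the nerve. It is the composite of
`y ↦ (y_{ν_{p,q} ∘ (g₁ ∨ g₂)})_{g₁, g₂}` with the inverse of the canonical isomorphism, which sends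
`x ⊗ y` to `(x_{g₁} ⊗ y_{g₂})_{g₁, g₂}`. -/
def comul (p q : ℕ) : obj A (p + q) ⟶ obj A p ⊗ obj A q := (existsUnique_comul A p q).choose

theorem comul_π {p q : ℕ} {U₁ F₁ U₂ F₂ : List ℕ} (h₁ : Valid p U₁ F₁) (h₂ : Valid q U₂ F₂) :
    comul A p q ≫ (π A p U₁ F₁ ⊗ₘ π A q U₂ F₂) = comulComp A p q U₁ F₁ U₂ F₂ :=
  (existsUnique_comul A p q).choose_spec.1 ⟨U₁, F₁, h₁⟩ ⟨U₂, F₂, h₂⟩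

theorem tensor_ext_left {p : ℕ} {Y : Quiv K O} {f g : Z ⟶ obj A p ⊗ Y}
    (h : ∀ U F, Valid p U F → f ≫ π A p U F ▷ Y = g ≫ π A p U F ▷ Y) : f = g := by
  refine Quiv.ker_tensor_ext (tanMap A p) fun i => ?_
  have := h i.U i.F i.valid
  rwa [π, rawProj_idx] at this

theorem tensor_ext_right {p : ℕ} {Y : Quiv K O} {f g : Z ⟶ Y ⊗ obj A p}
    (h : ∀ U F, Valid p U F → f ≫ Y ◁ π A p U F = g ≫ Y ◁ π A p U F) : f = g := by
  refine Quiv.tensor_ker_ext (tanMap A p) fun i => ?_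
  have := h i.U i.F i.valid
  rwa [π, rawProj_idx] at this

end Nerve

end Templicial

namespace Templicial

theorem red_map {V W : Type*} [DecidableEq V] [DecidableEq W] {f : V → W}
    (hf : Function.Injective f) (v : V) (F : List V) : red (f v) (F.map f) = (red v F).map f := by
  induction F generalizing v with
  | nil => rfl
  | cons w F ih =>
    simp only [List.map_cons, red, hf.eq_iff, ih]
    split_ifs <;> simp

theorem imSizes_map {V W : Type*} [DecidableEq V] [DecidableEq W] {f : V → W}
    (hf : Function.Injective f) (v : V) (U : List ℕ) (F : List V) :
    imSizes (f v) U (F.map f) = imSizes v U F := by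
  induction U generalizing v F with
  | nil => rfl
  | cons n U ih =>
    simp only [imSizes, ← List.map_take, ← List.map_drop, red_map hf, endOf_map, ih,
      List.length_map]

namespace Nerve

variable {K : Type u} [Field K] {O : Type u} {A : AInf (Quiv K O)} {Z : Quiv K O}

theorem map_tensor_vertices {m n m' n' : Fint} (f : m ⟶ m') (g : n ⟶ n') {F₁ F₂ : List ℕ}
    (h₁ : ∀ x ∈ F₁, x ≤ m.len) :
    (F₁ ++ shift m.len F₂).map (Fint.Hom.nat (f ⊗ₘ g)) =
      F₁.map (Fint.Hom.nat f) ++ shift m'.len (F₂.map (Fint.Hom.nat g)) := by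
  rw [List.map_append, shift, shift, List.map_map, List.map_map]
  congr 1
  · refine List.map_congr_left fun x hx => ?_
    rw [Fint.nat_tensor, Nat.sub_eq_zero_of_le (h₁ x hx), Fint.Hom.nat_zero, add_zero]
  · refine List.map_congr_left fun x _ => ?_
    simp only [Function.comp]
    rw [Fint.nat_tensor, Fint.Hom.nat_of_le f (by omega), Nat.add_sub_cancel_left]

theorem extend_split_shift {p : ℕ} (h : ∀ (U _ : List ℕ), Z ⟶ tens A.sus U) (U₁ U₂ : List ℕ)
    (F₁ F₂ : List ℕ) (hF : F₁.length = U₁.sum) (hl : endOf 0 F₁ = p) :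
    extend A (𝟭 _) h 0 (U₁ ++ U₂) (F₁ ++ shift p F₂) ≫ (split A.sus U₁ U₂).hom =
      h (nz (imSizes 0 U₁ F₁) ++ nz (imSizes 0 U₂ F₂)) (red 0 F₁ ++ shift p (red 0 F₂)) ≫
      (split A.sus _ _).hom ≫ (ebar A U₁ (imSizes 0 U₁ F₁) ⊗ₘ ebar A U₂ (imSizes 0 U₂ F₂)) := by
  have e := extend_split (𝓕 := 𝟭 _) (h := h) 0 U₁ U₂ F₁ (shift p F₂) hF
  have hi : Function.Injective (p + ·) := fun a b hab => Nat.add_left_cancel hab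
  have e1 : imSizes p U₂ (shift p F₂) = imSizes 0 U₂ F₂ := imSizes_map hi 0 U₂ F₂
  have e2 : red p (shift p F₂) = shift p (red 0 F₂) := red_map hi 0 F₂
  rw [hl, e1, e2] at e
  exact e

theorem comul_natural {m n m' n' : Fint} (f : m ⟶ m') (g : n ⟶ n') :
    comul A m'.len n'.len ≫ (map f ⊗ₘ map g) = map (f ⊗ₘ g) ≫ comul A m.len n.len := by
  refine Quiv.ker_tensor_ker_ext (tanMap A m.len) (tanMap A n.len) fun i j => ?_
  have h₁ := WValid.map i.valid.weak f
  have h₂ := WValid.map j.valid.weak g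
  have key : (comul A m'.len n'.len ≫ (map f ⊗ₘ map g)) ≫ (π A m.len i.U i.F ⊗ₘ π A n.len j.U j.F) =
      (map (f ⊗ₘ g) ≫ comul A m.len n.len) ≫ (π A m.len i.U i.F ⊗ₘ π A n.len j.U j.F) := by
    rw [Category.assoc, Category.assoc, tensorHom_comp_tensorHom, map_π f i.valid, map_π g j.valid,
      comul_π i.valid j.valid, comulComp]
    have e := map_π (A := A) (f ⊗ₘ g) (valid_append i.valid j.valid)
    refine Eq.trans ?_ ((Category.assoc _ _ _).symm.trans
      (congrArg (· ≫ (split A.sus i.U j.U).hom) e)).symm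
    rw [map_tensor_vertices f g i.valid.mem_le,
      extend_split_shift (p := m'.len) _ _ _ _ _ h₁.len h₁.last, ← Category.assoc]
    refine Eq.trans ?_ (congrArg (· ≫ _) (comul_π h₁.red h₂.red))
    rw [Category.assoc, tensorHom_comp_tensorHom]
    rfl
  simp only [π, rawProj_idx] at key
  exact key

variable (A) in
theorem exists_section (n : ℕ) : ∃ r : ∀ i : Idx n, tens A.sus i.U ⟶ obj A n,
    ∑ i, π A n i.U i.F ≫ r i = 𝟙 _ := by
  classical
  obtain ⟨r, s, h, -⟩ := Quiv.ker_retract (tanMap A n)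
  refine ⟨fun i => Quiv.inj (fun g : Idx n => tens A.sus g.U) i ≫ r, ?_⟩
  simp only [π, rawProj_idx]
  have := congrArg (fun t => Quiv.kerι (tanMap A n) ≫ t ≫ r)
    (Quiv.sum_proj_inj (Q := fun g : Idx n => tens A.sus g.U))
  simp only [Preadditive.sum_comp, Preadditive.comp_sum, Category.id_comp, h] at this
  simp only [Category.assoc] at this
  exact (Finset.sum_congr rfl fun i _ => Category.assoc _ _ _).trans this

theorem tensor_ext₃ {p q r : ℕ} {f g : Z ⟶ obj A p ⊗ (obj A q ⊗ obj A r)}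
    (h : ∀ (i : Idx p) (j : Idx q) (k : Idx r),
      f ≫ (π A p i.U i.F ⊗ₘ (π A q j.U j.F ⊗ₘ π A r k.U k.F)) =
      g ≫ (π A p i.U i.F ⊗ₘ (π A q j.U j.F ⊗ₘ π A r k.U k.F))) : f = g := by
  obtain ⟨s₁, h₁⟩ := exists_section A p
  obtain ⟨s₂, h₂⟩ := exists_section A q
  obtain ⟨s₃, h₃⟩ := exists_section A r
  have e : ∀ f : Z ⟶ obj A p ⊗ (obj A q ⊗ obj A r), f = ∑ i, ∑ j, ∑ k,
      (f ≫ (π A p i.U i.F ⊗ₘ (π A q j.U j.F ⊗ₘ π A r k.U k.F))) ≫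
        (s₁ i ⊗ₘ (s₂ j ⊗ₘ s₃ k)) := fun f => by
    simp only [Category.assoc, tensorHom_comp_tensorHom]
    simp only [← Preadditive.comp_sum, ← tensor_sum, ← sum_tensor, h₁, h₂, h₃, id_tensorHom_id,
      Category.comp_id]
  rw [e f, e g]
  simp only [h]

theorem map_π_of_eq {m n : Fint} (f : m ⟶ n) {U F : List ℕ} (hv : Valid m.len U F)
    (hmn : m.len = n.len) (hf : ∀ x, x ≤ m.len → Fint.Hom.nat f x = x) :
    map f ≫ π A m.len U F = π A n.len U F := by
  have e : F.map (Fint.Hom.nat f) = F := by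
    conv_rhs => rw [← List.map_id F]
    exact List.map_congr_left fun x hx => hf x (hv.mem_le x hx)
  rw [map_π f hv, e, extend_valid]
  exact hmn ▸ hv

theorem shift_append (p : ℕ) (F G : List ℕ) : shift p (F ++ G) = shift p F ++ shift p G :=
  List.map_append

theorem shift_shift (p q : ℕ) (F : List ℕ) : shift p (shift q F) = shift (p + q) F := by
  simp [shift, Function.comp_def, add_assoc]

theorem comul_assoc (l m n : Fint) :
    comul A (l ⊗ m).len n.len ≫ comul A l.len m.len ▷ obj A n.len ≫ (α_ _ _ _).hom =
      map (α_ l m n).inv ≫ comul A l.len (m ⊗ n).len ≫ obj A l.len ◁ comul A m.len n.len := by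
  refine tensor_ext₃ fun i j k => ?_
  have hl : comul A (l ⊗ m).len n.len ≫
      (π A (l.len + m.len) (i.U ++ j.U) (i.F ++ shift l.len j.F) ⊗ₘ π A n.len k.U k.F) =
      π A (l.len + m.len + n.len) ((i.U ++ j.U) ++ k.U)
        ((i.F ++ shift l.len j.F) ++ shift (l.len + m.len) k.F) ≫
        (split A.sus (i.U ++ j.U) k.U).hom :=
    comul_π (valid_append i.valid j.valid) k.valid
  have hr : comul A l.len (m ⊗ n).len ≫
      (π A l.len i.U i.F ⊗ₘ π A (m.len + n.len) (j.U ++ k.U) (j.F ++ shift m.len k.F)) =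
      π A (l.len + (m.len + n.len)) (i.U ++ (j.U ++ k.U))
        (i.F ++ shift l.len (j.F ++ shift m.len k.F)) ≫
        (split A.sus i.U (j.U ++ k.U)).hom :=
    comul_π i.valid (valid_append j.valid k.valid)
  have e₁ : (comul A (l ⊗ m).len n.len ≫ comul A l.len m.len ▷ obj A n.len ≫ (α_ _ _ _).hom) ≫
      (π A l.len i.U i.F ⊗ₘ (π A m.len j.U j.F ⊗ₘ π A n.len k.U k.F)) =
      (comul A (l ⊗ m).len n.len ≫
        (π A (l.len + m.len) (i.U ++ j.U) (i.F ++ shift l.len j.F) ⊗ₘ π A n.len k.U k.F)) ≫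
        (split A.sus i.U j.U).hom ▷ tens A.sus k.U ≫ (α_ _ _ _).hom := by
    have := comul_π (A := A) i.valid j.valid
    rw [comulComp] at this
    simp only [Category.assoc]
    rw [← associator_naturality, ← tensorHom_id, ← tensorHom_id,
      tensorHom_comp_tensorHom_assoc, tensorHom_comp_tensorHom_assoc, this, Category.id_comp,
      Category.comp_id]
  have e₂ : (map (α_ l m n).inv ≫ comul A l.len (m ⊗ n).len ≫
        obj A l.len ◁ comul A m.len n.len) ≫
      (π A l.len i.U i.F ⊗ₘ (π A m.len j.U j.F ⊗ₘ π A n.len k.U k.F)) =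
      map (α_ l m n).inv ≫ (comul A l.len (m ⊗ n).len ≫
      (π A l.len i.U i.F ⊗ₘ π A (m.len + n.len) (j.U ++ k.U) (j.F ++ shift m.len k.F))) ≫
        tens A.sus i.U ◁ (split A.sus j.U k.U).hom := by
    have := comul_π (A := A) j.valid k.valid
    rw [comulComp] at this
    simp only [Category.assoc]
    rw [← id_tensorHom, ← id_tensorHom, tensorHom_comp_tensorHom, tensorHom_comp_tensorHom, this,
      Category.id_comp, Category.comp_id]
  rw [e₁, e₂, hl, hr]
  have h₃ := map_π_of_eq (A := A) (α_ l m n).inv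
    (valid_append i.valid (valid_append j.valid k.valid)) (by simp [add_assoc])
    (fun x hx => by rw [Fint.nat_assoc_inv]; exact min_eq_left hx)
  have hF : (i.F ++ shift l.len j.F) ++ shift (l.len + m.len) k.F =
      i.F ++ shift l.len (j.F ++ shift m.len k.F) := by
    rw [shift_append, shift_shift, List.append_assoc]
  rw [hF]
  refine (Category.assoc _ _ _).trans ?_
  refine (congrArg (π A (l.len + m.len + n.len) ((i.U ++ j.U) ++ k.U) _ ≫ ·)
    (split_assoc A.sus i.U j.U k.U)).trans ?_
  refine (Category.assoc _ _ _).symm.trans ?_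
  refine (congrArg (· ≫ (split A.sus i.U (j.U ++ k.U)).hom ≫ tens A.sus i.U ◁
    (split A.sus j.U k.U).hom) ((apply_eqToHom' (π A (l.len + m.len + n.len)) _
      (List.append_assoc i.U j.U k.U)).trans h₃.symm)).trans ?_
  simp only [Category.assoc]
  rfl

variable (A) in
/-- The counit of the nerve. -/
def counit : obj A 0 ⟶ 𝟙_ (Quiv K O) := π A 0 [] []

theorem valid_zero : Valid 0 [] [] := ⟨by simp, rfl, by simp, rfl⟩

theorem eq_nil_of_valid {U F : List ℕ} (h : Valid 0 U F) : U = [] ∧ F = [] := by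
  have h1 : F = [] := List.length_eq_zero_iff.mp (Nat.le_zero.mp h.length_le)
  have h2 := length_le_sum h.pos
  rw [← h.len, h1] at h2
  exact ⟨List.length_eq_zero_iff.mp (Nat.le_zero.mp h2), h1⟩

instance : IsEmpty (BeadIdx 0) := ⟨fun b => by simpa using (eq_nil_of_valid b.valid).1⟩

variable (A) in
/-- The inverse of the counit. -/
def counitInv : 𝟙_ (Quiv K O) ⟶ obj A 0 :=
  lift (fun U _ => if h : U = [] then eqToHom (congrArg (tens A.sus) h.symm) else 0)
    (fun b => isEmptyElim b)

variable (A) in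
theorem counit_isIso : IsIso (counit A) := by
  refine ⟨counitInv A, hom_ext fun U F hv => ?_, ?_⟩
  · obtain ⟨rfl, rfl⟩ := eq_nil_of_valid hv
    rw [Category.assoc, counitInv, lift_π _ _ _ _ valid_zero, dif_pos rfl, Category.id_comp]
    exact Category.comp_id _
  · refine (lift_π (A := A) (n := 0) _ (fun b => isEmptyElim b) [] [] valid_zero).trans ?_
    rw [dif_pos rfl]
    rfl

theorem counit_left_aux (n : ℕ) (m : obj A n ⟶ obj A (0 + n))
    (hm : ∀ U F, Valid (0 + n) U F → m ≫ π A (0 + n) U F = π A n U F) :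
    (λ_ (obj A n)).inv = m ≫ comul A 0 n ≫ counit A ▷ obj A n := by
  refine tensor_ext_right fun U F hv => ?_
  have e₁ : (m ≫ comul A 0 n ≫ counit A ▷ obj A n) ≫ 𝟙_ _ ◁ π A n U F =
      m ≫ comulComp A 0 n [] [] U F := by
    have := comul_π (A := A) valid_zero hv
    rw [← this, Category.assoc, Category.assoc, MonoidalCategory.tensorHom_def]
    rfl
  have e₂ : shift 0 F = F := by simp [shift]
  have h₃ := hm _ _ (valid_append valid_zero hv)
  rw [e₁, ← leftUnitor_inv_naturality, comulComp]
  simp only [List.nil_append, e₂] at h₃ ⊢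
  exact ((Category.assoc _ _ _).symm.trans (congrArg (· ≫ (λ_ (tens A.sus U)).inv) h₃)).symm

theorem counit_right_aux (n : ℕ) (m : obj A n ⟶ obj A (n + 0))
    (hm : ∀ U F, Valid (n + 0) U F → m ≫ π A (n + 0) U F = π A n U F) :
    (ρ_ (obj A n)).inv = m ≫ comul A n 0 ≫ obj A n ◁ counit A := by
  refine tensor_ext_left fun U F hv => ?_
  have e₁ : (m ≫ comul A n 0 ≫ obj A n ◁ counit A) ≫ π A n U F ▷ 𝟙_ _ =
      m ≫ comulComp A n 0 U F [] [] := by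
    have := comul_π (A := A) hv valid_zero
    rw [← this, Category.assoc, Category.assoc, MonoidalCategory.tensorHom_def']
    rfl
  have e₂ : F ++ shift n [] = F := by simp [shift]
  have hv' : Valid (n + 0) (U ++ []) F := by simpa using hv
  have h₃ := hm _ _ hv'
  rw [e₁, ← rightUnitor_inv_naturality, comulComp, e₂, split_nil]
  refine Eq.symm ?_
  refine (Category.assoc _ _ _).symm.trans ?_
  refine (congrArg (· ≫ eqToHom (congrArg (tens A.sus) (List.append_nil U)) ≫
    (ρ_ (tens A.sus U)).inv) h₃).trans ?_
  refine (Category.assoc _ _ _).symm.trans ?_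
  exact congrArg (· ≫ (ρ_ (tens A.sus U)).inv)
    (apply_eqToHom' (π A n) F (List.append_nil U))

attribute [local irreducible] obj map comul counit π
theorem comul_counit_left (n : Fint) :
    (λ_ (obj A n.len)).inv =
      map (λ_ n).hom ≫ comul A (𝟙_ Fint).len n.len ≫ counit A ▷ obj A n.len :=
  counit_left_aux n.len (map (λ_ n).hom) fun U F hv =>
    map_π_of_eq (A := A) (λ_ n).hom hv (by simp)
      (fun x hx => by rw [Fint.nat_left_hom]; exact min_eq_left hx)

theorem comul_counit_right (n : Fint) :
    (ρ_ (obj A n.len)).inv =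
      map (ρ_ n).hom ≫ comul A n.len (𝟙_ Fint).len ≫ obj A n.len ◁ counit A :=
  counit_right_aux n.len (map (ρ_ n).hom) fun U F hv =>
    map_π_of_eq (A := A) (ρ_ n).hom hv (by simp)
      (fun x hx => by rw [Fint.nat_right_hom]; exact min_eq_left hx)

instance : (functor A).OplaxMonoidal where
  η := counit A
  δ m n := comul A m.unop.len n.unop.len
  δ_natural_left {m m'} f n := by
    have := comul_natural (A := A) f.unop (𝟙 n.unop)
    rw [map_id, tensorHom_id, tensorHom_id] at this
    exact this
  δ_natural_right {m m'} n f := by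
    have := comul_natural (A := A) (𝟙 n.unop) f.unop
    rw [map_id, id_tensorHom, id_tensorHom] at this
    exact this
  oplax_associativity l m n := comul_assoc l.unop m.unop n.unop
  oplax_left_unitality n := comul_counit_left n.unop
  oplax_right_unitality n := comul_counit_right n.unop

end Nerve

end Templicial

namespace Templicial

namespace Quiv

variable {K : Type u} [Field K] {O P : Type u}

/-- The pullback `(f^* Q)(a, b) = Q(f(a), f(b))` along a map of vertex sets. -/
def pull (f : O → P) : Quiv K P ⥤ Quiv K O where
  obj Q := { obj := fun a b => Q (f a) (f b) }
  map φ := ⟨fun a b => φ.app (f a) (f b)⟩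

variable (f : O → P)

@[simp] theorem pull_map_app {Q R : Quiv K P} (φ : Q ⟶ R) (a b : O) (x : Q (f a) (f b)) :
    ((pull f).map φ).app a b x = φ.app (f a) (f b) x := rfl

/-- `f^* Q ⊗ f^* R → f^* (Q ⊗ R)`, `x ⊗ y ↦ x ⊗ y`. -/
def pullTensor (Q R : Quiv K P) : tensor ((pull f).obj Q) ((pull f).obj R) ⟶
    (pull f).obj (tensor Q R) :=
  ⟨fun a b => lift (Q := (pull f).obj Q) (P := (pull f).obj R) (a := a) (b := b)
    fun c => tmul (Q := Q) (P := R) (a := f a) (b := f b) (f c)⟩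

@[simp] theorem pullTensor_tmul (Q R : Quiv K P) (a b c : O) (x : (pull f).obj Q a c)
    (y : (pull f).obj R c b) :
    (pullTensor f Q R).app a b (tmul c x y) =
      tmul (Q := Q) (P := R) (a := f a) (b := f b) (f c) x y :=
  lift_tmul (Q := (pull f).obj Q) (P := (pull f).obj R) _ c x y

/-- `K_O → f^* K_P`, `1_a ↦ 1_{f(a)}`. -/
def pullUnit : unit K O ⟶ (pull f).obj (unit K P) :=
  ⟨fun a _ => unitLift (M := (unit K P) _ _) fun h => h ▸ one (f a)⟩

@[simp] theorem pullUnit_one (a : O) : (pullUnit (K := K) f).app a a (one a) = one (f a) :=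
  unitLift_one _

instance : (pull (K := K) f).LaxMonoidal where
  ε := pullUnit f
  μ := pullTensor f
  μ_natural_left {Q R} φ S := by
    apply hom_tensor_ext
    intro a b c x y
    change (pullTensor f R S).app a b ((tensorMap ((pull f).map φ) (𝟙 _)).app a b (tmul c x y)) =
      (tensorMap φ (𝟙 S)).app (f a) (f b) ((pullTensor f Q S).app a b (tmul c x y))
    rw [tensorMap_tmul, pullTensor_tmul, pullTensor_tmul]
    exact (tensorMap_tmul φ (𝟙 S) (f a) (f b) (f c) x y).symm
  μ_natural_right {Q R} S φ := by
    apply hom_tensor_ext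
    intro a b c x y
    change (pullTensor f S R).app a b ((tensorMap (𝟙 _) ((pull f).map φ)).app a b (tmul c x y)) =
      (tensorMap (𝟙 S) φ).app (f a) (f b) ((pullTensor f S Q).app a b (tmul c x y))
    rw [tensorMap_tmul, pullTensor_tmul, pullTensor_tmul]
    exact (tensorMap_tmul (𝟙 S) φ (f a) (f b) (f c) x y).symm
  associativity Q R S := by
    apply hom_tensor_ext₃
    intro a b c d x y z
    change (assoc Q R S).hom.app (f a) (f b) ((pullTensor f (tensor Q R) S).app a b
        ((tensorMap (pullTensor f Q R) (𝟙 _)).app a b (tmul c (tmul d x y) z))) =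
      (pullTensor f Q (tensor R S)).app a b ((tensorMap (𝟙 _) (pullTensor f R S)).app a b
        ((assoc _ _ _).hom.app a b (tmul c (tmul d x y) z)))
    rw [assoc_hom_tmul, tensorMap_tmul, tensorMap_tmul, pullTensor_tmul, pullTensor_tmul,
      pullTensor_tmul, pullTensor_tmul]
    exact assoc_hom_tmul (f a) (f b) (f c) (f d) x y z
  left_unitality Q := by
    apply hom_unit_tensor_ext
    intro a b x
    change (leftUnit _).hom.app a b (tmul a (one a) x) = (leftUnit Q).hom.app (f a) (f b)
      ((pullTensor f (unit K P) Q).app a b ((tensorMap (pullUnit f) (𝟙 _)).app a b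
        (tmul a (one a) x)))
    rw [leftUnit_hom_tmul, tensorMap_tmul, pullTensor_tmul, pullUnit_one]
    exact (leftUnit_hom_tmul (Q := Q) (f a) (f b) x).symm
  right_unitality Q := by
    apply hom_tensor_unit_ext
    intro a b x
    change (rightUnit _).hom.app a b (tmul b x (one b)) = (rightUnit Q).hom.app (f a) (f b)
      ((pullTensor f Q (unit K P)).app a b ((tensorMap (𝟙 _) (pullUnit f)).app a b
        (tmul b x (one b))))
    rw [rightUnit_hom_tmul, tensorMap_tmul, pullTensor_tmul, pullUnit_one]
    exact (rightUnit_hom_tmul (Q := Q) (f a) (f b) x).symm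

end Quiv

/-- A templicial vector space, given by a set `O` and a strongly unital, colax monoidal functor
from the opposite of the finite interval category to the `K`-linear quivers with vertex set `O`. -/
structure TemplicialVect (K : Type u) [Field K] where
  O : Type u
  X : Fintᵒᵖ ⥤ Quiv K O
  [colax : X.OplaxMonoidal]
  strong : IsIso (Functor.OplaxMonoidal.η X)

attribute [instance] TemplicialVect.colax

namespace TemplicialVect

variable {K : Type u} [Field K]

/-- The quiver of `n`-simplices `X_n`. -/
def spx (X : TemplicialVect K) (n : ℕ) : Quiv K X.O := X.X.obj (Opposite.op ⟨n⟩)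

variable (X : TemplicialVect K)

/-- The counit `X_0 → K_O`. -/
def counit : X.spx 0 ⟶ 𝟙_ (Quiv K X.O) := Functor.OplaxMonoidal.η X.X

/-- The comultiplication `X_{p+q} → X_p ⊗ X_q`. -/
def comul (p q : ℕ) : X.spx (p + q) ⟶ X.spx p ⊗ X.spx q :=
  Functor.OplaxMonoidal.δ X.X (Opposite.op ⟨p⟩) (Opposite.op ⟨q⟩)

/-- The inner face map `d_{j+1} : X_{n+1} → X_n`, for `j < n`. -/
def face {n : ℕ} (j : Fin n) : X.spx (n + 1) ⟶ X.spx n := X.X.map (Fint.face j).op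

/-- The degeneracy map `s_i : X_n → X_{n+1}`, for `0 ≤ i ≤ n`. -/
def degen {n : ℕ} (i : Fin (n + 1)) : X.spx n ⟶ X.spx (n + 1) := X.X.map (Fint.degen i).op

/-- The iterated comultiplication `X_{i₁+...+i_l} → X_{i₁} ⊗ (... ⊗ (X_{i_l} ⊗ K_O))`. -/
def comulSum : ∀ S : List ℕ, X.spx S.sum ⟶ tens X.spx S
  | [] => X.counit
  | i :: S => X.comul i S.sum ≫ X.spx i ◁ comulSum S

/-- The iterated comultiplication `X_n → X_{i₁} ⊗ ... ⊗ X_{i_l}` for `n = i₁ + ... + i_l`. -/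
def comulList (n : ℕ) (S : List ℕ) (h : S.sum = n) : X.spx n ⟶ tens X.spx S :=
  eqToHom (congrArg X.spx h.symm) ≫ X.comulSum S

end TemplicialVect

/-- A map of templicial vector spaces `(X, O) → (Y, P)`, given by a map of sets `f : O → P` and a
natural transformation `X → f^* Y` that is compatible with comultiplications and counits. -/
@[ext] structure TempHom {K : Type u} [Field K] (X Y : TemplicialVect K) where
  obj : X.O → Y.O
  app : X.X ⟶ Y.X ⋙ Quiv.pull obj
  comul : ∀ m n : Fintᵒᵖ,
    app.app (m ⊗ n) ≫ (Quiv.pull obj).map (Functor.OplaxMonoidal.δ Y.X m n) =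
      Functor.OplaxMonoidal.δ X.X m n ≫ (app.app m ⊗ₘ app.app n) ≫
        Functor.LaxMonoidal.μ (Quiv.pull obj) (Y.X.obj m) (Y.X.obj n)
  counit : app.app (𝟙_ Fintᵒᵖ) ≫ (Quiv.pull obj).map (Functor.OplaxMonoidal.η Y.X) =
    Functor.OplaxMonoidal.η X.X ≫ Functor.LaxMonoidal.ε (Quiv.pull obj)

/-- A (small, strictly unital) `A∞`-category over `K`. -/
structure AInfCat (K : Type u) [Field K] where
  Obj : Type u
  alg : AInf (Quiv K Obj)

/-- The templicial nerve of an `A∞`-category. -/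
def nerve {K : Type u} [Field K] (A : AInfCat K) : TemplicialVect K where
  O := A.Obj
  X := Nerve.functor A.alg
  strong := Nerve.counit_isIso A.alg

section data

variable {C D : Type*} [Category C] [MonoidalCategory C] [Category D] [MonoidalCategory D]

/-- The tensor product `φ_{i₁} ⊗ ... ⊗ φ_{i_l}`, for morphisms `φ_i` that are indexed by positive
integers. -/
def tensHom {Q R : ℕ → C} (φ : ∀ n, 0 < n → (Q n ⟶ R n)) :
    ∀ S : List ℕ, (∀ i ∈ S, 0 < i) → (tens Q S ⟶ tens R S)
  | [], _ => 𝟙 _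
  | i :: S, h => φ i (h i (by simp)) ⊗ₘ tensHom φ S (fun j hj => h j (by simp [hj]))

/-- The canonical map `F(Q i₁) ⊗ ... ⊗ F(Q i_l) → F(Q i₁ ⊗ ... ⊗ Q i_l)` of a lax monoidal
functor. -/
def laxTens (F : C ⥤ D) [F.LaxMonoidal] {ι : Type*} (Q : ι → C) :
    ∀ S : List ι, tens (fun i => F.obj (Q i)) S ⟶ F.obj (tens Q S)
  | [] => Functor.LaxMonoidal.ε F
  | i :: S => F.obj (Q i) ◁ laxTens F Q S ≫ Functor.LaxMonoidal.μ F (Q i) (tens Q S)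

end data

namespace AInfCat

variable {K : Type u} [Field K] (A : AInfCat K) {O : Type u} (f : O → A.Obj)

/-- The quiver `f^* 𝒜_{n-1}`. -/
def pull (n : ℕ) : Quiv K O := (Quiv.pull f).obj (A.alg.sus n)

/-- The differential `∂ = m₁ : f^* 𝒜_d → f^* 𝒜_{d-1}`. -/
def diff (d : ℕ) : A.pull f (d + 1) ⟶ A.pull f d :=
  (Quiv.pull f).map ((ρ_ (A.alg.sus (d + 1))).inv ≫ A.alg.susMul [d + 1] d (by simp) (by simp))

/-- The multiplication `m_l : f^* 𝒜_{i₁-1} ⊗ ... ⊗ f^* 𝒜_{i_l-1} → f^* 𝒜_{d-1}` for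
`S = (i₁, ..., i_l)` with `i₁ + ... + i_l = d + 1`. -/
def mulPull (S : List ℕ) (d : ℕ) (hS : S ≠ []) (h : S.sum = d + 1) :
    tens (A.pull f) S ⟶ A.pull f d :=
  laxTens (Quiv.pull f) A.alg.sus S ≫ (Quiv.pull f).map (A.alg.susMul S d hS h)

/-- The unit `K_O → f^* 𝒜_0`. -/
def unitPull : 𝟙_ (Quiv K O) ⟶ A.pull f 1 :=
  Functor.LaxMonoidal.ε (Quiv.pull f) ≫ (Quiv.pull f).map A.alg.susUnit

end AInfCat

namespace MapData

variable {K : Type u} [Field K]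

/-- `β_{n+1} s_j` is the unit of `𝒜` for `n = 0` (where `X_0` is identified with `K_O` through the
counit) and `0` for `n > 0`. -/
def Degen {X : TemplicialVect K} {A : AInfCat K} (f : X.O → A.Obj)
    (β : ∀ n, 0 < n → (X.spx n ⟶ A.pull f n)) : Prop :=
  (∀ j : Fin (0 + 1), X.degen j ≫ β (0 + 1) (by simp) = X.counit ≫ A.unitPull f) ∧
  ∀ n, 0 < n → ∀ j : Fin (n + 1), X.degen j ≫ β (n + 1) (by simp) = 0

/-- For all `n = d + 1 > 0`, `∂ β_n = ∑_{j=1}^{n-1} (-1)^{j-1} β_{n-1} d_j -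
∑ (-1)^{ε(i₁, ..., i_l)} m_l (β_{i₁} ⊗ ... ⊗ β_{i_l}) μ_{i₁, ..., i_l}`, where the second sum ranges
over all `l ≥ 2` and `i₁, ..., i_l > 0` with `i₁ + ... + i_l = n`. -/
def Diff {X : TemplicialVect K} {A : AInfCat K} (f : X.O → A.Obj)
    (β : ∀ n, 0 < n → (X.spx n ⟶ A.pull f n)) : Prop :=
  ∀ d : ℕ, β (d + 1) (by simp) ≫ A.diff f d =
    ∑ j : Fin d, Int.negOnePow (j : ℤ) • (X.face j ≫ β d (Fin.pos j)) -
    ∑ c : Composition (d + 1) with 2 ≤ c.length, Int.negOnePow (sig c.blocks) •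
      (X.comulList (d + 1) c.blocks c.blocks_sum ≫ tensHom β c.blocks (fun _ h => c.blocks_pos h) ≫
        A.mulPull f c.blocks d (blocks_ne_nil c) c.blocks_sum)

/-- The map `α ↦ π_{id_{Δⁿ}} ∘ α_n`, where `id_{Δⁿ}` is the necklace map with the single bead `Δⁿ`
and the vertices `0, 1, ..., n`. -/
def ofHom {X : TemplicialVect K} {A : AInfCat K} (α : TempHom X (nerve A)) (n : ℕ) :
    X.spx n ⟶ A.pull α.obj n :=
  α.app.app (Opposite.op ⟨n⟩) ≫ (Quiv.pull (K := K) (P := A.Obj) α.obj).map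
    (Nerve.π A.alg n [n] (List.range' 1 n) ≫ (ρ_ (A.alg.sus n)).hom)

end MapData

end Templicial

end

/-! A simplex of the nerve is a family of components indexed by injective necklace maps g : Δ^{n₁} ∨
… ∨ Δ^{n_l} → Δⁿ. Every such g is the necklace that exhausts the vertices of Δ^{n₁+…+n_l}, followed
by a simplex map [n₁+…+n_l] → [n] that records the vertices of g. For a templicial map α to the
nerve, naturality takes care of the simplex map, and compatibility with comultiplications cuts the
exhausting necklace into its beads. So the component of α at g has no choice: it is (β_{n₁} ⊗ … ⊗
β_{n_l}) μ_{n₁,…,n_l} precomposed with the operator of X for the simplex map. This expression is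
`neckComp`, and `TempHom.nval_π` is the statement that α has these components. Injectivity follows
at once. The two conditions on β are the values of the nerve's degeneracies on the component at the
identity (`TempHom.degenRel_proj`) and the nerve relation at the unique bead of the identity of a
simplex (`TempHom.simplexRel_proj`).

Conversely, given β, the maps `neckComp` are to be assembled into a templicial map.

(1) They satisfy the nerve relation at every bead (`beadRel`). The other beads enter only as tensor
factors, so the relation reduces to that of a single bead, which is the relation on β pulled back
along the vertices of the bead.

(2) They are natural (`Nerve.map_components`). A simplex operator turns g into a necklace map that
may fail to be injective. The nerve evaluates it through the map ē, while `neckComp` makes sense for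
it directly, and `neckComp_eq_ebar` says that the two agree. This is the only place where the
condition on degeneracies enters: a collapsed edge contributes a unit, and any other degenerate bead
contributes zero.

(3) They are compatible with comultiplications (`Nerve.components_comul`), because `neckComp` of a
wedge is the product of the two values (`neckComp_split`), which is coassociativity of X. The counit
is the case of the empty necklace.

The bookkeeping rests on one operation. For a colax monoidal X and a lax monoidal F, maps X a → F A
and X b → F B have a convolution product X (a ⊗ b) → F (A ⊗ B). It is associative and unital up to
coherence (`conv_assoc`, `unit_conv`, `conv_unit`) and biadditive in the preadditive case. Here F is
the pullback of quivers along f, and an iterated convolution of the β is exactly (β_{n₁} ⊗ … ⊗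
β_{n_l}) μ. The differential condition of the theorem becomes `SimplexRel` once ∂β_n is read as the
summand l = 1 (`MapData.diff_iff`). -/

namespace Templicial

open Functor.LaxMonoidal Functor.OplaxMonoidal

/-! ### Chains of vertices as functions of the position -/

/-- The `i`-th vertex of the chain `v, G`, constant beyond its end. -/
def vertex {V : Type*} : V → List V → ℕ → V
  | v, _, 0 => v
  | v, [], _ + 1 => v
  | _, w :: G, i + 1 => vertex w G i

section vertex

variable {V W : Type*}

@[simp] theorem vertex_zero (v : V) (G : List V) : vertex v G 0 = v := by
  cases G <;> rfl

@[simp] theorem vertex_nil (v : V) (i : ℕ) : vertex v [] i = v := by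
  cases i <;> rfl

@[simp] theorem vertex_cons (v w : V) (G : List V) (i : ℕ) :
    vertex v (w :: G) (i + 1) = vertex w G i := rfl

theorem vertex_of_le (v : V) (G : List V) {i : ℕ} (h : G.length ≤ i) :
    vertex v G i = endOf v G := by
  induction G generalizing v i with
  | nil => simp [endOf]
  | cons w G ih =>
    obtain ⟨i, rfl⟩ : ∃ k, i = k + 1 := ⟨i - 1, by simp at h; omega⟩
    exact ih w (by simpa using h)

theorem vertex_map (f : V → W) (v : V) (G : List V) (i : ℕ) :
    vertex (f v) (G.map f) i = f (vertex v G i) := by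
  induction G generalizing v i with
  | nil => simp
  | cons w G ih => cases i with
    | zero => simp
    | succ i => exact ih w i

/-- Truncated subtraction kills the second summand along `G`, and beyond `G` the first summand rests
at the end of `G`. This is the formula for the monoidal product of `Fint`, so a wedge of necklace
maps has a tensor product as its vertex map. -/
theorem vertex_append_map (v : ℕ) (G H : List ℕ) (i : ℕ) :
    vertex v (G ++ H.map (endOf v G + ·)) i = vertex v G i + vertex 0 H (i - G.length) := by
  induction G generalizing v i with
  | nil => simpa [endOf] using vertex_map (v + ·) 0 H i
  | cons w G ih => cases i with
    | zero => simp
    | succ i => simpa [endOf] using ih w i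

theorem vertex_mono {v : ℕ} {G : List ℕ} (h : (v :: G).IsChain (· ≤ ·)) {i j : ℕ} (hij : i ≤ j) :
    vertex v G i ≤ vertex v G j := by
  induction G generalizing v i j with
  | nil => simp
  | cons w G ih =>
    rw [List.isChain_cons_cons] at h
    rcases i with _ | i <;> rcases j with _ | j
    · exact le_rfl
    · exact h.1.trans ((vertex_zero w G).symm.le.trans (ih h.2 (Nat.zero_le j)))
    · omega
    · exact ih h.2 (by omega)

theorem vertex_range' (s n i : ℕ) : vertex s (List.range' (s + 1) n) i = s + min i n := by
  induction n generalizing s i with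
  | zero => simp
  | succ n ih => cases i with
    | zero => simp
    | succ i => rw [List.range'_succ, vertex_cons, ih]; omega

/-- Entry `j` of the list is vertex `j + 1` of the chain, so erasing it is precomposition with the
inner face that omits `j + 1`. The bound on `j` protects the endpoint, whose loss would change the
constant value beyond the end. -/
theorem vertex_eraseIdx (v : V) (G : List V) (j i : ℕ) (hj : j + 1 < G.length) :
    vertex v (G.eraseIdx j) i = vertex v G (if i ≤ j then i else i + 1) := by
  induction G generalizing v j i with
  | nil => simp at hj
  | cons w G ih =>
    rcases j with _ | j
    · rcases i with _ | i
      · simp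
      · obtain _ | ⟨x, G⟩ := G
        · simp at hj
        · simp
    · rcases i with _ | i
      · simp
      · have := ih w j i (by simpa using hj)
        simp only [List.eraseIdx_cons_succ, vertex_cons, this]
        split_ifs with h1 h2 h2
        · rfl
        · omega
        · omega
        · rfl

/-- Any chain is thereby the image of the standard chain 1, 2, … under its own vertex map, which
reduces arbitrary necklace maps to those that hit all vertices. -/
theorem map_vertex_range' (v : V) (G : List V) :
    (List.range' 1 G.length).map (vertex v G) = G := by
  induction G generalizing v with
  | nil => rfl
  | cons w G ih =>
    rw [List.length_cons, List.range'_succ, List.map_cons, vertex_cons, vertex_zero,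
      List.range'_succ_left, List.map_map]
    exact congrArg (w :: ·) (ih w)

/-- Two equal neighbours are what is needed to factor the vertex map of the chain through a
degeneracy. -/
theorem exists_vertex_eq {v : V} {G : List V} (h : ¬ (v :: G).IsChain (· ≠ ·)) :
    ∃ j, j < G.length ∧ vertex v G j = vertex v G (j + 1) := by
  induction G generalizing v with
  | nil => simp at h
  | cons w G ih =>
    by_cases e : v = w
    · exact ⟨0, by simp, by simpa using e⟩
    · rw [List.isChain_cons_cons, not_and] at h
      obtain ⟨j, hj, hj'⟩ := ih (h e)
      exact ⟨j + 1, by simpa using hj, hj'⟩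

theorem endOf_range' (s n : ℕ) : endOf s (List.range' (s + 1) n) = s + n := by
  rw [← vertex_of_le s _ le_rfl, vertex_range']
  simp

theorem isChain_range' (s n : ℕ) : (s :: List.range' (s + 1) n).IsChain (· < ·) := by
  rw [← List.range'_succ]
  exact List.isChain_iff_pairwise.mpr List.pairwise_lt_range'

end vertex

/-- This is the necklace with beads `U` inside the simplex on all of its vertices, from which every
other necklace map with beads `U` is obtained by a simplex map. -/
theorem valid_range' {U : List ℕ} (h : ∀ m ∈ U, 0 < m) : Valid U.sum U (List.range' 1 U.sum) where
  pos := h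
  len := by simp
  chain := isChain_range' 0 _
  last := by simpa using endOf_range' 0 U.sum

/-! ### Faces and degeneracies on natural numbers -/

namespace Fint

variable {m n : Fint}

/-- The index is shifted by one: `face j` omits the value `j + 1`. The formula has the same shape as
`vertex_eraseIdx`. -/
theorem nat_face {n : ℕ} (j : Fin n) {i : ℕ} (hi : i ≤ n) :
    Hom.nat (face j) i = if i ≤ j then i else i + 1 := by
  have h := Hom.map_val (face j) ⟨i, Nat.lt_succ_of_le hi⟩
  refine h.symm.trans ?_
  change ((Fin.succAbove j.succ.castSucc ⟨i, _⟩ : Fin (n + 2)) : ℕ) = _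
  simp only [Fin.succAbove, Fin.lt_def]
  split_ifs <;> simp_all

theorem nat_degen {n : ℕ} (j : Fin (n + 1)) {i : ℕ} (hi : i ≤ n + 1) :
    Hom.nat (degen j) i = if i ≤ j then i else i - 1 := by
  have h := Hom.map_val (degen j) ⟨i, Nat.lt_succ_of_le hi⟩
  refine h.symm.trans ?_
  change ((Fin.predAbove j ⟨i, _⟩ : Fin (n + 1)) : ℕ) = _
  by_cases h1 : (j : ℕ) < i
  · rw [Fin.predAbove_of_castSucc_lt _ _ (by simpa [Fin.lt_def] using h1), if_neg (by omega)]
    rfl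
  · rw [Fin.predAbove_of_le_castSucc _ _ (by simpa [Fin.le_def] using h1), if_pos (by omega)]
    rfl

end Fint

/-! ### Necklace maps, their vertex maps and their wedges -/

namespace Nerve

/-- The map `[n₁ + ... + n_k] → [n]` on the vertices of a necklace. -/
def vtx {n : ℕ} {U G : List ℕ} (hv : WValid n U G) : (⟨U.sum⟩ : Fint) ⟶ ⟨n⟩ :=
  Fint.Hom.ofNat (vertex 0 G) (fun _ _ h _ => vertex_mono hv.chain h) (vertex_zero _ _)
    ((vertex_of_le 0 G hv.len.le).trans hv.last)

theorem nat_vtx {n : ℕ} {U G : List ℕ} (hv : WValid n U G) (i : ℕ) :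
    Fint.Hom.nat (vtx hv) i = vertex 0 G i := by
  rw [vtx, Fint.Hom.nat_ofNat]
  change vertex 0 G (min i U.sum) = _
  rcases le_total i U.sum with h | h
  · rw [min_eq_left h]
  · rw [min_eq_right h, vertex_of_le 0 G hv.len.le, vertex_of_le 0 G (hv.len.le.trans h)]

theorem wvalid_append {p q : ℕ} {U F U' F' : List ℕ} (h : WValid p U F) (h' : WValid q U' F') :
    WValid (p + q) (U ++ U') (F ++ shift p F') where
  pos m hm := (List.mem_append.mp hm).elim (h.pos m) (h'.pos m)
  len := by simp [shift, h.len, h'.len]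
  chain := by
    refine chain_append_of h.chain ?_
    rw [h.last]
    change ((p + 0) :: F'.map (p + ·)).IsChain (· ≤ ·)
    rw [← List.map_cons (f := (p + ·)), List.isChain_map]
    exact h'.chain.imp fun a b hab => by omega
  last := by
    rw [endOf_append, h.last]
    exact (endOf_shift p 0 F').trans (by rw [h'.last])

/-- A necklace map on a concatenation of necklaces is a concatenation of necklace maps. -/
theorem exists_split {n : ℕ} {S U G : List ℕ} (h : WValid n (S ++ U) G) :
    ∃ p q G₁ G₂, n = p + q ∧ G = G₁ ++ shift p G₂ ∧ WValid p S G₁ ∧ WValid q U G₂ := by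
  have hlen := h.len
  rw [List.sum_append] at hlen
  -- The vertices of the beads in `S` come first. What remains is a chain that starts where they
  -- end, and it is translated back to start at 0.
  have hG := List.take_append_drop S.sum G
  set G₁ := G.take S.sum with hG₁
  set G₃ := G.drop S.sum with hG₃
  have h1 : G₁.length = S.sum := by simp [hG₁]; omega
  have h2 : G₃.length = U.sum := by simp [hG₃]; omega
  have hc := h.chain
  have hl := h.last
  rw [← hG] at hc hl
  have hc₃ := chain_endOf hc
  -- Monotonicity makes the subtraction below exact, so that shifting back recovers `G₃`.
  have hle : ∀ x ∈ G₃, endOf 0 G₁ ≤ x := by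
    have := List.isChain_iff_pairwise.mp hc₃
    exact fun x hx => List.rel_of_pairwise_cons this hx
  have hs : shift (endOf 0 G₁) (G₃.map (· - endOf 0 G₁)) = G₃ := by
    rw [shift, List.map_map]
    conv_rhs => rw [← List.map_id G₃]
    exact List.map_congr_left fun x hx => by have := hle x hx; simp; omega
  have e := endOf_shift (endOf 0 G₁) 0 (G₃.map (· - endOf 0 G₁))
  rw [hs, add_zero, ← endOf_append, hl] at e
  refine ⟨endOf 0 G₁, endOf 0 (G₃.map (· - endOf 0 G₁)), G₁, G₃.map (· - endOf 0 G₁), e,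
    by rw [hs, hG], ⟨fun m hm => h.pos m (by simp [hm]), h1,
      List.IsChain.left_of_append (l₂ := G₃) (by simpa using hc), rfl⟩,
    ⟨fun m hm => h.pos m (by simp [hm]), by simp [h2], ?_, rfl⟩⟩
  have := chain_map (f := (· - endOf 0 G₁)) (fun _ _ hij => by omega) hc₃
  simpa using this

/-- `exists_split` only yields weakly increasing pieces. The pieces of a strictly increasing chain
are strictly increasing, since translation reflects strict inequalities. -/
theorem Valid.of_split {p q : ℕ} {S U G₁ G₂ : List ℕ}
    (h : Valid (p + q) (S ++ U) (G₁ ++ shift p G₂)) (h₁ : WValid p S G₁) (h₂ : WValid q U G₂) :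
    Valid p S G₁ ∧ Valid q U G₂ := by
  refine ⟨⟨h₁.pos, h₁.len, List.IsChain.left_of_append (l₂ := shift p G₂) (by simpa using h.chain),
    h₁.last⟩, ⟨h₂.pos, h₂.len, ?_, h₂.last⟩⟩
  have hc := chain_endOf h.chain
  rw [h₁.last] at hc
  have e : p :: shift p G₂ = (0 :: G₂).map (p + ·) := rfl
  rw [e, List.isChain_map] at hc
  exact hc.imp fun a b hab => by omega

theorem vtx_comp {m n : Fint} {U G : List ℕ} (hv : WValid m.len U G) (f : m ⟶ n) :
    vtx hv ≫ f = vtx (hv.map f) := by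
  refine Fint.hom_ext' fun i _ => ?_
  rw [Fint.Hom.nat_comp, nat_vtx, nat_vtx]
  have := vertex_map (Fint.Hom.nat f) 0 G i
  rw [Fint.Hom.nat_zero] at this
  exact this.symm

/-- Formulated for values, because the two morphisms have sources `⟨U.sum⟩ ⊗ ⟨U'.sum⟩` and `⟨(U ++
U').sum⟩`, which agree only up to a propositional equality of lengths. -/
theorem nat_tensor_vtx {p q : ℕ} {U F U' F' : List ℕ} (h : WValid p U F) (h' : WValid q U' F')
    (i : ℕ) : Fint.Hom.nat (vtx h ⊗ₘ vtx h') i = Fint.Hom.nat (vtx (wvalid_append h h')) i := by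
  rw [Fint.nat_tensor, nat_vtx, nat_vtx, nat_vtx]
  have := vertex_append_map 0 F F' i
  rw [h.last, h.len] at this
  exact this.symm

theorem wvalid_nil : WValid 0 [] [] := valid_zero.weak

theorem WValid.eq_nil {n : ℕ} {G : List ℕ} (h : WValid n [] G) : n = 0 ∧ G = [] := by
  obtain rfl : G = [] := by simpa using h.len
  exact ⟨h.last.symm, rfl⟩

end Nerve

/-! ### Convolution of maps from a colax to a lax monoidal functor -/

section convolution

variable {C D E : Type*} [Category C] [MonoidalCategory C] [Category D] [MonoidalCategory D]
  [Category E] [MonoidalCategory E] (X : E ⥤ C) [X.OplaxMonoidal] (F : D ⥤ C) [F.LaxMonoidal]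

/-- The convolution product of a map `X a ⟶ F A` with a map `X b ⟶ F B`. -/
def conv {a b : E} {A B : D} (f : X.obj a ⟶ F.obj A) (g : X.obj b ⟶ F.obj B) :
    X.obj (a ⊗ b) ⟶ F.obj (A ⊗ B) := δ X a b ≫ (f ⊗ₘ g) ≫ μ F A B

variable {X F} {a b c a' b' : E} {A B G A' B' : D}

theorem conv_map (f : X.obj a ⟶ F.obj A) (g : X.obj b ⟶ F.obj B) (σ : A ⟶ A') (τ : B ⟶ B') :
    conv X F f g ≫ F.map (σ ⊗ₘ τ) = conv X F (f ≫ F.map σ) (g ≫ F.map τ) := by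
  simp only [conv, Category.assoc, ← μ_natural, tensorHom_comp_tensorHom_assoc]

theorem conv_map_left (f : X.obj a ⟶ F.obj A) (g : X.obj b ⟶ F.obj B) (σ : A ⟶ A') :
    conv X F f g ≫ F.map (σ ▷ B) = conv X F (f ≫ F.map σ) g := by
  rw [← tensorHom_id, conv_map, F.map_id, Category.comp_id]

theorem conv_map_right (f : X.obj a ⟶ F.obj A) (g : X.obj b ⟶ F.obj B) (τ : B ⟶ B') :
    conv X F f g ≫ F.map (A ◁ τ) = conv X F f (g ≫ F.map τ) := by
  rw [← id_tensorHom, conv_map, F.map_id, Category.comp_id]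

theorem map_conv (f : X.obj a' ⟶ F.obj A) (g : X.obj b' ⟶ F.obj B) (σ : a ⟶ a') (τ : b ⟶ b') :
    X.map (σ ⊗ₘ τ) ≫ conv X F f g = conv X F (X.map σ ≫ f) (X.map τ ≫ g) := by
  simp only [conv, ← δ_natural_assoc, tensorHom_comp_tensorHom_assoc]

/-- Coassociativity of `X` and associativity of `F` rebracket the two ends, and naturality of the
associator rebrackets the maps in between. -/
theorem conv_assoc (f : X.obj a ⟶ F.obj A) (g : X.obj b ⟶ F.obj B) (h : X.obj c ⟶ F.obj G) :
    conv X F f (conv X F g h) ≫ F.map (α_ A B G).inv =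
      X.map (α_ a b c).inv ≫ conv X F (conv X F f g) h := by
  have e1 : conv X F f (conv X F g h) = δ X a (b ⊗ c) ≫ X.obj a ◁ δ X b c ≫ (f ⊗ₘ (g ⊗ₘ h)) ≫
      F.obj A ◁ μ F B G ≫ μ F A (B ⊗ G) := by
    simp only [conv, ← id_tensorHom, tensorHom_comp_tensorHom_assoc, Category.id_comp,
      Category.comp_id]
  have e2 : conv X F (conv X F f g) h = δ X (a ⊗ b) c ≫ δ X a b ▷ X.obj c ≫ ((f ⊗ₘ g) ⊗ₘ h) ≫
      μ F A B ▷ F.obj G ≫ μ F (A ⊗ B) G := by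
    simp only [conv, ← tensorHom_id, tensorHom_comp_tensorHom_assoc, Category.id_comp,
      Category.comp_id]
  rw [e1, e2]
  simp only [Category.assoc]
  rw [Functor.LaxMonoidal.associativity_inv, associator_inv_naturality_assoc,
    Functor.OplaxMonoidal.associativity_inv_assoc]

/-- The counit of `X` followed by the unit of `F` is neutral for convolution. Left unitality of both
functors cancels the structure maps around `g`. -/
theorem unit_conv (g : X.obj b ⟶ F.obj B) :
    X.map (λ_ b).inv ≫ conv X F (η X ≫ ε F) g = g ≫ F.map (λ_ B).inv := by
  have e : conv X F (η X ≫ ε F) g = δ X (𝟙_ E) b ≫ η X ▷ X.obj b ≫ 𝟙_ C ◁ g ≫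
      ε F ▷ F.obj B ≫ μ F (𝟙_ D) B := by
    simp only [conv, ← id_tensorHom, ← tensorHom_id, tensorHom_comp_tensorHom_assoc,
      Category.id_comp, Category.comp_id]
  rw [e, ← Functor.OplaxMonoidal.left_unitality_assoc, ← leftUnitor_inv_naturality_assoc,
    Functor.LaxMonoidal.left_unitality_inv]

theorem conv_unit (f : X.obj a ⟶ F.obj A) :
    X.map (ρ_ a).inv ≫ conv X F f (η X ≫ ε F) = f ≫ F.map (ρ_ A).inv := by
  have e : conv X F f (η X ≫ ε F) = δ X a (𝟙_ E) ≫ X.obj a ◁ η X ≫ f ▷ 𝟙_ C ≫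
      F.obj A ◁ ε F ≫ μ F A (𝟙_ D) := by
    simp only [conv, ← id_tensorHom, ← tensorHom_id, tensorHom_comp_tensorHom_assoc,
      Category.id_comp, Category.comp_id]
  rw [e, ← Functor.OplaxMonoidal.right_unitality_assoc, ← rightUnitor_inv_naturality_assoc,
    Functor.LaxMonoidal.right_unitality_inv]

end convolution

/-! ### Iterated convolutions and the components they define -/

noncomputable section comulTens

variable {C D : Type*} [Category C] [MonoidalCategory C] [Category D] [MonoidalCategory D]
  (X : Fintᵒᵖ ⥤ C) [X.OplaxMonoidal] (F : D ⥤ C) [F.LaxMonoidal] {Q : ℕ → D}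
  (β : ∀ n, X.obj (Opposite.op ⟨n⟩) ⟶ F.obj (Q n))

/-- The map `(β_{n₁} ⊗ ... ⊗ β_{n_l}) μ_{n₁, ..., n_l}`. -/
def comulTens : ∀ U : List ℕ, X.obj (Opposite.op ⟨U.sum⟩) ⟶ F.obj (tens Q U)
  | [] => η X ≫ ε F
  | i :: U => conv X F (β i) (comulTens U)

/-- The inductive step of `comulTens_split` for abstract objects: the splitting `σ` of the tail is
used inside the second factor, and then both sides are rebracketed by `conv_assoc`. -/
theorem split_cons_aux {a s t u : Fintᵒᵖ} {A S T U : D} {e' : t ⟶ s ⊗ u} {e : a ⊗ t ⟶ (a ⊗ s) ⊗ u}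
    (he : e = a ◁ e' ≫ (α_ a s u).inv) (f : X.obj a ⟶ F.obj A) (g : X.obj s ⟶ F.obj S)
    (k : X.obj u ⟶ F.obj U) (l : X.obj t ⟶ F.obj T) (σ : T ⟶ S ⊗ U)
    (hl : l ≫ F.map σ = X.map e' ≫ conv X F g k) :
    conv X F f l ≫ F.map (A ◁ σ ≫ (α_ A S U).inv) = X.map e ≫ conv X F (conv X F f g) k := by
  rw [F.map_comp, ← Category.assoc, conv_map_right, hl, he, X.map_comp, Category.assoc,
    ← conv_assoc, ← Category.assoc, ← id_tensorHom, map_conv, X.map_id, Category.id_comp]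

/-- Coassociativity for a list cut into two parts. The comparison `e` is any morphism that is the
identity on vertices, since the lengths of its source and target are equal only by a theorem on
sums. -/
theorem comulTens_split (S U : List ℕ) (e : (⟨S.sum⟩ ⊗ ⟨U.sum⟩ : Fint) ⟶ ⟨(S ++ U).sum⟩)
    (he : ∀ x, x ≤ S.sum + U.sum → Fint.Hom.nat e x = x) :
    comulTens X F β (S ++ U) ≫ F.map (split Q S U).hom =
      X.map e.op ≫ conv X F (comulTens X F β S) (comulTens X F β U) := by
  induction S with
  | nil =>
    -- For an empty first part the claim is the unit law. The inverse left unitor of the opposite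
    -- category is the opposite of the left unitor of `Fint`, which has the same values as `e`.
    refine (unit_conv (comulTens X F β U)).symm.trans ?_
    refine congrArg (· ≫ conv X F (η X ≫ ε F) (comulTens X F β U)) (congrArg X.map ?_)
    change ((λ_ (⟨U.sum⟩ : Fint)).hom).op = _
    refine congrArg Quiver.Hom.op (Fint.hom_ext' fun x hx => ?_)
    rw [Fint.nat_left_hom]
    exact (min_eq_left hx).trans (he x hx).symm
  | cons i S ih =>
    have h : (⟨S.sum⟩ ⊗ ⟨U.sum⟩ : Fint).len = (⟨(S ++ U).sum⟩ : Fint).len := by simp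
    let e' := (Fint.idIso h).hom
    have he' : ∀ x, x ≤ S.sum + U.sum → Fint.Hom.nat e' x = x := fun x hx => by
      rw [Fint.nat_idIso_hom]; exact min_eq_left hx
    refine split_cons_aux X F (a := Opposite.op ⟨i⟩) (s := Opposite.op ⟨S.sum⟩)
      (u := Opposite.op ⟨U.sum⟩) (t := Opposite.op ⟨(S ++ U).sum⟩)
      (e' := e'.op) (e := e.op) ?_ (β i) (comulTens X F β S) (comulTens X F β U)
      (comulTens X F β (S ++ U)) (split Q S U).hom (ih e' he')
    -- Passing to opposites turns the inverse associator into the associator of `Fint`, so the two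
    -- sides can be compared on vertices.
    change e.op = ((α_ (⟨i⟩ : Fint) ⟨S.sum⟩ ⟨U.sum⟩).hom ≫ (⟨i⟩ : Fint) ◁ e').op
    refine congrArg Quiver.Hom.op (Fint.hom_ext' fun x hx => ?_)
    have hx' : x ≤ i + S.sum + U.sum := hx
    refine (he x (by simpa using hx')).trans (Eq.symm ?_)
    refine (Fint.Hom.nat_comp (α_ (⟨i⟩ : Fint) ⟨S.sum⟩ ⟨U.sum⟩).hom ((⟨i⟩ : Fint) ◁ e') x).trans ?_
    rw [Fint.nat_assoc_hom, Fint.nat_whiskerLeft, min_eq_left hx', he' _ (show x - i ≤ _ by omega)]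
    simp only
    omega

/-- The map `comulTens` with a variable source. -/
def comulTensTo {s : ℕ} (U : List ℕ) (h : U.sum = s) : X.obj (Opposite.op ⟨s⟩) ⟶ F.obj (tens Q U) :=
  eqToHom (by rw [h]) ≫ comulTens X F β U

/-- This moves the proof of `U.sum = s` from the source of a simplex map into `comulTensTo`, so that
a map with source `⟨s⟩` can be chosen freely by its values. -/
theorem map_comulTens {n : Fint} {s : ℕ} (U : List ℕ) (h : U.sum = s) (φ : (⟨U.sum⟩ : Fint) ⟶ n)
    (ψ : (⟨s⟩ : Fint) ⟶ n) (hφ : ∀ x, x ≤ s → Fint.Hom.nat φ x = Fint.Hom.nat ψ x) :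
    X.map φ.op ≫ comulTens X F β U = X.map ψ.op ≫ comulTensTo X F β U h := by
  subst h
  rw [Fint.hom_ext' hφ, comulTensTo, eqToHom_refl, Category.id_comp]

/-- A tensor product over a list ends with the monoidal unit, hence the right unitor. The trailing
counit factor is absorbed by `conv_unit`. -/
theorem comulTensTo_single (n : ℕ) :
    comulTensTo X F β [n] (by simp) = β n ≫ F.map (ρ_ (Q n)).inv := by
  rw [← conv_unit]
  have := map_comulTens X F β [n] (s := n) (by simp) (ρ_ (⟨n⟩ : Fint)).hom (𝟙 _) fun x hx => by
    refine (Fint.nat_right_hom (m := ⟨n⟩) x).trans ?_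
    rw [Fint.Hom.nat_id]; simp
  rw [op_id, X.map_id, Category.id_comp] at this
  exact this.symm

open Classical in
/-- The components of the map to the nerve which is associated to a family `β`. -/
def neckComp [Preadditive C] (n : ℕ) (U G : List ℕ) : X.obj (Opposite.op ⟨n⟩) ⟶ F.obj (tens Q U) :=
  if hv : Nerve.WValid n U G then X.map (Nerve.vtx hv).op ≫ comulTens X F β U
  -- The default only serves to make the family total on pairs of lists; the statements below that
  -- evaluate it do so at pairs that encode a necklace map.
  else 0

theorem neckComp_of_nat [Preadditive C] {n s : ℕ} {U G : List ℕ} (hv : Nerve.WValid n U G)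
    (h : U.sum = s) (φ : (⟨s⟩ : Fint) ⟶ ⟨n⟩) (hφ : ∀ x, x ≤ s → Fint.Hom.nat φ x = vertex 0 G x) :
    neckComp X F β n U G = X.map φ.op ≫ comulTensTo X F β U h := by
  rw [neckComp, dif_pos hv]
  exact map_comulTens X F β U h _ φ fun x hx => by rw [Nerve.nat_vtx, hφ x hx]

/-- Functoriality of `X` alone: the vertex map of the composite necklace map is a composite. Weak
validity suffices, and the image chain may have repetitions even if `G` has none. -/
theorem map_neckComp [Preadditive C] {m n : Fint} (φ : m ⟶ n) {U G : List ℕ}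
    (hv : Nerve.WValid m.len U G) :
    X.map φ.op ≫ neckComp X F β m.len U G = neckComp X F β n.len U (G.map (Fint.Hom.nat φ)) := by
  rw [neckComp, dif_pos hv, neckComp, dif_pos (hv.map φ), ← Nerve.vtx_comp hv φ, op_comp,
    X.map_comp, Category.assoc]

/-- The vertex map of a wedge is the tensor product of the vertex maps, so naturality of the
comultiplication of `X` separates the two simplex operators, while `comulTens_split` separates the
two lists of beads. -/
theorem neckComp_split [Preadditive C] {p q : ℕ} {S U G₁ G₂ : List ℕ} (h₁ : Nerve.WValid p S G₁)
    (h₂ : Nerve.WValid q U G₂) :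
    neckComp X F β (p + q) (S ++ U) (G₁ ++ Nerve.shift p G₂) ≫ F.map (split Q S U).hom =
      conv X F (neckComp X F β p S G₁) (neckComp X F β q U G₂) := by
  have h : (⟨S.sum⟩ ⊗ ⟨U.sum⟩ : Fint).len = (⟨(S ++ U).sum⟩ : Fint).len := by simp
  have he : ∀ x, x ≤ S.sum + U.sum → Fint.Hom.nat (Fint.idIso h).hom x = x := fun x hx => by
    rw [Fint.nat_idIso_hom]; exact min_eq_left hx
  have hv := Nerve.wvalid_append h₁ h₂
  have e : (Fint.idIso h).hom ≫ Nerve.vtx hv = Nerve.vtx h₁ ⊗ₘ Nerve.vtx h₂ :=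
    Fint.hom_ext' fun x hx => by
      rw [Nerve.nat_tensor_vtx, Fint.Hom.nat_comp, he x hx]
  rw [neckComp, dif_pos hv, neckComp, dif_pos h₁, neckComp, dif_pos h₂, Category.assoc,
    comulTens_split X F β S U _ he, ← Category.assoc, ← X.map_comp, ← op_comp, e]
  exact map_conv (X := X) (F := F) _ _ (Nerve.vtx h₁).op (Nerve.vtx h₂).op

theorem split_single (i : ℕ) (U : List ℕ) :
    (split Q [i] U).hom = (ρ_ (Q i)).inv ▷ tens Q U :=
  triangle_assoc_comp_left_inv (Q i) (tens Q U)

/-- The case of one bead followed by the rest, with the unit object at the end of the one-bead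
tensor product removed. Inductions on the beads use this form. -/
theorem neckComp_cons [Preadditive C] {p q i : ℕ} {U G₁ G₂ : List ℕ} (h₁ : Nerve.WValid p [i] G₁)
    (h₂ : Nerve.WValid q U G₂) :
    neckComp X F β (p + q) (i :: U) (G₁ ++ Nerve.shift p G₂) =
      conv X F (neckComp X F β p [i] G₁ ≫ F.map (ρ_ (Q i)).hom) (neckComp X F β q U G₂) := by
  have h := neckComp_split X F β h₁ h₂
  rw [← cancel_mono (F.map (split Q [i] U).hom)]
  refine h.trans ?_
  rw [split_single]
  refine Eq.trans ?_ (conv_map_left (X := X) (F := F) (a := Opposite.op ⟨p⟩) (b := Opposite.op ⟨q⟩)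
    _ _ (ρ_ (Q i)).inv).symm
  rw [Category.assoc, ← F.map_comp, Iso.hom_inv_id, F.map_id, Category.comp_id]

/-- The component at a single bead is β applied to the face or degeneracy of the simplex that the
vertices of the bead describe. -/
theorem neckComp_single [Preadditive C] {n i : ℕ} {G : List ℕ} (hv : Nerve.WValid n [i] G)
    (φ : (⟨i⟩ : Fint) ⟶ ⟨n⟩) (hφ : ∀ x, x ≤ i → Fint.Hom.nat φ x = vertex 0 G x) :
    neckComp X F β n [i] G ≫ F.map (ρ_ (Q i)).hom = X.map φ.op ≫ β i := by
  rw [neckComp_of_nat X F β hv (by simp) φ hφ, comulTensTo_single, Category.assoc, Category.assoc,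
    ← F.map_comp, Iso.inv_hom_id, F.map_id, Category.comp_id]

end comulTens

/-! ### Biadditivity of convolution -/

section convAdditive

variable {C D E : Type*} [Category C] [MonoidalCategory C] [Preadditive C] [MonoidalPreadditive C]
  [Category D] [MonoidalCategory D] [Category E] [MonoidalCategory E] {X : E ⥤ C}
  [X.OplaxMonoidal] {F : D ⥤ C} [F.LaxMonoidal] {a b : E} {A B : D}

theorem zero_conv (g : X.obj b ⟶ F.obj B) : conv X F (0 : X.obj a ⟶ F.obj A) g = 0 := by
  simp [conv]

theorem conv_sum {ι : Type*} (t : Finset ι) (s : ι → ℤˣ) (f : X.obj a ⟶ F.obj A)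
    (g : ι → (X.obj b ⟶ F.obj B)) :
    ∑ i ∈ t, s i • conv X F f (g i) = conv X F f (∑ i ∈ t, s i • g i) := by
  -- Signs are units of ℤ, so additivity in the second variable suffices to carry a signed sum
  -- through.
  let φ : (X.obj b ⟶ F.obj B) →+ (X.obj (a ⊗ b) ⟶ F.obj (A ⊗ B)) :=
    AddMonoidHom.mk' (fun g => conv X F f g) fun g g' => by
      simp [conv, MonoidalPreadditive.tensor_add]
  change _ = φ _
  simp only [map_sum, Units.smul_def, map_zsmul]
  rfl

theorem sum_conv {ι : Type*} (t : Finset ι) (s : ι → ℤˣ) (f : ι → (X.obj a ⟶ F.obj A))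
    (g : X.obj b ⟶ F.obj B) :
    ∑ i ∈ t, s i • conv X F (f i) g = conv X F (∑ i ∈ t, s i • f i) g := by
  let φ : (X.obj a ⟶ F.obj A) →+ (X.obj (a ⊗ b) ⟶ F.obj (A ⊗ B)) :=
    AddMonoidHom.mk' (fun f => conv X F f g) fun f f' => by
      simp [conv, MonoidalPreadditive.add_tensor]
  change _ = φ _
  simp only [map_sum, Units.smul_def, map_zsmul]
  rfl

end convAdditive

/-! ### Degenerate beads and bead relations for the components -/

section neckComp

variable {C D : Type*} [Category C] [MonoidalCategory C] [Preadditive C]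
  [Category D] [MonoidalCategory D] [Preadditive D] {A : AInf D}
  (X : Fintᵒᵖ ⥤ C) [X.OplaxMonoidal] (F : D ⥤ C) [F.LaxMonoidal]
  (β : ∀ n, X.obj (Opposite.op ⟨n⟩) ⟶ F.obj (A.sus n))

/-- The condition that `β` sends degenerate simplices to units or to zero. -/
structure DegenRel : Prop where
  zero (j : Fin (0 + 1)) : X.map (Fint.degen j).op ≫ β 1 =
    (η X : X.obj (Opposite.op ⟨0⟩) ⟶ 𝟙_ C) ≫ ε F ≫ F.map A.susUnit
  pos {n : ℕ} (hn : 0 < n) (j : Fin (n + 1)) : X.map (Fint.degen j).op ≫ β (n + 1) = 0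

/-- The relation imposed on `β` by the simplex of dimension `d + 1`. -/
def SimplexRel (d : ℕ) : Prop :=
  ∑ c : Composition (d + 1), Int.negOnePow (sig c.blocks) •
      (comulTensTo X F β c.blocks c.blocks_sum ≫
        F.map (A.susMul c.blocks d (blocks_ne_nil c) c.blocks_sum)) =
    ∑ j : Fin d, Int.negOnePow (j : ℤ) • (X.map (Fint.face j).op ≫ β d)

variable {X F β}

/-- The vertex map of a collapsed edge is the degeneracy [1] → [0], where β takes the value of the
unit. The counit factor that this leaves is neutral for convolution, and only the unit of 𝒜 remains.
-/
theorem neckComp_unit {q : ℕ} {U G : List ℕ} (hβ : DegenRel X F β) (h : Nerve.WValid q U G) :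
    neckComp X F β q (1 :: U) (0 :: G) =
      neckComp X F β q U G ≫ F.map (insertAt A.sus [] (S := []) A.susUnit U) := by
  have h₁ : Nerve.WValid 0 [1] [0] := ⟨by simp, by simp, by simp, rfl⟩
  have e₀ : Nerve.shift 0 G = G := by simp [Nerve.shift]
  have h₀ := neckComp_single X F β h₁ (Fint.degen (0 : Fin (0 + 1))) fun x hx => by
    rw [Fint.nat_degen _ (by omega)]
    rcases x with _ | x
    · simp
    · simp; omega
  rw [hβ.zero] at h₀
  have hv := Nerve.wvalid_append h₁ h
  have hc := neckComp_cons X F β h₁ h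
  rw [h₀] at hc
  -- The wedge with Δ⁰ lives over `0 + q` and the claim over `q`; the left unitor, which fixes all
  -- vertices, compares them.
  have hm := map_neckComp X F β (λ_ (⟨q⟩ : Fint)).hom hv
  have e₁ : ([0] ++ Nerve.shift 0 G).map (Fint.Hom.nat (λ_ (⟨q⟩ : Fint)).hom) = 0 :: G := by
    rw [e₀, List.singleton_append]
    conv_rhs => rw [← List.map_id (0 :: G)]
    refine List.map_congr_left fun x hx => ?_
    have hl := mem_le_endOf hv.chain x (by simpa [e₀] using hx)
    rw [hv.last] at hl
    rw [Fint.nat_left_hom]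
    exact min_eq_left hl
  rw [e₁] at hm
  refine hm.symm.trans ?_
  refine (congrArg (X.map (λ_ (⟨q⟩ : Fint)).hom.op ≫ ·) hc).trans ?_
  -- The unit of 𝒜 is moved out of the first factor, which leaves the neutral element to which
  -- `unit_conv` applies.
  have hl := conv_map_left (X := X) (F := F) (η X ≫ ε F) (neckComp X F β q U G) A.susUnit
  rw [Category.assoc] at hl
  refine (congrArg (X.map (λ_ (Opposite.op (⟨q⟩ : Fint))).inv ≫ ·) hl.symm).trans ?_
  rw [← Category.assoc, unit_conv, Category.assoc, ← F.map_comp]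
  rfl

/-- A repeated vertex factors the vertex map of the bead through a degeneracy [k + 1] → [k]. Here k
> 0 because the bead is not an edge, so β vanishes on the result. -/
theorem neckComp_zero {p i : ℕ} {G : List ℕ} (hβ : DegenRel X F β) (h : Nerve.WValid p [i] G)
    (hc : ¬ (0 :: G).IsChain (· ≠ ·)) (hi : i ≠ 1) :
    neckComp X F β p [i] G ≫ F.map (ρ_ (A.sus i)).hom = 0 := by
  have h0 := h.pos i (by simp)
  obtain ⟨k, rfl⟩ : ∃ k, i = k + 1 := ⟨i - 1, by omega⟩
  obtain ⟨j, hj, hj'⟩ := exists_vertex_eq hc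
  have hl : G.length = k + 1 := by simpa using h.len
  -- The second factor skips position `j + 1`, whose vertex equals that at `j`. If `j = k`, the
  -- skipped position is the endpoint, and the repetition is what keeps ψ endpoint-preserving.
  let ψ : (⟨k⟩ : Fint) ⟶ ⟨p⟩ := Fint.Hom.ofNat (fun x => vertex 0 G (if x ≤ j then x else x + 1))
    (fun x y hxy _ => vertex_mono h.chain (by split_ifs <;> omega)) (by simp) (by
      have e := (vertex_of_le 0 G hl.le).trans h.last
      simp only
      split_ifs with hk
      · obtain rfl : j = k := by omega
        rw [hj', e]
      · exact e)
  have hφ := neckComp_single X F β h (Fint.degen (⟨j, by omega⟩ : Fin (k + 1)) ≫ ψ) fun x hx => by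
    rw [Fint.Hom.nat_comp, Fint.nat_degen _ hx]
    simp only [ψ]
    rw [Fint.Hom.nat_ofNat]
    simp only
    split_ifs with h1 h2 h2
    · rw [min_eq_left (by omega)]
    · omega
    · obtain rfl : x = j + 1 := by omega
      rw [min_eq_left (by omega), Nat.add_sub_cancel, hj']
    · rw [min_eq_left (by omega), Nat.sub_add_cancel (by omega)]
  rw [hφ, op_comp, X.map_comp, Category.assoc, hβ.pos (by omega), Limits.comp_zero]

/-- The components at necklace maps that need not be injective. -/
theorem neckComp_eq_ebar [MonoidalPreadditive C] [F.Additive] {n : ℕ} {U G : List ℕ}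
    (hβ : DegenRel X F β) (h : Nerve.WValid n U G) :
    neckComp X F β n U G =
      neckComp X F β n (nz (imSizes 0 U G)) (red 0 G) ≫ F.map (ebar A U (imSizes 0 U G)) := by
  induction U generalizing n G with
  | nil =>
    obtain ⟨rfl, rfl⟩ := h.eq_nil
    simp only [imSizes, ebar, nz, red]
    exact ((congrArg (neckComp X F β 0 [] [] ≫ ·) (F.map_id _)).trans (Category.comp_id _)).symm
  | cons i U ih =>
    obtain ⟨p, q, G₁, G₂, rfl, rfl, h₁, h₂⟩ := Nerve.exists_split (S := [i]) (U := U) h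
    obtain rfl : G₁.length = i := by simpa using h₁.len
    -- The reduction of a chain and the image sizes of its beads are unaffected by translation, so
    -- those of the tail can be computed from 0 and the induction hypothesis applies.
    have hi : Function.Injective (p + ·) := fun a b hab => Nat.add_left_cancel hab
    have e₁ : imSizes p U (Nerve.shift p G₂) = imSizes 0 U G₂ := imSizes_map hi 0 U G₂
    have e₂ : red p (Nerve.shift p G₂) = Nerve.shift p (red 0 G₂) := red_map hi 0 G₂
    rw [imSizes_cons, red_append, h₁.last, e₁, e₂, neckComp_cons X F β h₁ h₂]
    have h0 : G₁ ≠ [] := List.ne_nil_of_length_pos (h₁.pos _ (by simp))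
    rcases bead_cases (v := 0) h0 with h3 | rfl | ⟨h3, h4⟩
    -- An injective bead: ē is the identity on it, and the induction hypothesis acts in the second
    -- convolution factor.
    · obtain ⟨w, G₁, rfl⟩ := List.exists_cons_of_ne_nil h0
      rw [red_eq_of_chain h3, ih h₂]
      have hc := neckComp_cons X F β h₁ h₂.red.weak
      refine Eq.trans ?_ (congrArg₂ (· ≫ ·) hc.symm
        (congrArg F.map (ebar_id A G₁.length U (imSizes 0 U G₂)).symm))
      exact (conv_map_right (X := X) (F := F) (a := Opposite.op ⟨p⟩) (b := Opposite.op ⟨q⟩)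
        _ _ _).symm
    -- An edge collapsed to a vertex: both sides insert the unit of 𝒜 in front of the remaining
    -- beads.
    · obtain rfl : 0 = p := h₁.last
      rw [← neckComp_cons X F β h₁ h₂]
      have e₃ : ∀ G, Nerve.shift 0 G = G := fun G => by simp [Nerve.shift]
      have e₄ : red 0 [0] = [] := rfl
      simp only [e₃, e₄, List.length_singleton, List.singleton_append, List.nil_append]
      have h₂' : Nerve.WValid (0 + q) U G₂ := by rwa [zero_add]
      rw [neckComp_unit hβ h₂', ih h₂']
      refine Eq.trans ?_ (congrArg (fun t => neckComp X F β (0 + q) (nz (imSizes 0 U G₂)) (red 0 G₂) ≫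
        F.map t) (ebar_unit A U (imSizes 0 U G₂)).symm)
      rw [F.map_comp, Category.assoc]
    -- Any other degenerate bead: the first convolution factor is zero on the left, and ē is zero on
    -- the right.
    · rw [neckComp_zero hβ h₁ h3 h4]
      refine (zero_conv (X := X) (F := F) (a := Opposite.op ⟨p⟩) (b := Opposite.op ⟨q⟩) _).trans ?_
      rw [ebar_zero A U _ (red_length_lt h3) h4, F.map_zero, Limits.comp_zero]

variable (X F β) in
/-- The relation of the nerve at a bead, for the components `neckComp`. -/
def BeadRel (n : ℕ) (U₁ : List ℕ) (d : ℕ) (U₂ : List ℕ) (G : List ℕ) : Prop :=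
  ∑ c : Composition (d + 1), Int.negOnePow (sig c.blocks) •
      (neckComp X F β n (U₁ ++ (c.blocks ++ U₂)) G ≫
        F.map (insertAt A.sus U₁ (A.susMul c.blocks d (blocks_ne_nil c) c.blocks_sum) U₂)) =
    ∑ j : Fin d, Int.negOnePow (j : ℤ) •
      neckComp X F β n (U₁ ++ d :: U₂) (G.eraseIdx (U₁.sum + j))

/-- The relation on β lives on the full simplex of dimension `d + 1`. Precomposition with the
operator of the bead's vertex map carries it to any bead in Δ^p: cuttings keep the vertices, and an
inner face erases one of them. -/
theorem simplex_beadRel {p d : ℕ} {G : List ℕ} (hβ : SimplexRel X F β d) (h : Valid p [d + 1] G) :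
    ∑ c : Composition (d + 1), Int.negOnePow (sig c.blocks) •
      (neckComp X F β p c.blocks G ≫
        F.map (A.susMul c.blocks d (blocks_ne_nil c) c.blocks_sum)) =
    ∑ j : Fin d, Int.negOnePow (j : ℤ) •
      (neckComp X F β p [d] (G.eraseIdx j) ≫ F.map (ρ_ (A.sus d)).hom) := by
  have hl : G.length = d + 1 := by simpa using h.len
  let φ : (⟨d + 1⟩ : Fint) ⟶ ⟨p⟩ := Fint.Hom.ofNat (vertex 0 G)
    (fun _ _ hij _ => vertex_mono h.weak.chain hij) (vertex_zero _ _)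
    ((vertex_of_le 0 G hl.le).trans h.last)
  have hφ : ∀ x, x ≤ d + 1 → Fint.Hom.nat φ x = vertex 0 G x := fun x hx => by
    simp only [φ, Fint.Hom.nat_ofNat]
    rw [min_eq_left hx]
  have h' := congrArg (X.map φ.op ≫ ·) hβ
  simp only [Preadditive.comp_sum, Linear.comp_units_smul] at h'
  refine Eq.trans (Finset.sum_congr rfl fun c _ => congrArg _ ?_) (h'.trans
    (Finset.sum_congr rfl fun j _ => congrArg _ ?_))
  · have hv : Valid p c.blocks G := by
      have := Nerve.valid_cut (U₁ := []) (U₂ := []) h c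
      simpa using this
    rw [neckComp_of_nat X F β hv.weak c.blocks_sum φ hφ, Category.assoc]
  · have hv : Valid p [d] (G.eraseIdx j) := by
      have := Nerve.valid_face (U₁ := []) (U₂ := []) h j
      simpa using this
    rw [neckComp_single X F β hv.weak (Fint.face j ≫ φ), op_comp, X.map_comp, Category.assoc]
    intro x hx
    have hj := j.isLt
    rw [Fint.Hom.nat_comp, Fint.nat_face j hx, hφ _ (by split_ifs <;> omega),
      vertex_eraseIdx _ _ _ _ (by omega)]

/-- Beads away from the chosen one are convolution factors common to all summands. Biadditivity
pulls them out of the signed sums, by induction for the beads on the left and in one step for those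
on the right, and `simplex_beadRel` remains. -/
theorem beadRel [MonoidalPreadditive C] [F.Additive] (hβ : ∀ d, SimplexRel X F β d) {n : ℕ}
    {U₁ : List ℕ} {d : ℕ} {U₂ : List ℕ} {G : List ℕ} (h : Valid n (U₁ ++ (d + 1) :: U₂) G) :
    BeadRel X F β n U₁ d U₂ G := by
  induction U₁ generalizing n G with
  | nil =>
    obtain ⟨p, q, G₁, G₂, rfl, rfl, h₁, h₂⟩ := Nerve.exists_split (S := [d + 1]) (U := U₂) h.weak
    have hl : G₁.length = d + 1 := by simpa using h₁.len
    have hv := (Nerve.Valid.of_split (S := [d + 1]) (U := U₂) h h₁ h₂).1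
    -- The relation at the chosen bead is multiplied on the right by the component at all later
    -- beads.
    have h' := congrArg (fun t => conv X F (a := Opposite.op ⟨p⟩) (b := Opposite.op ⟨q⟩) t
      (neckComp X F β q U₂ G₂)) (simplex_beadRel (hβ d) hv)
    simp only [← sum_conv] at h'
    refine Eq.trans (Finset.sum_congr rfl fun c _ => congrArg _ ?_) (h'.trans
      (Finset.sum_congr rfl fun j _ => congrArg _ ?_))
    · have hc : Valid p c.blocks G₁ := by
        have := Nerve.valid_cut (U₁ := []) (U₂ := []) hv c
        simpa using this
      rw [insertAt_nil, F.map_comp, ← Category.assoc]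
      refine (congrArg (· ≫ F.map (A.susMul c.blocks d (blocks_ne_nil c) c.blocks_sum ▷ tens A.sus U₂))
        (neckComp_split X F β hc.weak h₂)).trans ?_
      exact conv_map_left (X := X) (F := F) (a := Opposite.op ⟨p⟩) (b := Opposite.op ⟨q⟩) _ _ _
    · have hj := j.isLt
      have hc : Valid p [d] (G₁.eraseIdx j) := by
        have := Nerve.valid_face (U₁ := []) (U₂ := []) hv j
        simpa using this
      rw [List.sum_nil, zero_add, List.eraseIdx_append_of_lt_length (by omega)]
      exact (neckComp_cons X F β hc.weak h₂).symm
  | cons i U₁ ih =>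
    obtain ⟨p, q, G₁, G₂, rfl, rfl, h₁, h₂⟩ :=
      Nerve.exists_split (S := [i]) (U := U₁ ++ (d + 1) :: U₂) h.weak
    have hl : G₁.length = i := by simpa using h₁.len
    have hv := (Nerve.Valid.of_split (S := [i]) (U := U₁ ++ (d + 1) :: U₂) h h₁ h₂).2
    -- The relation for the remaining necklace is multiplied on the left by the component at the
    -- first bead. No sign appears, since the Koszul signs have already cancelled in `tanSign_eq`.
    have h' := congrArg (fun t => conv X F (a := Opposite.op ⟨p⟩) (b := Opposite.op ⟨q⟩)
      (neckComp X F β p [i] G₁ ≫ F.map (ρ_ (A.sus i)).hom) t) (ih hv)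
    simp only [← conv_sum] at h'
    refine Eq.trans (Finset.sum_congr rfl fun c _ => congrArg _ ?_) (h'.trans
      (Finset.sum_congr rfl fun j _ => congrArg _ ?_))
    · refine (congrArg (· ≫ F.map (A.sus i ◁ insertAt A.sus U₁ (A.susMul c.blocks d
        (blocks_ne_nil c) c.blocks_sum) U₂))
        (neckComp_cons X F β h₁ (Nerve.valid_cut hv c).weak)).trans ?_
      exact conv_map_right (X := X) (F := F) (a := Opposite.op ⟨p⟩) (b := Opposite.op ⟨q⟩) _ _ _
    · have e : (G₁ ++ Nerve.shift p G₂).eraseIdx ((i :: U₁).sum + j) =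
          G₁ ++ Nerve.shift p (G₂.eraseIdx (U₁.sum + j)) := by
        rw [List.eraseIdx_append_of_length_le (by simp; omega), Nerve.shift, Nerve.shift,
          List.eraseIdx_map]
        congr 3
        simp; omega
      rw [e]
      exact (neckComp_cons X F β h₁ (Nerve.valid_face hv j).weak).symm

end neckComp

/-! ### Maps into pullbacks of the nerve, and identities in the nerve -/

namespace Quiv

instance {K : Type u} [Field K] {O P : Type u} (f : O → P) : (pull (K := K) f).Additive where
  map_add := rfl

end Quiv

namespace Nerve

variable {K : Type u} [Field K] {O P : Type u} {A : AInf (Quiv K P)} (f : O → P) {n : ℕ}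
  {Z : Quiv K O}

/-- Pullback only reindexes vertices, so a value is still an element of a kernel inside a product
and is determined by its coordinates. -/
theorem pull_hom_ext {M M' : Z ⟶ (Quiv.pull f).obj (obj A n)}
    (h : ∀ U F, Valid n U F → M ≫ (Quiv.pull f).map (π A n U F) =
      M' ≫ (Quiv.pull f).map (π A n U F)) : M = M' := by
  ext a b x
  refine Subtype.ext (funext fun g => ?_)
  have h' := h g.U g.F g.valid
  rw [π, rawProj_idx] at h'
  exact congrArg (fun t : Z ⟶ (Quiv.pull f).obj (tens A.sus g.U) => t.app a b x) h'

/-- The index sets are finite and the kernel is a retract of the product, so the identity of each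
factor is a finite sum of maps through the components (`exists_section`). Tensoring these
decompositions recovers a map from its pairs of components. -/
theorem pull_tensor_hom_ext {p q : ℕ} {M M' : Z ⟶ (Quiv.pull f).obj (obj A p ⊗ obj A q)}
    (h : ∀ (i : Idx p) (j : Idx q),
      M ≫ (Quiv.pull f).map (π A p i.U i.F ⊗ₘ π A q j.U j.F) =
      M' ≫ (Quiv.pull f).map (π A p i.U i.F ⊗ₘ π A q j.U j.F)) : M = M' := by
  obtain ⟨s₁, h₁⟩ := exists_section A p
  obtain ⟨s₂, h₂⟩ := exists_section A q
  have e : ∀ M : Z ⟶ (Quiv.pull f).obj (obj A p ⊗ obj A q), M = ∑ i, ∑ j,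
      (M ≫ (Quiv.pull f).map (π A p i.U i.F ⊗ₘ π A q j.U j.F)) ≫
        (Quiv.pull f).map (s₁ i ⊗ₘ s₂ j) := fun M => by
    simp only [Category.assoc, ← Functor.map_comp, tensorHom_comp_tensorHom]
    simp only [← Preadditive.comp_sum, ← Functor.map_sum, ← tensor_sum, ← sum_tensor, h₁, h₂,
      id_tensorHom_id]
    exact (Category.comp_id M).symm
  rw [e M, e M']
  simp only [h]

/-- The map to the pullback of the nerve with given components. -/
theorem exists_pull_lift (h : ∀ (U _ : List ℕ), Z ⟶ (Quiv.pull f).obj (tens A.sus U))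
    (H : ∀ b : BeadIdx n, ∑ c : Composition (b.d + 1), Int.negOnePow (sig c.blocks) •
      (h (b.U₁ ++ (c.blocks ++ b.U₂)) b.F ≫ (Quiv.pull f).map (insertAt A.sus b.U₁
        (A.susMul c.blocks b.d (blocks_ne_nil c) c.blocks_sum) b.U₂)) =
      ∑ j : Fin b.d, Int.negOnePow (j : ℤ) •
        h (b.U₁ ++ b.d :: b.U₂) (b.F.eraseIdx (b.U₁.sum + j))) :
    ∃ M : Z ⟶ (Quiv.pull f).obj (obj A n),
      ∀ U F, Valid n U F → M ≫ (Quiv.pull f).map (π A n U F) = h U F := by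
  let M₀ : Z ⟶ (Quiv.pull f).obj (raw A n) :=
    ⟨fun a b => LinearMap.pi fun g => (h g.U g.F).app a b⟩
  have h₀ : ∀ U F, Valid n U F → M₀ ≫ (Quiv.pull f).map (rawProj A n U F) = h U F :=
    fun U F hv => congrArg (fun t => M₀ ≫ (Quiv.pull f).map t) (rawProj_idx A ⟨U, F, hv⟩)
  have h₁ : ∀ b, M₀ ≫ (Quiv.pull f).map (tanMap A n ≫ Quiv.proj _ b) = 0 := fun b => by
    rw [tanMap, Quiv.piLift_proj, Functor.map_sub, Preadditive.comp_sub, sub_eq_zero]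
    -- The sign from moving the multiplication past earlier beads cancels against the term ℓ(S)
    -- dim(U^{<k}), which leaves the sign of the hypothesis `H`.
    simp only [tanL, tanR, tanSign_eq, Functor.map_sum, Preadditive.comp_sum,
      Functor.map_units_smul, Linear.comp_units_smul]
    refine Eq.trans (Finset.sum_congr rfl fun c _ => congrArg _ ?_) ((H b).trans
      (Finset.sum_congr rfl fun j _ => congrArg _ ?_))
    · refine (congrArg (M₀ ≫ ·) ((Quiv.pull f).map_comp _ _)).trans ?_
      refine (Category.assoc _ _ _).symm.trans ?_
      rw [h₀ _ _ (valid_cut b.valid c)]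
      rfl
    · exact (h₀ _ _ (valid_face b.valid j)).symm
  -- The same maps with the pullback unfolded in the codomain, so that the range can be restricted
  -- to the kernel at each pair of vertices.
  let φ : ∀ a b, Z a b →ₗ[K] (raw A n) (f a) (f b) := fun a b => M₀.app a b
  have h₂ : ∀ a b x, φ a b x ∈ LinearMap.ker ((tanMap A n).app (f a) (f b)) :=
    fun a b x => LinearMap.mem_ker.mpr (funext fun i =>
      congrArg (fun t : Z ⟶ (Quiv.pull f).obj _ => t.app a b x) (h₁ i))
  let M : Z ⟶ (Quiv.pull f).obj (obj A n) :=
    ⟨fun a b => LinearMap.codRestrict (LinearMap.ker ((tanMap A n).app (f a) (f b))) (φ a b) (h₂ a b)⟩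
  exact ⟨M, h₀⟩

/-- Recorded while both sides still unfold; they are locally irreducible in the sections below. -/
theorem counit_eq : counit A = π A 0 [] [] := rfl

/-- The action of the vertex map on the component at the exhausting necklace is the component at the
image chain. That chain is `G`, which is strictly increasing, so ē is the identity. -/
theorem π_eq_map_vtx {U G : List ℕ} (hv : Valid n U G) :
    π A n U G = map (vtx hv.weak) ≫ π A U.sum U (List.range' 1 U.sum) := by
  refine Eq.symm ((map_π (A := A) (vtx hv.weak) (valid_range' hv.pos)).trans ?_)
  have e : (List.range' 1 U.sum).map (Fint.Hom.nat (vtx hv.weak)) = G := by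
    conv_rhs => rw [← map_vertex_range' 0 G, hv.len]
    exact List.map_congr_left fun x _ => nat_vtx hv.weak x
  rw [e, extend_valid _ hv]

/-- The exhausting necklace is the wedge of its first bead with the exhausting necklace on the
others, so this is the defining property of the nerve's comultiplication, up to the unitor of a
one-bead tensor product. -/
theorem π_cons {i : ℕ} (hi : 0 < i) {U : List ℕ} (hU : ∀ m ∈ U, 0 < m) :
    π A (i + U.sum) (i :: U) (List.range' 1 (i + U.sum)) =
      comul A i U.sum ≫ ((π A i [i] (List.range' 1 i) ≫ (ρ_ (A.sus i)).hom) ⊗ₘ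
        π A U.sum U (List.range' 1 U.sum)) := by
  have h₁ : Valid i [i] (List.range' 1 i) := by
    simpa using valid_range' (U := [i]) (by simpa using hi)
  have h := comul_π (A := A) h₁ (valid_range' hU)
  have e : List.range' 1 i ++ shift i (List.range' 1 U.sum) = List.range' 1 (i + U.sum) := by
    rw [shift, List.map_add_range', add_comm i 1, List.range'_append_1]
  rw [comulComp, e, split_single] at h
  have h' := congrArg (· ≫ (ρ_ (A.sus i)).hom ▷ tens A.sus U) h
  simp only [Category.assoc] at h'
  rw [← tensorHom_id, tensorHom_comp_tensorHom, Category.comp_id] at h'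
  refine Eq.symm (h'.trans ?_)
  have e' : (ρ_ (A.sus i)).inv ▷ tens A.sus U ≫ ((ρ_ (A.sus i)).hom ⊗ₘ 𝟙 (tens A.sus U)) = 𝟙 _ := by
    rw [tensorHom_id, inv_hom_whiskerRight]
  exact (congrArg (π A (i + U.sum) (i :: U) (List.range' 1 (i + U.sum)) ≫ ·) e').trans
    (Category.comp_id _)

theorem insertAt_nil_rightUnitor {D : Type*} [Category D] [MonoidalCategory D] {ι : Type*}
    (Q : ι → D) (S : List ι) {d : ι} (m : tens Q S ⟶ Q d) :
    insertAt Q [] m [] ≫ (ρ_ (Q d)).hom = eqToHom (congrArg (tens Q) (List.append_nil S)) ≫ m := by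
  change ((split Q S []).hom ≫ m ▷ 𝟙_ D) ≫ (ρ_ (Q d)).hom = _
  rw [split_nil]
  simp

/-- The image of the edge 0, 1 under [1] → [0] is the repeated chain 0, 0, where ē inserts the unit
of 𝒜. -/
theorem map_degen_zero (j : Fin (0 + 1)) :
    map (Fint.degen j) ≫ π A 1 [1] (List.range' 1 1) ≫ (ρ_ (A.sus 1)).hom =
      π A 0 [] [] ≫ A.susUnit := by
  have h : map (Fint.degen j) ≫ π A 1 [1] (List.range' 1 1) = _ :=
    map_π (A := A) (Fint.degen j) (valid_range' (U := [1]) (by simp))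
  have e : (List.range' 1 1).map (Fint.Hom.nat (Fint.degen j)) = [0] := by
    have := Fint.nat_degen j (i := 1) (by omega)
    simp [this]
  rw [← Category.assoc, h, e, extend_unit, extend_nil, Category.assoc]
  refine congrArg (π A 0 [] [] ≫ ·) ((insertAt_nil_rightUnitor A.sus [] A.susUnit).trans ?_)
  exact Category.id_comp _

theorem map_degen_pos {n : ℕ} (hn : 0 < n) (j : Fin (n + 1)) :
    map (Fint.degen j) ≫ π A (n + 1) [n + 1] (List.range' 1 (n + 1)) = 0 := by
  have hv : Valid (n + 1) [n + 1] (List.range' 1 (n + 1)) := by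
    simpa using valid_range' (U := [n + 1]) (by simp)
  refine (map_π (A := A) (Fint.degen j) hv).trans ?_
  have hw := hv.weak.map (m := ⟨n + 1⟩) (Fint.degen j)
  set G := (List.range' 1 (n + 1)).map (Fint.Hom.nat (Fint.degen j)) with hG
  have hl : G.length = n + 1 := by simp [hG]
  -- A chain of n + 1 strict steps starting at 0 would end at n + 1 or later, but this one ends at
  -- n.
  have hc : ¬ (0 :: G).IsChain (· ≠ ·) := fun hc => by
    have h1 := red_lt hw.chain
    rw [red_eq_of_chain hc] at h1
    have h2 := length_le_endOf h1
    rw [hw.last] at h2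
    simp only at h2
    omega
  have := extend_zero (A := A) (𝓕 := 𝟭 _) (h := π A n) hc (by omega) [] []
  rwa [List.append_nil, hl] at this

/-- A face is injective, so it acts by relabelling vertices, and the image of the standard chain is
the longer standard chain with one vertex erased. -/
theorem map_face_π {d : ℕ} (j : Fin d) :
    map (Fint.face j) ≫ π A d [d] (List.range' 1 d) =
      π A (d + 1) [d] ((List.range' 1 (d + 1)).eraseIdx j) := by
  have hj := j.isLt
  have hv : Valid d [d] (List.range' 1 d) := by
    simpa using valid_range' (U := [d]) (by simp; omega)
  have hv' : Valid (d + 1) [d + 1] (List.range' 1 (d + 1)) := by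
    simpa using valid_range' (U := [d + 1]) (by simp)
  have hw : Valid (d + 1) [d] ((List.range' 1 (d + 1)).eraseIdx j) := by
    simpa using valid_face (U₁ := []) (U₂ := []) hv' j
  refine (map_π (A := A) (Fint.face j) hv).trans ?_
  have hl : ((List.range' 1 (d + 1)).eraseIdx j).length = d := by simpa using hw.len
  have e : (List.range' 1 d).map (Fint.Hom.nat (Fint.face j)) =
      (List.range' 1 (d + 1)).eraseIdx j := by
    conv_rhs => rw [← map_vertex_range' 0 ((List.range' 1 (d + 1)).eraseIdx j), hl]
    refine List.map_congr_left fun x hx => ?_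
    have hx' : x ≤ d := by simp at hx; omega
    rw [Fint.nat_face j hx', vertex_eraseIdx _ _ _ _ (by simp), vertex_range']
    split_ifs <;> omega
  rw [e, extend_valid _ hw]

/-- The relation of the nerve for the unique bead of a simplex. -/
theorem tan_simplex (d : ℕ) :
    ∑ c : Composition (d + 1), Int.negOnePow (sig c.blocks) •
      (π A (d + 1) c.blocks (List.range' 1 (d + 1)) ≫
        A.susMul c.blocks d (blocks_ne_nil c) c.blocks_sum) =
    ∑ j : Fin d, Int.negOnePow (j : ℤ) •
      (map (Fint.face j) ≫ π A d [d] (List.range' 1 d) ≫ (ρ_ (A.sus d)).hom) := by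
  have hv : Valid (d + 1) [d + 1] (List.range' 1 (d + 1)) := by
    simpa using valid_range' (U := [d + 1]) (by simp)
  have h := (TAN_iff _ _ _ _).mp (π_tan (A := A) ⟨[], d, [], List.range' 1 (d + 1), hv⟩)
  have h' := congrArg (· ≫ (ρ_ (A.sus d)).hom) h
  simp only [Preadditive.sum_comp, Linear.units_smul_comp] at h'
  refine Eq.trans (Finset.sum_congr rfl fun c _ => congrArg _ ?_) (h'.trans
    (Finset.sum_congr rfl fun j _ => congrArg _ ?_))
  -- With no beads before or after it, the insertion of the multiplication is the multiplication
  -- itself, up to the empty list and the unit object on the right.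
  · refine Eq.symm ((Category.assoc _ _ _).trans ?_)
    refine (congrArg (π A (d + 1) (c.blocks ++ []) (List.range' 1 (d + 1)) ≫ ·)
      (insertAt_nil_rightUnitor A.sus c.blocks _)).trans ?_
    refine (Category.assoc _ _ _).symm.trans ?_
    exact congrArg (· ≫ A.susMul c.blocks d (blocks_ne_nil c) c.blocks_sum)
      (apply_eqToHom' (π A (d + 1)) _ (List.append_nil c.blocks))
  · rw [← Category.assoc, map_face_π, List.sum_nil, zero_add]
    rfl

end Nerve

/-! ### A map to the nerve is determined by its projections -/

noncomputable section

variable {K : Type u} [Field K] {X : TemplicialVect K}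

namespace TempHom

section

variable {P : Type u} {Y : Fintᵒᵖ ⥤ Quiv K P} [Y.OplaxMonoidal] {hY : IsIso (η Y)}

/-- The map on vertices. -/
def fn (α : TempHom X ⟨P, Y, hY⟩) : X.O → P := α.obj

/-- The map on simplices. -/
def val (α : TempHom X ⟨P, Y, hY⟩) (m : Fintᵒᵖ) : X.X.obj m ⟶ (Quiv.pull α.fn).obj (Y.obj m) :=
  α.app.app m

variable (α : TempHom X ⟨P, Y, hY⟩)

/-- This and the next two are the axioms of a templicial map for an abstract target functor `Y`, so
that specializing them to the nerve does not require unfolding the nerve. -/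
theorem map_val {m n : Fintᵒᵖ} (φ : m ⟶ n) :
    X.X.map φ ≫ α.val n = α.val m ≫ (Quiv.pull α.fn).map (Y.map φ) :=
  α.app.naturality φ

theorem val_comul (m n : Fintᵒᵖ) :
    α.val (m ⊗ n) ≫ (Quiv.pull α.fn).map (δ Y m n) =
      conv X.X (Quiv.pull α.fn) (α.val m) (α.val n) :=
  α.comul m n

theorem val_counit :
    α.val (𝟙_ Fintᵒᵖ) ≫ (Quiv.pull α.fn).map (η Y) = η X.X ≫ ε (Quiv.pull α.fn) :=
  α.counit

end

attribute [local irreducible] Nerve.obj Nerve.map Nerve.comul Nerve.counit Nerve.π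

variable {A : AInfCat K} (α : TempHom X (nerve A))

/-- The value of a map to the nerve on `n`-simplices. -/
def nval (n : ℕ) : X.X.obj (Opposite.op ⟨n⟩) ⟶ (Quiv.pull α.fn).obj (Nerve.obj A.alg n) :=
  α.val (Opposite.op ⟨n⟩)

theorem map_nval {m n : ℕ} (φ : (⟨m⟩ : Fint) ⟶ ⟨n⟩) :
    X.X.map φ.op ≫ α.nval m = α.nval n ≫ (Quiv.pull α.fn).map (Nerve.map φ) :=
  α.map_val φ.op

theorem nval_comul (p q : ℕ) :
    α.nval (p + q) ≫ (Quiv.pull α.fn).map (Nerve.comul A.alg p q) =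
      conv X.X (Quiv.pull α.fn) (a := Opposite.op ⟨p⟩)
        (b := Opposite.op ⟨q⟩) (α.nval p) (α.nval q) :=
  α.val_comul (Opposite.op ⟨p⟩) (Opposite.op ⟨q⟩)

theorem nval_counit :
    α.nval 0 ≫ (Quiv.pull α.fn).map (Nerve.counit A.alg) =
      (η X.X : X.X.obj (Opposite.op ⟨0⟩) ⟶ 𝟙_ _) ≫ ε (Quiv.pull α.fn) :=
  α.val_counit

/-- The projection of a map to the nerve to `A`. -/
def proj (n : ℕ) : X.X.obj (Opposite.op ⟨n⟩) ⟶ (Quiv.pull α.fn).obj (A.alg.sus n) :=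
  MapData.ofHom α n

/-- Induction on the beads: `π_cons` writes the component through the comultiplication of the nerve,
and compatibility of α with comultiplications turns it into a convolution whose first factor is the
projection. -/
theorem nval_range' {U : List ℕ} (hU : ∀ m ∈ U, 0 < m) :
    α.nval U.sum ≫ (Quiv.pull α.fn).map
        (Nerve.π A.alg U.sum U (List.range' 1 U.sum)) =
      comulTens X.X (Quiv.pull α.fn) α.proj U := by
  induction U with
  | nil =>
    have h := α.nval_counit
    rw [Nerve.counit_eq] at h
    exact h
  | cons i U ih =>
    have hU' : ∀ m ∈ U, 0 < m := fun m hm => hU m (by simp [hm])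
    have e := Nerve.π_cons (A := A.alg) (hU i (by simp)) hU'
    refine (congrArg (α.nval (i + U.sum) ≫
      (Quiv.pull α.fn).map ·) e).trans ?_
    rw [Functor.map_comp, ← Category.assoc, nval_comul]
    refine (conv_map (X := X.X) (F := Quiv.pull α.fn)
      (a := Opposite.op ⟨i⟩) (b := Opposite.op ⟨U.sum⟩) _ _ _ _).trans ?_
    rw [ih hU']
    rfl

/-- The components of a map to the nerve are determined by its projections to `A`. -/
theorem nval_π {n : ℕ} {U G : List ℕ} (hv : Valid n U G) :
    α.nval n ≫ (Quiv.pull α.fn).map (Nerve.π A.alg n U G) =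
      neckComp X.X (Quiv.pull α.fn) α.proj n U G := by
  -- Naturality of α moves the vertex map from the nerve to `X`, which leaves the exhausting
  -- necklace.
  rw [Nerve.π_eq_map_vtx hv, Functor.map_comp, ← Category.assoc, ← map_nval, Category.assoc,
    nval_range' α hv.pos, neckComp, dif_pos hv.weak]

end TempHom

end

/-! ### Translation into the conditions of the theorem -/

namespace MapData

variable {K : Type u} [Field K] {X : TemplicialVect K} {A : AInfCat K} {f : X.O → A.Obj}
  {β : ∀ n, X.X.obj (Opposite.op ⟨n⟩) ⟶ (Quiv.pull f).obj (A.alg.sus n)}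

theorem comp_tensor_assoc {C : Type*} [Category C] [MonoidalCategory C] {x a b a' c d b' y : C}
    (δ : x ⟶ a ⊗ b) (f : a ⟶ a') (g : b ⟶ c) (h : c ⟶ d) (k : d ⟶ b') (m : a' ⊗ b' ⟶ y) :
    δ ≫ (f ⊗ₘ (g ≫ h ≫ k)) ≫ m = (δ ≫ a ◁ g) ≫ (f ⊗ₘ h) ≫ a' ◁ k ≫ m := by
  simp only [← id_tensorHom, Category.assoc, tensorHom_comp_tensorHom_assoc, Category.id_comp,
    Category.comp_id]

/-- The iterated convolution alternates comultiplications of `X`, the maps β and structure maps of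
the pullback. Interchange in the monoidal category collects these into the three stages of the
formula in the theorem. -/
theorem comulTens_eq (U : List ℕ) (hU : ∀ m ∈ U, 0 < m) :
    comulTens X.X (Quiv.pull f) β U =
      X.comulSum U ≫ tensHom (Q := X.spx) (R := A.pull f) (fun n _ => β n) U hU ≫
        laxTens (Quiv.pull f) A.alg.sus U := by
  induction U with
  | nil => exact congrArg (X.counit ≫ ·) (Category.id_comp _).symm
  | cons i U ih =>
    have hU' : ∀ m ∈ U, 0 < m := fun m hm => hU m (by simp [hm])
    refine (congrArg (fun t => conv X.X (Quiv.pull f) (a := Opposite.op ⟨i⟩)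
      (b := Opposite.op ⟨U.sum⟩) (β i) t) (ih hU')).trans ?_
    exact comp_tensor_assoc (X.comul i U.sum) (β i) (X.comulSum U)
      (tensHom (Q := X.spx) (R := A.pull f) (fun n _ => β n) U hU')
      (laxTens (Quiv.pull f) A.alg.sus U) (μ (Quiv.pull f) _ _)

theorem degen_iff : Degen f (fun n _ => β n) ↔ DegenRel X.X (Quiv.pull f) β :=
  ⟨fun h => ⟨h.1, fun hn => h.2 _ hn⟩, fun h => ⟨h.zero, fun _ hn => h.pos hn⟩⟩

theorem comulTensTo_mul {d : ℕ} (c : Composition (d + 1)) :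
    X.comulList (d + 1) c.blocks c.blocks_sum ≫
        tensHom (Q := X.spx) (R := A.pull f) (fun n _ => β n) c.blocks
          (fun _ h => c.blocks_pos h) ≫
        A.mulPull f c.blocks d (blocks_ne_nil c) c.blocks_sum =
      comulTensTo X.X (Quiv.pull f) β c.blocks c.blocks_sum ≫
        (Quiv.pull f).map (A.alg.susMul c.blocks d (blocks_ne_nil c) c.blocks_sum) := by
  rw [comulTensTo, comulTens_eq _ (fun _ h => c.blocks_pos h), TemplicialVect.comulList,
    AInfCat.mulPull]
  simp only [Category.assoc]
  rfl

/-- The one-block summand is ∂β. The list is a variable so that the blocks of a composition can be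
put in its place. -/
theorem comulTensTo_single_mul (S : List ℕ) (d : ℕ) (hS : S = [d + 1]) (h₁ h₂) :
    comulTensTo X.X (Quiv.pull f) β S h₂ ≫ (Quiv.pull f).map (A.alg.susMul S d h₁ h₂) =
      β (d + 1) ≫ A.diff f d := by
  subst hS
  rw [comulTensTo_single, Category.assoc, ← Functor.map_comp]
  rfl

/-- The term ∂β_n is the summand l = 1 of the sum over all compositions, so solving for it exchanges
the two forms of the relation. -/
theorem diff_iff : Diff f (fun n _ => β n) ↔ ∀ d, SimplexRel X.X (Quiv.pull f) β d := by
  refine forall_congr' fun d => ?_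
  have h₁ : ∑ c : Composition (d + 1) with ¬ 2 ≤ c.length, Int.negOnePow (sig c.blocks) •
      (comulTensTo X.X (Quiv.pull f) β c.blocks c.blocks_sum ≫
        (Quiv.pull f).map (A.alg.susMul c.blocks d (blocks_ne_nil c) c.blocks_sum)) =
      β (d + 1) ≫ A.diff f d := by
    -- A composition of a positive number with fewer than two blocks has exactly one. Its sign is
    -- +1, since ε of a one-term list is 0.
    rw [Finset.sum_eq_single (Composition.single (d + 1) d.succ_pos)]
    · rw [comulTensTo_single_mul _ _ (Composition.single_blocks _)]
      simp [sig, Composition.single_blocks]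
      exact one_smul _ _
    · intro c hc hne
      refine absurd ((Composition.eq_single_iff_length d.succ_pos).mpr ?_) hne
      have := c.length_pos_of_pos d.succ_pos
      have := (Finset.mem_filter.mp hc).2
      omega
    · intro h
      simp at h
  have h₂ := Finset.sum_filter_add_sum_filter_not Finset.univ
    (fun c : Composition (d + 1) => 2 ≤ c.length) (fun c => Int.negOnePow (sig c.blocks) •
      (comulTensTo X.X (Quiv.pull f) β c.blocks c.blocks_sum ≫
        (Quiv.pull f).map (A.alg.susMul c.blocks d (blocks_ne_nil c) c.blocks_sum)))
  rw [h₁] at h₂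
  unfold SimplexRel
  rw [← h₂]
  refine Iff.trans ?_ eq_sub_iff_add_eq'
  refine Iff.of_eq (congrArg (β (d + 1) ≫ A.diff f d = ·) (congrArg₂ (· - ·) rfl
    (Finset.sum_congr rfl fun c _ => congrArg _ (comulTensTo_mul c))))

/-- The theorem prescribes β only in positive degrees, while convolutions use a family indexed by
all of ℕ. Beads have positive dimension, so the value in degree 0 never enters. -/
theorem comulTens_congr {β' : ∀ n, X.X.obj (Opposite.op ⟨n⟩) ⟶ (Quiv.pull f).obj (A.alg.sus n)}
    (h : ∀ n, 0 < n → β n = β' n) {U : List ℕ} (hU : ∀ m ∈ U, 0 < m) :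
    comulTens X.X (Quiv.pull f) β U = comulTens X.X (Quiv.pull f) β' U := by
  induction U with
  | nil => rfl
  | cons i U ih =>
    rw [comulTens, comulTens, h i (hU i (by simp)), ih fun m hm => hU m (by simp [hm])]

theorem neckComp_congr {β' : ∀ n, X.X.obj (Opposite.op ⟨n⟩) ⟶ (Quiv.pull f).obj (A.alg.sus n)}
    (h : ∀ n, 0 < n → β n = β' n) {n : ℕ} {U G : List ℕ} (hv : Valid n U G) :
    neckComp X.X (Quiv.pull f) β n U G = neckComp X.X (Quiv.pull f) β' n U G := by
  rw [neckComp, neckComp, dif_pos hv.weak, dif_pos hv.weak, comulTens_congr h hv.pos]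

end MapData

/-! ### The projections satisfy the conditions and are jointly injective -/

noncomputable section

variable {K : Type u} [Field K]

attribute [local irreducible] Nerve.obj Nerve.map Nerve.comul Nerve.counit Nerve.π

namespace TempHom

variable {X : TemplicialVect K} {A : AInfCat K} (α : TempHom X (nerve A))

theorem proj_eq (n : ℕ) : α.proj n = α.nval n ≫ (Quiv.pull α.fn).map
    (Nerve.π A.alg n [n] (List.range' 1 n) ≫ (ρ_ (A.alg.sus n)).hom) := rfl

theorem map_proj {m n : ℕ} (φ : (⟨m⟩ : Fint) ⟶ ⟨n⟩) :
    X.X.map φ.op ≫ α.proj m = α.nval n ≫ (Quiv.pull α.fn).map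
      (Nerve.map φ ≫ Nerve.π A.alg m [m] (List.range' 1 m) ≫ (ρ_ (A.alg.sus m)).hom) := by
  rw [proj_eq, ← Category.assoc, map_nval, Category.assoc, ← Functor.map_comp]

/-- Naturality reduces both cases to the degeneracies of the nerve. In degree 0 the counit of the
nerve appears, and compatibility of α with counits replaces it by that of `X`. -/
theorem degenRel_proj : DegenRel X.X (Quiv.pull α.fn) α.proj where
  zero j := by
    refine (α.map_proj (Fint.degen j)).trans ?_
    refine (congrArg (fun t => α.nval 0 ≫ (Quiv.pull α.fn).map t)
      (Nerve.map_degen_zero (A := A.alg) j)).trans ?_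
    rw [Functor.map_comp, ← Category.assoc, ← Nerve.counit_eq]
    refine (congrArg (· ≫ (Quiv.pull α.fn).map A.alg.susUnit) α.nval_counit).trans ?_
    exact Category.assoc _ _ _
  pos hn j := by
    refine (α.map_proj (Fint.degen j)).trans ?_
    rw [← Category.assoc (Nerve.map _), Nerve.map_degen_pos hn, Limits.zero_comp,
      Functor.map_zero, Limits.comp_zero]

/-- The nerve relation `Nerve.tan_simplex`, precomposed with α: its cut components are convolutions
by `nval_π`, and its faces move to `X` by naturality. -/
theorem simplexRel_proj (d : ℕ) : SimplexRel X.X (Quiv.pull α.fn) α.proj d := by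
  have h := congrArg (fun t => α.nval (d + 1) ≫ (Quiv.pull α.fn).map t)
    (Nerve.tan_simplex (A := A.alg) d)
  simp only [Functor.map_sum, Preadditive.comp_sum, Functor.map_units_smul,
    Linear.comp_units_smul] at h
  refine Eq.trans (Finset.sum_congr rfl fun c _ => congrArg _ ?_) (h.trans
    (Finset.sum_congr rfl fun j _ => congrArg _ (α.map_proj (Fint.face j)).symm))
  have hv : Valid (d + 1) c.blocks (List.range' 1 (d + 1)) := by
    simpa only [c.blocks_sum] using valid_range' (U := c.blocks) fun m hm => c.blocks_pos hm
  -- A cut of the full simplex has all the vertices in order, so its simplex operator is the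
  -- identity.
  have e := neckComp_of_nat X.X (Quiv.pull α.fn) α.proj hv.weak c.blocks_sum (𝟙 _) fun x hx => by
    rw [Fint.Hom.nat_id]
    exact ((vertex_range' 0 _ x).trans (zero_add _)).symm
  rw [Functor.map_comp, ← Category.assoc, α.nval_π hv, e, op_id, X.X.map_id, Category.id_comp]

/-- A map to the nerve is determined by its projections to `A`. -/
theorem eq_of_ofHom {α α' : TempHom X (nerve A)}
    (h : (⟨α.obj, fun n _ => MapData.ofHom α n⟩ :
        Σ f : X.O → A.Obj, ∀ n : ℕ, 0 < n → (X.spx n ⟶ A.pull f n)) =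
      ⟨α'.obj, fun n _ => MapData.ofHom α' n⟩) : α = α' := by
  obtain ⟨f, a, h₁, h₂⟩ := α
  obtain ⟨f', a', h₁', h₂'⟩ := α'
  obtain rfl : f = f' := congrArg Sigma.fst h
  have h' := eq_of_heq (Sigma.mk.inj h).2
  suffices a = a' by subst this; rfl
  -- Maps into the nerve are compared component by component, and each component is a `neckComp` of
  -- the projections in positive degrees.
  refine NatTrans.ext (funext fun m => ?_)
  refine Nerve.pull_hom_ext (A := A.alg) f (n := m.unop.len) fun U G hv => ?_
  refine (nval_π ⟨f, a, h₁, h₂⟩ hv).trans (Eq.trans ?_ (nval_π ⟨f, a', h₁', h₂'⟩ hv).symm)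
  exact MapData.neckComp_congr (fun n hn => congrFun (congrFun h' n) hn) hv

end TempHom

/-! ### Assembling a map to the nerve from its components -/

namespace Nerve

variable {O P : Type u} {A : AInf (Quiv K P)} {X : Fintᵒᵖ ⥤ Quiv K O} [X.OplaxMonoidal]
  {f : O → P} {β : ∀ n, X.obj (Opposite.op ⟨n⟩) ⟶ (Quiv.pull f).obj (A.sus n)}
  {M : ∀ n, X.obj (Opposite.op ⟨n⟩) ⟶ (Quiv.pull f).obj (obj A n)}

/-- The bead relations are exactly what allows the components to be lifted to the kernel that
defines the nerve. -/
theorem exists_components (h : ∀ d, SimplexRel X (Quiv.pull f) β d) (n : ℕ) :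
    ∃ M : X.obj (Opposite.op ⟨n⟩) ⟶ (Quiv.pull f).obj (obj A n), ∀ U G, Valid n U G →
      M ≫ (Quiv.pull f).map (π A n U G) = neckComp X (Quiv.pull f) β n U G :=
  exists_pull_lift f _ fun b => beadRel h b.valid

/-- On the side of `X`, the operator φ yields `neckComp` at a possibly non-injective necklace map.
On the side of the nerve it yields ē applied to the component at the injective part. The degeneracy
condition identifies the two. -/
theorem map_components (hβ : DegenRel X (Quiv.pull f) β)
    (hM : ∀ n U G, Valid n U G →
      M n ≫ (Quiv.pull f).map (π A n U G) = neckComp X (Quiv.pull f) β n U G)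
    {m n : Fint} (φ : m ⟶ n) :
    X.map φ.op ≫ M m.len = M n.len ≫ (Quiv.pull f).map (map φ) := by
  refine pull_hom_ext f fun U G hv => ?_
  have hw := hv.weak.map φ
  rw [Category.assoc, Category.assoc, hM _ _ _ hv, ← Functor.map_comp, map_π φ hv]
  refine (map_neckComp X (Quiv.pull f) β φ hv.weak).trans ((neckComp_eq_ebar hβ hw).trans ?_)
  rw [← hM _ _ _ hw.red, Category.assoc, ← Functor.map_comp]
  rfl

/-- Tested on pairs of components, the comultiplication of the nerve reads off the component at a
wedge, where `neckComp_split` applies. -/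
theorem components_comul
    (hM : ∀ n U G, Valid n U G →
      M n ≫ (Quiv.pull f).map (π A n U G) = neckComp X (Quiv.pull f) β n U G) (p q : ℕ) :
    M (p + q) ≫ (Quiv.pull f).map (comul A p q) =
      conv X (Quiv.pull f) (a := Opposite.op ⟨p⟩) (b := Opposite.op ⟨q⟩) (M p) (M q) := by
  refine pull_tensor_hom_ext f fun i j => ?_
  rw [Category.assoc, ← Functor.map_comp, comul_π i.valid j.valid, comulComp, Functor.map_comp,
    ← Category.assoc, hM _ _ _ (valid_append i.valid j.valid),
    neckComp_split X (Quiv.pull f) β i.valid.weak j.valid.weak, ← hM _ _ _ i.valid,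
    ← hM _ _ _ j.valid]
  exact (conv_map (X := X) (F := Quiv.pull f) (a := Opposite.op ⟨p⟩) (b := Opposite.op ⟨q⟩)
    _ _ _ _).symm

/-- The counit of the nerve is the component at the empty necklace, where `neckComp` is the empty
convolution. -/
theorem components_counit
    (hM : ∀ n U G, Valid n U G →
      M n ≫ (Quiv.pull f).map (π A n U G) = neckComp X (Quiv.pull f) β n U G) :
    M 0 ≫ (Quiv.pull f).map (counit A) =
      (η X : X.obj (Opposite.op ⟨0⟩) ⟶ 𝟙_ _) ≫ ε (Quiv.pull f) := by
  have e := neckComp_of_nat X (Quiv.pull f) β wvalid_nil rfl (𝟙 _) fun x hx => by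
    obtain rfl : x = 0 := Nat.le_zero.mp hx
    simp
  rw [counit_eq]
  refine (hM _ _ _ valid_zero).trans (e.trans ?_)
  refine (congrArg (· ≫ comulTensTo X (Quiv.pull f) β [] rfl)
    (X.map_id (Opposite.op ⟨0⟩))).trans ?_
  exact (Category.id_comp _).trans (Category.id_comp _)

/-- The identity necklace map of Δⁿ has one bead and the identity as vertex map, so the construction
returns the given β. -/
theorem components_single
    (hM : ∀ n U G, Valid n U G →
      M n ≫ (Quiv.pull f).map (π A n U G) = neckComp X (Quiv.pull f) β n U G) {n : ℕ}
    (hn : 0 < n) :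
    M n ≫ (Quiv.pull f).map (π A n [n] (List.range' 1 n) ≫ (ρ_ (A.sus n)).hom) = β n := by
  have hv : Valid n [n] (List.range' 1 n) := by
    simpa using valid_range' (U := [n]) (by simpa using hn)
  rw [Functor.map_comp, ← Category.assoc, hM _ _ _ hv,
    neckComp_single X (Quiv.pull f) β hv.weak (𝟙 _), op_id, X.map_id, Category.id_comp]
  intro x hx
  rw [Fint.Hom.nat_id]
  exact ((vertex_range' 0 _ x).trans (zero_add _)).symm

end Nerve

namespace TempHom

variable {X : TemplicialVect K} {A : AInfCat K} {f : X.O → A.Obj}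
  {β : ∀ n, X.X.obj (Opposite.op ⟨n⟩) ⟶ (Quiv.pull f).obj (A.alg.sus n)}

/-- The map to the nerve with given components. -/
def ofComponents (hβ : DegenRel X.X (Quiv.pull f) β)
    (M : ∀ n, X.X.obj (Opposite.op ⟨n⟩) ⟶ (Quiv.pull f).obj (Nerve.obj A.alg n))
    (hM : ∀ n U G, Valid n U G →
      M n ≫ (Quiv.pull f).map (Nerve.π A.alg n U G) = neckComp X.X (Quiv.pull f) β n U G) :
    TempHom X (nerve A) where
  obj := f
  app :=
    { app := fun m => M m.unop.len
      naturality := fun _ _ φ => Nerve.map_components hβ hM φ.unop }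
  comul m n := Nerve.components_comul hM m.unop.len n.unop.len
  counit := Nerve.components_counit hM

/-- A map to the nerve can be given by its projections to `A`. -/
theorem exists_ofHom_eq (hβ : DegenRel X.X (Quiv.pull f) β)
    (hβ' : ∀ d, SimplexRel X.X (Quiv.pull f) β d) :
    ∃ α : TempHom X (nerve A), (⟨α.obj, fun n _ => MapData.ofHom α n⟩ :
        Σ f : X.O → A.Obj, ∀ n : ℕ, 0 < n → (X.spx n ⟶ A.pull f n)) =
      ⟨f, fun n _ => β n⟩ := by
  choose M hM using Nerve.exists_components hβ'
  exact ⟨ofComponents hβ M hM, congrArg (Sigma.mk f) (funext fun n => funext fun hn =>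
    Nerve.components_single hM hn)⟩

end TempHom

end

end Templicial

theorem mainTheorem3 {K : Type u} [Field K] (X : Templicial.TemplicialVect K)
    (A : Templicial.AInfCat K) :
    Set.BijOn
      (fun α : Templicial.TempHom X (Templicial.nerve A) =>
        (⟨α.obj, fun n _ => Templicial.MapData.ofHom α n⟩ :
          Σ f : X.O → A.Obj, ∀ n : ℕ, 0 < n → (X.spx n ⟶ A.pull f n)))
      Set.univ
      {p | Templicial.MapData.Degen p.1 p.2 ∧ Templicial.MapData.Diff p.1 p.2} := by
  refine ⟨fun α _ => ?_, fun α _ α' _ h => ?_, ?_⟩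
  · exact ⟨Templicial.MapData.degen_iff.mpr α.degenRel_proj,
      Templicial.MapData.diff_iff.mpr α.simplexRel_proj⟩
  · exact Templicial.TempHom.eq_of_ofHom h
  · rintro ⟨f, β⟩ ⟨h₁, h₂⟩
    -- β is extended by zero to degree 0, which is harmless because the conditions and the
    -- components only involve positive degrees.
    obtain ⟨γ, rfl⟩ : ∃ γ : ∀ n, X.spx n ⟶ A.pull f n, (fun n _ => γ n) = β :=
      ⟨fun n => if hn : 0 < n then β n hn else 0, funext fun _ => funext fun hn => dif_pos hn⟩
    obtain ⟨α, hα⟩ := Templicial.TempHom.exists_ofHom_eq (Templicial.MapData.degen_iff.mp h₁)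
      (Templicial.MapData.diff_iff.mp h₂)
    exact ⟨α, trivial, hα⟩
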